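/- **Setting.** Consider $\min_{x\in X}\max_{y\in Y}\, g(x,y)+f(x)-h(y)$ with $g(x,y)=\mathbb{E}_{\zeta\sim D}[G(x,y,\zeta)]$, where $X\subset\mathbb{R}^{d_x}$, $Y\subset\mathbb{R}^{d_y}$ are nonempty, convex and compact, $f:X\to\mathbb{R}$ and $h:Y\to\mathbb{R}$ are convex and continuous (possibly nonsmooth), and, for every $\zeta$, $G(\cdot,\cdot,\zeta)$ is differentiable in $x$ and in $y$ on $X\times Y$ and concave in $y$. Assume (with the measurability and integrability in $\zeta$ that give the expectations a meaning): (A1) for some $l>0$ and every $\zeta$, $\nabla_xG(\cdot,\cdot,\zeta)$ and $\nabla_yG(\cdot,\cdot,\zeta)$ are $l$-Lipschitz in $x$ (for fixed $y$) and in $y$ (for fixed $x$) on $X\times Y$; (A2) for some $\delta>0$ and all $(x,y)\in X\times Y$, $\mathbb{E}\|\nabla_xG(x,y,\zeta)-\nabla_xg(x,y)\|^2\le\delta^2$ and $\mathbb{E}\|\nabla_yG(x,y,\zeta)-\nabla_yg(x,y)\|^2\le\delta^2$, where $\nabla_x g=\mathbb{E}[\nabla_xG]$ and $\nabla_y g=\mathbb{E}[\nabla_yG]$.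 For convex $\varphi$, a set $S$ and $\alpha>0$ let $\operatorname{Prox}^{1/\alpha}_{\varphi,S}(u)=\arg\min_{z\in S}\varphi(z)+\frac1{2\alpha}\|z-u\|^2$. For parameters $L,\beta,a_1,a_2,a_4,a_5,a_6$ and a batch size $b\ge1$ put $$\eta_k=\tfrac{1}{(k+2)^{5/13}},\quad \alpha_k=\tfrac{a_4}{(k+2)^{4/13}},\quad \rho_k=\tfrac{L}{(k+1)^{2/13}},\quad \gamma_k=\tfrac{a_5}{(k+2)^{12/13}},\quad \theta_k=\tfrac{a_6}{(k+2)^{8/13}},$$ $D^{(1)}_k=a_1(k+2)^{3/13}$, $D^{(2)}_k=a_2(k+2)^{3/13}$, where $L=l+\rho_1$, $0<\beta\le\frac1{6L}$, $$0<a_1,a_2\le\min\Big\{\tfrac{b}{32a_4L^2},\tfrac{ba_4}{2L\beta}\Big\},\quad 0<a_4\le\min\Big\{\tfrac1{8L},\tfrac{\beta}{8\sqrt5}\Big\},\quad a_5\ge\tfrac{4a_4}{a_1}+\tfrac{12}{13},\quad a_6\ge\tfrac{80a_4}{a_2}+\tfrac{12}{13},$$ and $\gamma_k,\theta_k\le1$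 for all $k\ge1$. **Algorithm FORMDA-NS.** Let $\tilde G_k(x,y,\zeta)=G(x,y,\zeta)-\frac{\rho_k}2\|y\|^2$, and for $I=(\zeta_1,\dots,\zeta_b)$ let $\nabla\tilde G_k(x,y;I)=\frac1b\sum_j\nabla\tilde G_k(x,y,\zeta_j)$. Start from deterministic $x_1\in X$, $y_1\in Y$, and put $\gamma_0=\theta_0=1$. In iteration $k\ge1$ draw a batch $I_k$ of $b$ samples (all samples of all iterations being i.i.d. with law $D$) and set $$v_k=\nabla_x\tilde G_k(x_k,y_k;I_k)+(1-\gamma_{k-1})[v_{k-1}-\nabla_x\tilde G_{k-1}(x_{k-1},y_{k-1};I_k)],$$ $$w_k=\nabla_y\tilde G_k(x_k,y_k;I_k)+(1-\theta_{k-1})[w_{k-1}-\nabla_y\tilde G_{k-1}(x_{k-1},y_{k-1};I_k)],$$ $$\tilde x_{k+1}=\operatorname{Prox}^{1/\alpha_k}_{f,X}(x_k-\alpha_kv_k),\quad x_{k+1}=x_k+\eta_k(\tilde x_{k+1}-x_k),$$ $$\tilde y_{k+1}=\operatorname{Prox}^{1/\beta}_{h,Y}(y_k+\beta w_k),\quad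 y_{k+1}=y_k+\eta_k(\tilde y_{k+1}-y_k).$$ The stationarity gap is $$\nabla\mathcal G^{\alpha,\beta}(x,y)=\Big(\tfrac1\alpha\big(x-\operatorname{Prox}^{1/\alpha}_{f,X}(x-\alpha\nabla_xg(x,y))\big),\ \tfrac1\beta\big(y-\operatorname{Prox}^{1/\beta}_{h,Y}(y+\beta\nabla_yg(x,y))\big)\Big),$$ and $T(\varepsilon)=\min\{k\ge1:\ \mathbb{E}\|\nabla\mathcal G^{\alpha_k,\beta}(x_k,y_k)\|\le\varepsilon\}$. **Constants.** Let $\sigma_y=\max_{y\in Y}\|y\|$, $g_k(x,y)=g(x,y)-\frac{\rho_k}2\|y\|^2$, $\Phi_k(x)=\max_{y\in Y}(g_k(x,y)-h(y))$, $y_k^*(x)=\arg\max_{y\in Y}(g_k(x,y)-h(y))$ and, for $k\ge0$ (with $\alpha_0,D_0^{(1)},D_0^{(2)}$ given by the formulas above at $k=0$), $$\begin{aligned}S_{k+1}={}&\mathbb{E}[\Phi_{k+1}(x_{k+1})+f(x_{k+1})]+D^{(1)}_k\mathbb{E}\|\nabla_xg_{k+1}(x_{k+1},y_{k+1})-v_{k+1}\|^2\\&+\tfrac{8\alpha_kL^2}{\beta\rho_{k+1}}\mathbb{E}\|y_{k+1}-y^*_{k+1}(x_{k+1})\|^2+D^{(2)}_k\mathbb{E}\|\nabla_yg_{k+1}(x_{k+1},y_{k+1})-w_{k+1}\|^2\\&-\tfrac{40\alpha_{k+1}L^2(\rho_{k+1}-\rho_{k+2})}{\eta_{k+1}\beta^2\rho_{k+2}^3}\mathbb{E}\|y^*_{k+1}(x_{k+1})\|^2+\tfrac{4D^{(2)}_{k+1}\rho_{k+1}^2\sigma_y^2}{b},\end{aligned}$$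 $\underline S=\inf_{k\ge1}S_k$, $$C_1=S_1-\underline S+\tfrac{\rho_1}2\sigma_y^2+\tfrac{40\alpha_1L^2\rho_1}{\eta_1\beta^2\rho_2^3}\sigma_y^2,\qquad C_2=\tfrac{2\delta^2(a_5^2a_1+a_6^2a_2)}b+\tfrac{12a_2L^2\sigma_y^2}{13b},$$ and let $0<d_1\le\min\{\frac18,L\beta,\frac{a_1a_5}{4a_4},\frac{a_2a_6}{4a_4}\}$. **Theorem.** The random variables $\|\nabla\mathcal G^{\alpha_k,\beta}(x_k,y_k)\|$, $k\ge1$, are integrable, $\underline S>-\infty$, and for every $\varepsilon>0$ the number $T(\varepsilon)$ is finite and $$T(\varepsilon)\le\max\Big\{\tilde T(\varepsilon),\ \Big(\frac{2L\sigma_y}{\varepsilon}\Big)^{13/2}-1\Big\}$$ for some integer $\tilde T(\varepsilon)\ge1$ such that either $\tilde T(\varepsilon)=1$ or, with $t=\tilde T(\varepsilon)-1$, $$\frac{\varepsilon^2}4\le\frac{C_1+C_2\ln(t+2)}{d_1a_4\big(\frac{13}4(t+3)^{4/13}-\frac{13\cdot3^{4/13}}4\big)}.$$ Consequently $T(\varepsilon)=\tilde{\mathcal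 O}(\varepsilon^{-6.5})$: there is a constant $C$ independent of $\varepsilon$ with $T(\varepsilon)\le C\,\varepsilon^{-13/2}\,(\ln(1/\varepsilon))^{13/4}$ for all $0<\varepsilon\le\frac12$. -/

import Mathlib

open MeasureTheory ProbabilityTheory

noncomputable section

namespace FORMDA

/-- The Euclidean space `ℝⁿ`. -/
abbrev Vec (n : ℕ) := EuclideanSpace ℝ (Fin n)

/-- The data of the problem `min_{x ∈ X} max_{y ∈ Y} 𝔼_{ζ ∼ D}[G(x, y, ζ)] + f(x) - h(y)`. -/
structure Problem (dx dy : ℕ) (Z : Type*) [MeasurableSpace Z] where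
  X : Set (Vec dx)
  Y : Set (Vec dy)
  G : Vec dx → Vec dy → Z → ℝ
  D : Measure Z
  f : Vec dx → ℝ
  h : Vec dy → ℝ

section Gradients

variable {dx dy : ℕ} {Z : Type*}

/-- The partial gradient `∇ₓ H(x, y, ζ)`. -/
def gradX (H : Vec dx → Vec dy → Z → ℝ) (x : Vec dx) (y : Vec dy) (ζ : Z) : Vec dx :=
  gradient (fun x' => H x' y ζ) x

/-- The partial gradient `∇_y H(x, y, ζ)`. -/
def gradY (H : Vec dx → Vec dy → Z → ℝ) (x : Vec dx) (y : Vec dy) (ζ : Z) : Vec dy :=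
  gradient (fun y' => H x y' ζ) y

/-- The mini-batch gradient `∇ₓ H(x, y; I) = (1/b) ∑ⱼ ∇ₓ H(x, y, ζⱼ)` for `I = (ζ₁, …, ζ_b)`. -/
def batchGradX {b : ℕ} (H : Vec dx → Vec dy → Z → ℝ) (x : Vec dx) (y : Vec dy)
    (I : Fin b → Z) : Vec dx :=
  (1 / (b : ℝ)) • ∑ j, gradX H x y (I j)

/-- The mini-batch gradient `∇_y H(x, y; I) = (1/b) ∑ⱼ ∇_y H(x, y, ζⱼ)` for `I = (ζ₁, …, ζ_b)`. -/
def batchGradY {b : ℕ} (H : Vec dx → Vec dy → Z → ℝ) (x : Vec dx) (y : Vec dy)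
    (I : Fin b → Z) : Vec dy :=
  (1 / (b : ℝ)) • ∑ j, gradY H x y (I j)

/-- `H` regularized: `H(x, y, ζ) - (ρ/2) ‖y‖²`. -/
def regularize (H : Vec dx → Vec dy → Z → ℝ) (ρ : ℝ) (x : Vec dx) (y : Vec dy) (ζ : Z) : ℝ :=
  H x y ζ - ρ / 2 * ‖y‖ ^ 2

end Gradients

/-- The proximity operator with step `α`: the minimizer over `z ∈ S` of
`φ(z) + (1 / (2α)) ‖z - u‖²`. -/
def prox {n : ℕ} (φ : Vec n → ℝ) (S : Set (Vec n)) (α : ℝ) (u : Vec n) : Vec n :=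
  Classical.epsilon fun z =>
    z ∈ S ∧ IsMinOn (fun z' => φ z' + 1 / (2 * α) * ‖z' - u‖ ^ 2) S z

/-- On a nonempty compact set and for continuous `φ` the minimizer defining `prox` exists. -/
theorem prox_spec {n : ℕ} {φ : Vec n → ℝ} {S : Set (Vec n)} (hS : IsCompact S)
    (hne : S.Nonempty) (hφ : ContinuousOn φ S) (α : ℝ) (u : Vec n) :
    prox φ S α u ∈ S ∧
      IsMinOn (fun z' => φ z' + 1 / (2 * α) * ‖z' - u‖ ^ 2) S (prox φ S α u) := by
  have hc : ContinuousOn (fun z' => φ z' + 1 / (2 * α) * ‖z' - u‖ ^ 2) S :=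
    hφ.add (by fun_prop)
  obtain ⟨z, hz, hmin⟩ := hS.exists_isMinOn hne hc
  exact Classical.epsilon_spec
    (p := fun z => z ∈ S ∧ IsMinOn (fun z' => φ z' + 1 / (2 * α) * ‖z' - u‖ ^ 2) S z)
    ⟨z, hz, hmin⟩

namespace Problem

variable {dx dy : ℕ} {Z : Type*} [MeasurableSpace Z]

/-- Standing assumptions on the problem: `X`, `Y` nonempty, convex, compact; `D` a probability
distribution; `G(·, ·, ζ)` differentiable in each variable on `X × Y` and concave in `y`;
`f`, `h` convex and continuous; and the measurability and integrability in `ζ` without which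
the expectations have no meaning. -/
structure Standing (p : Problem dx dy Z) : Prop where
  X_nonempty : p.X.Nonempty
  X_convex : Convex ℝ p.X
  X_compact : IsCompact p.X
  Y_nonempty : p.Y.Nonempty
  Y_convex : Convex ℝ p.Y
  Y_compact : IsCompact p.Y
  prob : IsProbabilityMeasure p.D
  diff_x : ∀ x ∈ p.X, ∀ y ∈ p.Y, ∀ ζ, DifferentiableAt ℝ (fun x' => p.G x' y ζ) x
  diff_y : ∀ x ∈ p.X, ∀ y ∈ p.Y, ∀ ζ, DifferentiableAt ℝ (fun y' => p.G x y' ζ) y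
  concave_y : ∀ x ∈ p.X, ∀ ζ, ConcaveOn ℝ p.Y (fun y => p.G x y ζ)
  f_convex : ConvexOn ℝ p.X p.f
  f_cont : ContinuousOn p.f p.X
  h_convex : ConvexOn ℝ p.Y p.h
  h_cont : ContinuousOn p.h p.Y
  G_integrable : ∀ x ∈ p.X, ∀ y ∈ p.Y, Integrable (p.G x y) p.D
  gradX_measurable : ∀ x ∈ p.X, ∀ y ∈ p.Y, Measurable (gradX p.G x y)
  gradY_measurable : ∀ x ∈ p.X, ∀ y ∈ p.Y, Measurable (gradY p.G x y)

/-- `l`-Lipschitz continuity of the partial gradients of `G(·, ·, ζ)` on `X × Y`, in each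
variable separately and for every `ζ`. -/
structure LipschitzGradients (p : Problem dx dy Z) (l : ℝ) : Prop where
  xx : ∀ x₁ ∈ p.X, ∀ x₂ ∈ p.X, ∀ y ∈ p.Y, ∀ ζ,
    ‖gradX p.G x₁ y ζ - gradX p.G x₂ y ζ‖ ≤ l * ‖x₁ - x₂‖
  xy : ∀ x ∈ p.X, ∀ y₁ ∈ p.Y, ∀ y₂ ∈ p.Y, ∀ ζ,
    ‖gradX p.G x y₁ ζ - gradX p.G x y₂ ζ‖ ≤ l * ‖y₁ - y₂‖
  yy : ∀ x ∈ p.X, ∀ y₁ ∈ p.Y, ∀ y₂ ∈ p.Y, ∀ ζ,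
    ‖gradY p.G x y₁ ζ - gradY p.G x y₂ ζ‖ ≤ l * ‖y₁ - y₂‖
  yx : ∀ x₁ ∈ p.X, ∀ x₂ ∈ p.X, ∀ y ∈ p.Y, ∀ ζ,
    ‖gradY p.G x₁ y ζ - gradY p.G x₂ y ζ‖ ≤ l * ‖x₁ - x₂‖

/-- `g(x, y) = 𝔼_{ζ ∼ D}[G(x, y, ζ)]`. -/
def g (p : Problem dx dy Z) (x : Vec dx) (y : Vec dy) : ℝ := ∫ ζ, p.G x y ζ ∂p.D

/-- The gradient `∇ₓ g(x, y) = 𝔼[∇ₓ G(x, y, ζ)]` on `X × Y`. Since `g` is only given on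
`X × Y`, where `X` may have empty interior, its gradient is the expected ambient gradient of
`G`; `hasGradientWithinAt_g_x` shows that it is a gradient of `g(·, y)` on `X` (the only one
if `X` has interior points). -/
def gGradX (p : Problem dx dy Z) (x : Vec dx) (y : Vec dy) : Vec dx :=
  ∫ ζ, gradX p.G x y ζ ∂p.D

/-- The gradient `∇_y g(x, y) = 𝔼[∇_y G(x, y, ζ)]` on `X × Y`; see `hasGradientWithinAt_g_y`. -/
def gGradY (p : Problem dx dy Z) (x : Vec dx) (y : Vec dy) : Vec dy :=
  ∫ ζ, gradY p.G x y ζ ∂p.D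

/-- The stochastic partial gradients have variance at most `δ²` on `X × Y`. -/
structure BoundedVariance (p : Problem dx dy Z) (δ : ℝ) : Prop where
  integrable_x : ∀ x ∈ p.X, ∀ y ∈ p.Y,
    Integrable (fun ζ => ‖gradX p.G x y ζ - p.gGradX x y‖ ^ 2) p.D
  integrable_y : ∀ x ∈ p.X, ∀ y ∈ p.Y,
    Integrable (fun ζ => ‖gradY p.G x y ζ - p.gGradY x y‖ ^ 2) p.D
  var_x : ∀ x ∈ p.X, ∀ y ∈ p.Y,
    ∫ ζ, ‖gradX p.G x y ζ - p.gGradX x y‖ ^ 2 ∂p.D ≤ δ ^ 2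
  var_y : ∀ x ∈ p.X, ∀ y ∈ p.Y,
    ∫ ζ, ‖gradY p.G x y ζ - p.gGradY x y‖ ^ 2 ∂p.D ≤ δ ^ 2

/-- Differentiation under the expectation, relative to a convex set. -/
theorem hasGradientWithinAt_integral {n : ℕ} {D : Measure Z} {φ : Vec n → Z → ℝ}
    {S : Set (Vec n)} {l : ℝ} (hS : Convex ℝ S)
    (hd : ∀ x ∈ S, ∀ ζ, DifferentiableAt ℝ (fun x' => φ x' ζ) x)
    (hl : ∀ x₁ ∈ S, ∀ x₂ ∈ S, ∀ ζ,
      ‖gradient (fun x' => φ x' ζ) x₁ - gradient (fun x' => φ x' ζ) x₂‖ ≤ l * ‖x₁ - x₂‖)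
    (hl0 : 0 ≤ l) [IsProbabilityMeasure D] (hi : ∀ x ∈ S, Integrable (φ x) D) {x : Vec n}
    (hx : x ∈ S) (hg : Integrable (fun ζ => gradient (fun x' => φ x' ζ) x) D) :
    HasGradientWithinAt (fun x' => ∫ ζ, φ x' ζ ∂D)
      (∫ ζ, gradient (fun x' => φ x' ζ) x ∂D) S x := by
  have key : ∀ x' ∈ S, ∀ ζ, ‖φ x' ζ - φ x ζ -
      inner ℝ (gradient (fun x' => φ x' ζ) x) (x' - x)‖ ≤ l * ‖x' - x‖ ^ 2 := by
    intro x' hx' ζ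
    have hseg : segment ℝ x x' ⊆ S := hS.segment_subset hx hx'
    have h1 := Convex.norm_image_sub_le_of_norm_hasFDerivWithin_le' (𝕜 := ℝ)
      (f := fun x' => φ x' ζ) (s := segment ℝ x x') (C := l * ‖x' - x‖)
      (f' := fun z => InnerProductSpace.toDual ℝ (Vec n) (gradient (fun x' => φ x' ζ) z))
      (φ := InnerProductSpace.toDual ℝ (Vec n) (gradient (fun x' => φ x' ζ) x))
      (fun z hz => ((hd z (hseg hz) ζ).hasGradientAt.hasFDerivAt).hasFDerivWithinAt)
      (fun z hz => by
        rw [← map_sub, LinearIsometryEquiv.norm_map]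
        refine (hl z (hseg hz) x hx ζ).trans (mul_le_mul_of_nonneg_left ?_ hl0)
        obtain ⟨a, b, ha, hb, hab, rfl⟩ := hz
        have : a • x + b • x' - x = b • (x' - x) := by
          have : a = 1 - b := by linarith
          subst this
          module
        rw [this, norm_smul, Real.norm_of_nonneg hb]
        exact mul_le_of_le_one_left (norm_nonneg _) (by linarith))
      (convex_segment x x') (left_mem_segment ℝ x x') (right_mem_segment ℝ x x')
    rw [InnerProductSpace.toDual_apply_apply] at h1
    calc _ ≤ _ := h1
      _ = _ := by ring
  rw [hasGradientWithinAt_iff_isLittleO]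
  have hO : (fun x' : Vec n => (∫ ζ, φ x' ζ ∂D) - (∫ ζ, φ x ζ ∂D) -
      inner ℝ (∫ ζ, gradient (fun x' => φ x' ζ) x ∂D) (x' - x))
      =O[nhdsWithin x S] fun x' => ‖x' - x‖ ^ 2 := by
    refine Asymptotics.IsBigO.of_bound l ?_
    filter_upwards [self_mem_nhdsWithin] with x' hx'
    have hin : Integrable (fun ζ => inner ℝ (gradient (fun x' => φ x' ζ) x) (x' - x)) D :=
      hg.inner_const _
    have e1 : inner ℝ (∫ ζ, gradient (fun x' => φ x' ζ) x ∂D) (x' - x) =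
        ∫ ζ, inner ℝ (gradient (fun x' => φ x' ζ) x) (x' - x) ∂D := by
      rw [real_inner_comm, ← integral_inner hg]
      simp_rw [real_inner_comm]
    have e2 : (∫ ζ, φ x' ζ ∂D) - (∫ ζ, φ x ζ ∂D) -
        ∫ ζ, inner ℝ (gradient (fun x' => φ x' ζ) x) (x' - x) ∂D =
        ∫ ζ, (φ x' ζ - φ x ζ - inner ℝ (gradient (fun x' => φ x' ζ) x) (x' - x)) ∂D := by
      have hs : Integrable (fun ζ => φ x' ζ - φ x ζ) D := (hi x' hx').sub (hi x hx)
      rw [integral_sub hs hin, integral_sub (hi x' hx') (hi x hx)]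
    rw [e1, e2]
    have h2 := norm_integral_le_of_norm_le_const (μ := D)
      (Filter.Eventually.of_forall (key x' hx'))
    simpa using h2
  refine hO.trans_isLittleO ?_
  have h3 : (fun z : Vec n => ‖z‖ ^ 2) =o[nhds 0] fun z => z :=
    Asymptotics.isLittleO_norm_pow_id one_lt_two
  have h4 : Filter.Tendsto (fun x' : Vec n => x' - x) (nhdsWithin x S) (nhds 0) := by
    have : ContinuousWithinAt (fun x' : Vec n => x' - x) S x := by fun_prop
    simpa [ContinuousWithinAt] using this
  exact h3.comp_tendsto h4

/-- A measurable map at finite mean-square distance from a constant is integrable. -/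
theorem integrable_of_sq {n : ℕ} {D : Measure Z} [IsProbabilityMeasure D] {u : Z → Vec n}
    (hu : Measurable u) (c : Vec n) (hi : Integrable (fun ζ => ‖u ζ - c‖ ^ 2) D) :
    Integrable u D := by
  have h1 : MemLp (fun ζ => u ζ - c) 2 D :=
    (memLp_two_iff_integrable_sq_norm (hu.sub_const c).aestronglyMeasurable).2 hi
  have h2 : Integrable (fun ζ => u ζ - c) D := h1.integrable (by norm_num)
  have h3 : Integrable (fun ζ => (u ζ - c) + c) D := h2.add (integrable_const c)
  simpa using h3

/-- `gGradX` is a gradient of `g(·, y)` on `X`. -/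
theorem hasGradientWithinAt_g_x {p : Problem dx dy Z} (hp : p.Standing) {l δ : ℝ} (hl0 : 0 ≤ l)
    (hl : p.LipschitzGradients l) (hv : p.BoundedVariance δ) {x : Vec dx} (hx : x ∈ p.X)
    {y : Vec dy} (hy : y ∈ p.Y) :
    HasGradientWithinAt (fun x' => p.g x' y) (p.gGradX x y) p.X x := by
  have := hp.prob
  exact hasGradientWithinAt_integral (φ := fun x' ζ => p.G x' y ζ) hp.X_convex
    (fun x hx ζ => hp.diff_x x hx y hy ζ) (fun x₁ h₁ x₂ h₂ ζ => hl.xx x₁ h₁ x₂ h₂ y hy ζ) hl0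
    (fun x hx => hp.G_integrable x hx y hy) hx
    (integrable_of_sq (hp.gradX_measurable x hx y hy) _ (hv.integrable_x x hx y hy))

/-- `gGradY` is a gradient of `g(x, ·)` on `Y`. -/
theorem hasGradientWithinAt_g_y {p : Problem dx dy Z} (hp : p.Standing) {l δ : ℝ} (hl0 : 0 ≤ l)
    (hl : p.LipschitzGradients l) (hv : p.BoundedVariance δ) {x : Vec dx} (hx : x ∈ p.X)
    {y : Vec dy} (hy : y ∈ p.Y) :
    HasGradientWithinAt (fun y' => p.g x y') (p.gGradY x y) p.Y y := by
  have := hp.prob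
  exact hasGradientWithinAt_integral (φ := fun y' ζ => p.G x y' ζ) hp.Y_convex
    (fun y hy ζ => hp.diff_y x hx y hy ζ) (fun y₁ h₁ y₂ h₂ ζ => hl.yy x hx y₁ h₁ y₂ h₂ ζ) hl0
    (fun y hy => hp.G_integrable x hx y hy) hy
    (integrable_of_sq (hp.gradY_measurable x hx y hy) _ (hv.integrable_y x hx y hy))

/-- `σ_y = max {‖y‖ : y ∈ Y}`. -/
def sigmaY (p : Problem dx dy Z) : ℝ := sSup ((fun y => ‖y‖) '' p.Y)

/-- The stationarity gap `∇𝒢^{α,β}(x, y)`, a vector of `ℝ^{dx} × ℝ^{dy}` with its Euclidean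
norm. -/
def gap (p : Problem dx dy Z) (α β : ℝ) (x : Vec dx) (y : Vec dy) :
    WithLp 2 (Vec dx × Vec dy) :=
  WithLp.toLp 2
    ((1 / α) • (x - prox p.f p.X α (x - α • p.gGradX x y)),
     (1 / β) • (y - prox p.h p.Y β (y + β • p.gGradY x y)))

/-- `g(x, y) - (ρ/2) ‖y‖² - h(y)`. -/
def regObj (p : Problem dx dy Z) (ρ : ℝ) (x : Vec dx) (y : Vec dy) : ℝ :=
  p.g x y - ρ / 2 * ‖y‖ ^ 2 - p.h y

/-- `max_{y ∈ Y} (g(x, y) - (ρ/2) ‖y‖² - h(y))`. -/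
def regMax (p : Problem dx dy Z) (ρ : ℝ) (x : Vec dx) : ℝ :=
  sSup (p.regObj ρ x '' p.Y)

/-- `argmax_{y ∈ Y} (g(x, y) - (ρ/2) ‖y‖² - h(y))`. -/
def regArgmax (p : Problem dx dy Z) (ρ : ℝ) (x : Vec dx) : Vec dy :=
  Classical.epsilon fun y => y ∈ p.Y ∧ IsMaxOn (p.regObj ρ x) p.Y y

end Problem

/-- The parameters of the algorithm and of its analysis. -/
structure Params where
  L : ℝ
  β : ℝ
  a₁ : ℝ
  a₂ : ℝ
  a₄ : ℝ
  a₅ : ℝ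
  a₆ : ℝ
  b : ℕ

namespace Params

variable (s : Params)

def η (_ : Params) (k : ℕ) : ℝ := 1 / ((k : ℝ) + 2) ^ (5 / 13 : ℝ)

def α (k : ℕ) : ℝ := s.a₄ / ((k : ℝ) + 2) ^ (4 / 13 : ℝ)

def ρ (k : ℕ) : ℝ := s.L / ((k : ℝ) + 1) ^ (2 / 13 : ℝ)

def γ (k : ℕ) : ℝ := s.a₅ / ((k : ℝ) + 2) ^ (12 / 13 : ℝ)

def θ (k : ℕ) : ℝ := s.a₆ / ((k : ℝ) + 2) ^ (8 / 13 : ℝ)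

def D₁ (k : ℕ) : ℝ := s.a₁ * ((k : ℝ) + 2) ^ (3 / 13 : ℝ)

def D₂ (k : ℕ) : ℝ := s.a₂ * ((k : ℝ) + 2) ^ (3 / 13 : ℝ)

/-- The conditions on the parameters, for Lipschitz constant `l`. The last two fields are the
requirement `γ_k, θ_k ∈ (0, 1]` of the algorithm (positivity being automatic). -/
structure Admissible (l : ℝ) : Prop where
  b_pos : 0 < s.b
  L_eq : s.L = l + s.ρ 1
  β_pos : 0 < s.β
  β_le : s.β ≤ 1 / (6 * s.L)
  a₁_pos : 0 < s.a₁
  a₁_le : s.a₁ ≤ min (s.b / (32 * s.a₄ * s.L ^ 2)) (s.b * s.a₄ / (2 * s.L * s.β))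
  a₂_pos : 0 < s.a₂
  a₂_le : s.a₂ ≤ min (s.b / (32 * s.a₄ * s.L ^ 2)) (s.b * s.a₄ / (2 * s.L * s.β))
  a₄_pos : 0 < s.a₄
  a₄_le : s.a₄ ≤ min (1 / (8 * s.L)) (s.β / (8 * √5))
  a₅_ge : 4 * s.a₄ / s.a₁ + 12 / 13 ≤ s.a₅
  a₆_ge : 80 * s.a₄ / s.a₂ + 12 / 13 ≤ s.a₆
  γ_le_one : ∀ k, 1 ≤ k → s.γ k ≤ 1
  θ_le_one : ∀ k, 1 ≤ k → s.θ k ≤ 1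

end Params

/-- Sequences of random vectors, indexed by the iteration counter `k = 1, 2, …`
(the value at `0` is never used). -/
structure Iterates (dx dy : ℕ) (Ω : Type*) where
  x : ℕ → Ω → Vec dx
  y : ℕ → Ω → Vec dy
  xt : ℕ → Ω → Vec dx
  yt : ℕ → Ω → Vec dy
  v : ℕ → Ω → Vec dx
  w : ℕ → Ω → Vec dy

section Algorithm

variable {dx dy : ℕ} {Z : Type*} [MeasurableSpace Z] {Ω : Type*}

/-- The regularized integrand `G̃_k(x, y, ζ) = G(x, y, ζ) - (ρ_k/2) ‖y‖²`. -/
def Gt (p : Problem dx dy Z) (s : Params) (k : ℕ) : Vec dx → Vec dy → Z → ℝ :=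
  regularize p.G (s.ρ k)

/-- The sequences generated by the algorithm FORMDA-NS from the starting point `(x₁, y₁)`, with
the mini-batch `I_k = (ζ k 0, …, ζ k (b - 1))` drawn in iteration `k ≥ 1`.
The first estimators carry no correction term because `γ₀ = θ₀ = 1`. -/
structure IsFORMDANS (p : Problem dx dy Z) (s : Params) (ζ : ℕ → Fin s.b → Ω → Z)
    (x₁ : Vec dx) (y₁ : Vec dy) (it : Iterates dx dy Ω) : Prop where
  x_one : ∀ ω, it.x 1 ω = x₁
  y_one : ∀ ω, it.y 1 ω = y₁
  v_one : ∀ ω, it.v 1 ω = batchGradX (Gt p s 1) (it.x 1 ω) (it.y 1 ω) (fun j => ζ 1 j ω)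
  w_one : ∀ ω, it.w 1 ω = batchGradY (Gt p s 1) (it.x 1 ω) (it.y 1 ω) (fun j => ζ 1 j ω)
  v_succ : ∀ k, 1 ≤ k → ∀ ω, it.v (k + 1) ω =
    batchGradX (Gt p s (k + 1)) (it.x (k + 1) ω) (it.y (k + 1) ω) (fun j => ζ (k + 1) j ω) +
      (1 - s.γ k) • (it.v k ω -
        batchGradX (Gt p s k) (it.x k ω) (it.y k ω) (fun j => ζ (k + 1) j ω))
  w_succ : ∀ k, 1 ≤ k → ∀ ω, it.w (k + 1) ω =
    batchGradY (Gt p s (k + 1)) (it.x (k + 1) ω) (it.y (k + 1) ω) (fun j => ζ (k + 1) j ω) +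
      (1 - s.θ k) • (it.w k ω -
        batchGradY (Gt p s k) (it.x k ω) (it.y k ω) (fun j => ζ (k + 1) j ω))
  xt_succ : ∀ k, 1 ≤ k → ∀ ω, it.xt (k + 1) ω =
    prox p.f p.X (s.α k) (it.x k ω - s.α k • it.v k ω)
  x_succ : ∀ k, 1 ≤ k → ∀ ω, it.x (k + 1) ω =
    it.x k ω + s.η k • (it.xt (k + 1) ω - it.x k ω)
  yt_succ : ∀ k, 1 ≤ k → ∀ ω, it.yt (k + 1) ω =
    prox p.h p.Y s.β (it.y k ω + s.β • it.w k ω)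
  y_succ : ∀ k, 1 ≤ k → ∀ ω, it.y (k + 1) ω =
    it.y k ω + s.η k • (it.yt (k + 1) ω - it.y k ω)

variable [MeasurableSpace Ω]

/-- The samples `ζ k j`, `k ≥ 1`, are independent random variables with distribution `D`. -/
structure IsIIDSample (p : Problem dx dy Z) (P : Measure Ω) {b : ℕ} (ζ : ℕ → Fin b → Ω → Z) :
    Prop where
  measurable : ∀ k, 1 ≤ k → ∀ j, Measurable (ζ k j)
  law : ∀ k, 1 ≤ k → ∀ j, P.map (ζ k j) = p.D
  indep : iIndepFun (fun i : ℕ × Fin b => ζ (i.1 + 1) i.2) P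

variable (p : Problem dx dy Z) (s : Params) (P : Measure Ω) (it : Iterates dx dy Ω)

/-- `𝔼‖∇𝒢^{α_k,β}(x_k, y_k)‖`. -/
def expGap (k : ℕ) : ℝ := ∫ ω, ‖p.gap (s.α k) s.β (it.x k ω) (it.y k ω)‖ ∂P

/-- `T(ε)`: the first `k ≥ 1` at which the expected norm of the stationarity gap is at most `ε`. -/
def firstStationary (ε : ℝ) : ℕ := sInf {k : ℕ | 1 ≤ k ∧ expGap p s P it k ≤ ε}

/-- The potential `S_{k+1}(x_{k+1}, y_{k+1})`, for `k ≥ 0`; here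
`∇ₓ g_k = ∇ₓ g` and `∇_y g_k(x, y) = ∇_y g(x, y) - ρ_k y`. -/
def potential (k : ℕ) : ℝ :=
  (∫ ω, (p.regMax (s.ρ (k + 1)) (it.x (k + 1) ω) + p.f (it.x (k + 1) ω)) ∂P)
    + s.D₁ k * (∫ ω, ‖p.gGradX (it.x (k + 1) ω) (it.y (k + 1) ω) - it.v (k + 1) ω‖ ^ 2 ∂P)
    + 8 * s.α k * s.L ^ 2 / (s.β * s.ρ (k + 1)) *
        (∫ ω, ‖it.y (k + 1) ω - p.regArgmax (s.ρ (k + 1)) (it.x (k + 1) ω)‖ ^ 2 ∂P)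
    + s.D₂ k * (∫ ω, ‖p.gGradY (it.x (k + 1) ω) (it.y (k + 1) ω) -
        s.ρ (k + 1) • it.y (k + 1) ω - it.w (k + 1) ω‖ ^ 2 ∂P)
    - 40 * s.α (k + 1) * s.L ^ 2 * (s.ρ (k + 1) - s.ρ (k + 2)) /
        (s.η (k + 1) * s.β ^ 2 * s.ρ (k + 2) ^ 3) *
        (∫ ω, ‖p.regArgmax (s.ρ (k + 1)) (it.x (k + 1) ω)‖ ^ 2 ∂P)
    + 4 * s.D₂ (k + 1) * s.ρ (k + 1) ^ 2 * p.sigmaY ^ 2 / s.b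

/-- The greatest lower bound of the potential along the iterations. -/
def potentialInf : ℝ := ⨅ k : ℕ, potential p s P it k

def C₁ : ℝ :=
  potential p s P it 0 - potentialInf p s P it + s.ρ 1 / 2 * p.sigmaY ^ 2 +
    40 * s.α 1 * s.L ^ 2 * s.ρ 1 / (s.η 1 * s.β ^ 2 * s.ρ 2 ^ 3) * p.sigmaY ^ 2

def C₂ (δ : ℝ) : ℝ :=
  2 * δ ^ 2 * (s.a₅ ^ 2 * s.a₁ + s.a₆ ^ 2 * s.a₂) / s.b +
    12 * s.a₂ * s.L ^ 2 * p.sigmaY ^ 2 / (13 * s.b)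

/-- `(C₁ + C₂ ln(t + 2)) / (d₁ a₄ ((13/4) (t + 3)^{4/13} - 13 · 3^{4/13} / 4))`. -/
def rate (δ d₁ t : ℝ) : ℝ :=
  (C₁ p s P it + C₂ p s δ * Real.log (t + 2)) /
    (d₁ * s.a₄ * (13 / 4 * (t + 3) ^ (4 / 13 : ℝ) - 13 * 3 ^ (4 / 13 : ℝ) / 4))

end Algorithm

end FORMDA

end

noncomputable section

/-! The proof is a Lyapunov argument. The inner problem regularized by `ρ_k` has quadratic growth at
its maximizer, so the primal function `Φ_k` satisfies a descent inequality although `g` is merely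
concave in `y` (`regMax_le_linear`), and a proximal ascent step contracts the distance of `y_k` to
the maximizer (`norm_step_sub_regArgmax_sq_le`). The estimators `v_k`, `w_k` are recursive momentum
estimators: conditionally on the past their fresh noise is centered, so their mean-square errors
contract up to squared step lengths and a variance term (`StochasticOracle.momentum_step`). The
potential adds these three tracking errors to the primal value, with weights such that the
contraction of each error pays for its appearance in the other recursions and for the growth of its
own weight (the `coeff_*` lemmas). One iteration then lowers the potential by `d₁ η_k α_k` times
`meanGapSq`, up to telescoping terms and a noise of order `1 / k`, whose sum is the logarithm
(`potential_succ_le`, `potential_add_sum_le`).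

The regularization decreases to zero, so the inner maximizer drifts even for fixed `x`. The drift
bound `regArgmax_sub_sq_le` keeps the difference of the squared norms of the two maximizers with its
sign. The negative term of the potential turns it into a telescoping sum, which works because its
weights decrease (`root_weight_succ_le`).

For the stopping time, the expected gap is at most `M_k / ε + ε / 4 + ρ_k σ_y` with `M_k` the value
of `meanGapSq`. While the gap exceeds `ε`, every `k` with `ρ_k σ_y ≤ ε / 2` has `M_k ≥ ε² / 4`. The
remaining, early indices give no lower bound, but their total weight is `O(ε⁻²)`; after
multiplication by `ε² / 4` this is a constant free of `ε`, and the last term of `C₁` has room for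
it. Hence the rate inequality holds at `t = T(ε) - 1` itself (`sq_le_rate`), and solving it for `t`
gives the complexity (`exists_complexity_bound`).

The equation `L = l + ρ₁` forces `l ≤ L / 8`. This slack absorbs the constants lost by crude
smoothness bounds and by measuring `X × Y` in the maximum metric. -/

namespace FORMDA

/-! ### Convexity: quadratic growth at minimizers. -/

/-- An inequality with an error term that vanishes linearly. -/
theorem le_of_forall_le_add_mul {a b c : ℝ} (h : ∀ t : ℝ, 0 < t → t ≤ 1 → a ≤ b + t * c) :
    a ≤ b := by
  have h1 : Filter.Tendsto (fun t : ℝ => b + t * c) (nhdsWithin 0 (Set.Ioi 0)) (nhds b) := by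
    have : Continuous (fun t : ℝ => b + t * c) := by fun_prop
    have h2 := this.tendsto 0
    simp only [zero_mul, add_zero] at h2
    exact h2.mono_left nhdsWithin_le_nhds
  refine ge_of_tendsto h1 ?_
  filter_upwards [Ioc_mem_nhdsGT (zero_lt_one' ℝ)] with t ht
  exact h t ht.1 ht.2

/-- A minimizer of a convex function plus a quadratic satisfies the quadratic growth condition. -/
theorem quadratic_growth {n : ℕ} {φ : Vec n → ℝ} {S : Set (Vec n)} {c : ℝ} {u q z : Vec n}
    (hφ : ConvexOn ℝ S φ) (hq : q ∈ S)
    (hmin : IsMinOn (fun z' => φ z' + c * ‖z' - u‖ ^ 2) S q) (hz : z ∈ S) :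
    φ q + c * ‖q - u‖ ^ 2 + c * ‖z - q‖ ^ 2 ≤ φ z + c * ‖z - u‖ ^ 2 := by
  -- Compare `q` with the point `(1 - t) q + t z`, divide by `t` and let `t → 0`; no
  -- differentiability of `φ` is needed.
  refine le_of_forall_le_add_mul (c := c * ‖z - q‖ ^ 2) fun t ht0 ht1 => ?_
  have hmem : (1 - t) • q + t • z ∈ S := hφ.1 hq hz (by linarith) ht0.le (by ring)
  have h1 := hmin hmem
  have h2 := hφ.2 hq hz (sub_nonneg.2 ht1) ht0.le (by ring)
  simp only [Set.mem_ofPred_eq, smul_eq_mul] at h1 h2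
  have h3 : ‖(1 - t) • q + t • z - u‖ ^ 2 =
      (1 - t) * ‖q - u‖ ^ 2 + t * ‖z - u‖ ^ 2 - t * (1 - t) * ‖z - q‖ ^ 2 := by
    have e1 : (1 - t) • q + t • z - u = (q - u) + t • (z - q) := by module
    have e2 : z - u = (q - u) + (z - q) := by module
    rw [e1, e2, norm_add_sq_real, norm_add_sq_real, norm_smul, inner_smul_right,
      Real.norm_of_nonneg ht0.le]
    ring
  rw [h3] at h1
  have h4 : t * (φ q + c * ‖q - u‖ ^ 2 + c * ‖z - q‖ ^ 2) ≤
      t * (φ z + c * ‖z - u‖ ^ 2 + t * (c * ‖z - q‖ ^ 2)) := by nlinarith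
  exact le_of_mul_le_mul_left h4 ht0

/-! ### The proximity operator. -/

section Prox

variable {n : ℕ} {φ : Vec n → ℝ} {S : Set (Vec n)}

theorem prox_mem (hS : IsCompact S) (hne : S.Nonempty) (hc : ContinuousOn φ S) (α : ℝ)
    (u : Vec n) : prox φ S α u ∈ S := (prox_spec hS hne hc α u).1

/-- The variational inequality of the proximity operator, for a step from `x - α v`. -/
theorem prox_le (hS : IsCompact S) (hne : S.Nonempty) (hφ : ConvexOn ℝ S φ)
    (hc : ContinuousOn φ S) {α : ℝ} (hα : 0 < α) (x v : Vec n) {z : Vec n} (hz : z ∈ S) :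
    φ (prox φ S α (x - α • v)) + inner ℝ v (prox φ S α (x - α • v) - z) ≤
      φ z + 1 / (2 * α) * (‖z - x‖ ^ 2 - ‖prox φ S α (x - α • v) - x‖ ^ 2
        - ‖z - prox φ S α (x - α • v)‖ ^ 2) := by
  obtain ⟨h1, h2⟩ := prox_spec hS hne hc α (x - α • v)
  have h3 := quadratic_growth hφ h1 h2 hz
  set q := prox φ S α (x - α • v)
  have e : ∀ w : Vec n, 1 / (2 * α) * ‖w - (x - α • v)‖ ^ 2 =
      1 / (2 * α) * ‖w - x‖ ^ 2 + inner ℝ v (w - x) + α / 2 * ‖v‖ ^ 2 := by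
    intro w
    have : w - (x - α • v) = (w - x) + α • v := by module
    rw [this, norm_add_sq_real, norm_smul, inner_smul_right, Real.norm_of_nonneg hα.le,
      real_inner_comm]
    field_simp
  rw [e, e] at h3
  have e3 : inner ℝ v (q - z) = inner ℝ v (q - x) - inner ℝ v (z - x) := by
    rw [← inner_sub_right]; congr 1; module
  rw [e3]
  linarith

/-- The proximity operator of a convex function is nonexpansive. -/
theorem norm_prox_sub_le (hS : IsCompact S) (hne : S.Nonempty) (hφ : ConvexOn ℝ S φ)
    (hc : ContinuousOn φ S) {α : ℝ} (hα : 0 < α) (u v : Vec n) :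
    ‖prox φ S α u - prox φ S α v‖ ≤ ‖u - v‖ := by
  obtain ⟨h1, h2⟩ := prox_spec hS hne hc α u
  obtain ⟨h3, h4⟩ := prox_spec hS hne hc α v
  have h5 := quadratic_growth hφ h1 h2 h3
  have h6 := quadratic_growth hφ h3 h4 h1
  set a := prox φ S α u
  set c := prox φ S α v
  have h7 : 1 / (2 * α) * (‖a - u‖ ^ 2 + ‖c - a‖ ^ 2 + ‖c - v‖ ^ 2 + ‖a - c‖ ^ 2) ≤
      1 / (2 * α) * (‖c - u‖ ^ 2 + ‖a - v‖ ^ 2) := by linarith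
  have h8 := le_of_mul_le_mul_left h7 (by positivity)
  have e1 : ‖c - u‖ ^ 2 = ‖a - u‖ ^ 2 - 2 * inner ℝ (a - u) (a - c) + ‖a - c‖ ^ 2 := by
    rw [← norm_sub_sq_real]; congr 2; module
  have e2 : ‖a - v‖ ^ 2 = ‖c - v‖ ^ 2 + 2 * inner ℝ (c - v) (a - c) + ‖a - c‖ ^ 2 := by
    rw [← norm_add_sq_real]; congr 2; module
  have e3 : inner ℝ (c - v) (a - c) - inner ℝ (a - u) (a - c) =
      inner ℝ (u - v) (a - c) - ‖a - c‖ ^ 2 := by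
    rw [← inner_sub_left, ← real_inner_self_eq_norm_sq, ← inner_sub_left]; congr 1; module
  rw [norm_sub_rev c a] at h8
  have h9 := real_inner_le_norm (u - v) (a - c)
  -- The two growth inequalities add up to firm nonexpansiveness, `‖a - c‖² ≤ ⟪u - v, a - c⟫`;
  -- Cauchy–Schwarz does the rest.
  have h10 : ‖a - c‖ * ‖a - c‖ ≤ ‖u - v‖ * ‖a - c‖ := by nlinarith
  rcases (norm_nonneg (a - c)).eq_or_lt with h | h
  · rw [← h]; positivity
  · exact le_of_mul_le_mul_right h10 h

theorem continuous_prox (hS : IsCompact S) (hne : S.Nonempty) (hφ : ConvexOn ℝ S φ)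
    (hc : ContinuousOn φ S) {α : ℝ} (hα : 0 < α) : Continuous (prox φ S α) := by
  refine (LipschitzWith.of_dist_le_mul (K := 1) fun u v => ?_).continuous
  simpa [dist_eq_norm] using norm_prox_sub_le hS hne hφ hc hα u v

end Prox

/-- Deviation from the linearization of a function with Lipschitz gradient on a convex set. -/
theorem abs_sub_linear_le {n : ℕ} {φ : Vec n → ℝ} {φ' : Vec n → Vec n} {S : Set (Vec n)} {l : ℝ}
    (hS : Convex ℝ S) (hd : ∀ x ∈ S, HasGradientWithinAt φ (φ' x) S x) (hl0 : 0 ≤ l)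
    (hl : ∀ x₁ ∈ S, ∀ x₂ ∈ S, ‖φ' x₁ - φ' x₂‖ ≤ l * ‖x₁ - x₂‖) {x x' : Vec n} (hx : x ∈ S)
    (hx' : x' ∈ S) : |φ x' - φ x - inner ℝ (φ' x) (x' - x)| ≤ l * ‖x' - x‖ ^ 2 := by
  have hseg : segment ℝ x x' ⊆ S := hS.segment_subset hx hx'
  have h1 := Convex.norm_image_sub_le_of_norm_hasFDerivWithin_le' (𝕜 := ℝ)
    (f := φ) (s := segment ℝ x x') (C := l * ‖x' - x‖)
    (f' := fun z => InnerProductSpace.toDual ℝ (Vec n) (φ' z))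
    (φ := InnerProductSpace.toDual ℝ (Vec n) (φ' x))
    (fun z hz => ((hd z (hseg hz)).hasFDerivWithinAt).mono hseg)
    (fun z hz => by
      rw [← map_sub, LinearIsometryEquiv.norm_map]
      refine (hl z (hseg hz) x hx).trans (mul_le_mul_of_nonneg_left ?_ hl0)
      obtain ⟨a, b, ha, hb, hab, rfl⟩ := hz
      have : a • x + b • x' - x = b • (x' - x) := by
        have : a = 1 - b := by linarith
        subst this
        module
      rw [this, norm_smul, Real.norm_of_nonneg hb]
      exact mul_le_of_le_one_left (norm_nonneg _) (by linarith))
    (convex_segment x x') (left_mem_segment ℝ x x') (right_mem_segment ℝ x x')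
  rw [InnerProductSpace.toDual_apply_apply, Real.norm_eq_abs] at h1
  calc _ ≤ _ := h1
    _ = _ := by ring

/-- The mean value inequality for gradients relative to a convex set. -/
theorem abs_sub_le_of_norm_gradient_le {n : ℕ} {φ : Vec n → ℝ} {φ' : Vec n → Vec n}
    {S : Set (Vec n)} {C : ℝ} (hS : Convex ℝ S)
    (hd : ∀ x ∈ S, HasGradientWithinAt φ (φ' x) S x) (hC : ∀ x ∈ S, ‖φ' x‖ ≤ C) {x x' : Vec n}
    (hx : x ∈ S) (hx' : x' ∈ S) : |φ x' - φ x| ≤ C * ‖x' - x‖ := by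
  have := Convex.norm_image_sub_le_of_norm_hasFDerivWithin_le (𝕜 := ℝ)
    (f := φ) (s := S) (C := C) (f' := fun z => InnerProductSpace.toDual ℝ (Vec n) (φ' z))
    (fun z hz => (hd z hz).hasFDerivWithinAt)
    (fun z hz => by rw [LinearIsometryEquiv.norm_map]; exact hC z hz) hS hx hx'
  simpa using this

/-! ### Smoothness of `g`, and the regularized maximum and its maximizer. -/

namespace Problem

variable {dx dy : ℕ} {Z : Type*} [MeasurableSpace Z]

/-- The assumptions on the problem, bundled. -/
structure Regular (p : Problem dx dy Z) (l δ : ℝ) : Prop where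
  standing : p.Standing
  l_nonneg : 0 ≤ l
  lip : p.LipschitzGradients l
  var : p.BoundedVariance δ

namespace Regular

variable {p : Problem dx dy Z} {l δ : ℝ} (h : p.Regular l δ)
include h

theorem integrable_gradX {x : Vec dx} (hx : x ∈ p.X) {y : Vec dy} (hy : y ∈ p.Y) :
    Integrable (gradX p.G x y) p.D := by
  have := h.standing.prob
  exact integrable_of_sq (h.standing.gradX_measurable x hx y hy) _ (h.var.integrable_x x hx y hy)

theorem integrable_gradY {x : Vec dx} (hx : x ∈ p.X) {y : Vec dy} (hy : y ∈ p.Y) :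
    Integrable (gradY p.G x y) p.D := by
  have := h.standing.prob
  exact integrable_of_sq (h.standing.gradY_measurable x hx y hy) _ (h.var.integrable_y x hx y hy)

theorem gGradX_sub_le {x₁ x₂ : Vec dx} (h₁ : x₁ ∈ p.X) (h₂ : x₂ ∈ p.X) {y₁ y₂ : Vec dy}
    (k₁ : y₁ ∈ p.Y) (k₂ : y₂ ∈ p.Y) :
    ‖p.gGradX x₁ y₁ - p.gGradX x₂ y₂‖ ≤ l * (‖x₁ - x₂‖ + ‖y₁ - y₂‖) := by
  have := h.standing.prob
  rw [gGradX, gGradX, ← integral_sub (h.integrable_gradX h₁ k₁) (h.integrable_gradX h₂ k₂)]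
  refine (norm_integral_le_of_norm_le_const (C := l * (‖x₁ - x₂‖ + ‖y₁ - y₂‖))
    (Filter.Eventually.of_forall fun ζ => ?_)).trans (by simp)
  have e1 := h.lip.xx x₁ h₁ x₂ h₂ y₁ k₁ ζ
  have e2 := h.lip.xy x₂ h₂ y₁ k₁ y₂ k₂ ζ
  calc _ = ‖(gradX p.G x₁ y₁ ζ - gradX p.G x₂ y₁ ζ) +
        (gradX p.G x₂ y₁ ζ - gradX p.G x₂ y₂ ζ)‖ := by congr 1; module
    _ ≤ _ := norm_add_le _ _
    _ ≤ _ := by linarith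

theorem gGradY_sub_le {x₁ x₂ : Vec dx} (h₁ : x₁ ∈ p.X) (h₂ : x₂ ∈ p.X) {y₁ y₂ : Vec dy}
    (k₁ : y₁ ∈ p.Y) (k₂ : y₂ ∈ p.Y) :
    ‖p.gGradY x₁ y₁ - p.gGradY x₂ y₂‖ ≤ l * (‖x₁ - x₂‖ + ‖y₁ - y₂‖) := by
  have := h.standing.prob
  rw [gGradY, gGradY, ← integral_sub (h.integrable_gradY h₁ k₁) (h.integrable_gradY h₂ k₂)]
  refine (norm_integral_le_of_norm_le_const (C := l * (‖x₁ - x₂‖ + ‖y₁ - y₂‖))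
    (Filter.Eventually.of_forall fun ζ => ?_)).trans (by simp)
  have e1 := h.lip.yx x₁ h₁ x₂ h₂ y₁ k₁ ζ
  have e2 := h.lip.yy x₂ h₂ y₁ k₁ y₂ k₂ ζ
  calc _ = ‖(gradY p.G x₁ y₁ ζ - gradY p.G x₂ y₁ ζ) +
        (gradY p.G x₂ y₁ ζ - gradY p.G x₂ y₂ ζ)‖ := by congr 1; module
    _ ≤ _ := norm_add_le _ _
    _ ≤ _ := by linarith

theorem hasGradientWithinAt_x {x : Vec dx} (hx : x ∈ p.X) {y : Vec dy} (hy : y ∈ p.Y) :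
    HasGradientWithinAt (fun x' => p.g x' y) (p.gGradX x y) p.X x :=
  hasGradientWithinAt_g_x h.standing h.l_nonneg h.lip h.var hx hy

theorem hasGradientWithinAt_y {x : Vec dx} (hx : x ∈ p.X) {y : Vec dy} (hy : y ∈ p.Y) :
    HasGradientWithinAt (fun y' => p.g x y') (p.gGradY x y) p.Y y :=
  hasGradientWithinAt_g_y h.standing h.l_nonneg h.lip h.var hx hy

theorem abs_g_sub_linear_x_le {x x' : Vec dx} (hx : x ∈ p.X) (hx' : x' ∈ p.X) {y : Vec dy}
    (hy : y ∈ p.Y) :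
    |p.g x' y - p.g x y - inner ℝ (p.gGradX x y) (x' - x)| ≤ l * ‖x' - x‖ ^ 2 :=
  abs_sub_linear_le (φ := fun x => p.g x y) (φ' := fun x => p.gGradX x y) h.standing.X_convex
    (fun _ hx => h.hasGradientWithinAt_x hx hy) h.l_nonneg
    (fun x₁ h₁ x₂ h₂ => by simpa using h.gGradX_sub_le h₁ h₂ hy hy) hx hx'

theorem abs_g_sub_linear_y_le {x : Vec dx} (hx : x ∈ p.X) {y y' : Vec dy} (hy : y ∈ p.Y)
    (hy' : y' ∈ p.Y) :
    |p.g x y' - p.g x y - inner ℝ (p.gGradY x y) (y' - y)| ≤ l * ‖y' - y‖ ^ 2 :=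
  abs_sub_linear_le (φ := fun y => p.g x y) (φ' := fun y => p.gGradY x y) h.standing.Y_convex
    (fun _ hy => h.hasGradientWithinAt_y hx hy) h.l_nonneg
    (fun x₁ h₁ x₂ h₂ => by simpa using h.gGradY_sub_le hx hx h₁ h₂) hy hy'

theorem concaveOn_g {x : Vec dx} (hx : x ∈ p.X) : ConcaveOn ℝ p.Y (p.g x) := by
  refine ⟨h.standing.Y_convex, fun y₁ h₁ y₂ h₂ a b ha hb hab => ?_⟩
  have h3 := h.standing.Y_convex h₁ h₂ ha hb hab
  have i := h.standing.G_integrable x hx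
  simp only [g, smul_eq_mul]
  rw [← integral_const_mul, ← integral_const_mul,
    ← integral_add ((i y₁ h₁).const_mul a) ((i y₂ h₂).const_mul b)]
  exact integral_mono (((i y₁ h₁).const_mul a).add ((i y₂ h₂).const_mul b)) (i _ h3)
    fun ζ => (h.standing.concave_y x hx ζ).2 h₁ h₂ ha hb hab

/-- Concavity along the segment from `y` to `y'`, with the gradient at `y` read off from the
quadratic bound as the parameter tends to zero. -/
theorem g_le_linear {x : Vec dx} (hx : x ∈ p.X) {y y' : Vec dy} (hy : y ∈ p.Y)
    (hy' : y' ∈ p.Y) : p.g x y' ≤ p.g x y + inner ℝ (p.gGradY x y) (y' - y) := by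
  refine le_of_forall_le_add_mul (c := l * ‖y' - y‖ ^ 2) fun t ht0 ht1 => ?_
  have hmem := h.standing.Y_convex hy hy' (sub_nonneg.2 ht1) ht0.le (by ring)
  have h1 := (h.concaveOn_g hx).2 hy hy' (sub_nonneg.2 ht1) ht0.le (by ring)
  have h2 := (abs_le.1 (h.abs_g_sub_linear_y_le hx hy hmem)).2
  have e : (1 - t) • y + t • y' - y = t • (y' - y) := by module
  rw [e, inner_smul_right, norm_smul, Real.norm_of_nonneg ht0.le] at h2
  simp only [smul_eq_mul] at h1
  have h3 : t * p.g x y' ≤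
      t * (p.g x y + inner ℝ (p.gGradY x y) (y' - y) + t * (l * ‖y' - y‖ ^ 2)) := by nlinarith
  exact le_of_mul_le_mul_left h3 ht0

/-- The function `y ↦ g(x', y) - g(x, y)` has gradient at most `l ‖x' - x‖`. This mixed difference
replaces second derivatives wherever two maximizers are compared. -/
theorem g_cross_le {x x' : Vec dx} (hx : x ∈ p.X) (hx' : x' ∈ p.X) {y y' : Vec dy}
    (hy : y ∈ p.Y) (hy' : y' ∈ p.Y) :
    |(p.g x' y' - p.g x y') - (p.g x' y - p.g x y)| ≤ l * ‖x' - x‖ * ‖y' - y‖ :=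
  abs_sub_le_of_norm_gradient_le (φ := fun y => p.g x' y - p.g x y)
    (φ' := fun y => p.gGradY x' y - p.gGradY x y) h.standing.Y_convex
    (fun y hy => by
      have h1 := (h.hasGradientWithinAt_y hx' hy).hasFDerivWithinAt.sub
        (h.hasGradientWithinAt_y hx hy).hasFDerivWithinAt
      rw [← map_sub] at h1
      exact hasGradientWithinAt_iff_hasFDerivWithinAt.2 h1)
    (fun y hy => by simpa using h.gGradY_sub_le hx' hx hy hy) hy hy'

/-- A bound for the gradients on `X × Y`. -/
theorem exists_gradient_bound : ∃ M : ℝ, 0 ≤ M ∧ ∀ x ∈ p.X, ∀ y ∈ p.Y,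
    ‖p.gGradX x y‖ ≤ M ∧ ‖p.gGradY x y‖ ≤ M := by
  obtain ⟨x₀, hx₀⟩ := h.standing.X_nonempty
  obtain ⟨y₀, hy₀⟩ := h.standing.Y_nonempty
  obtain ⟨C₁, hC₁⟩ := (h.standing.X_compact.isBounded).exists_norm_le
  obtain ⟨C₂, hC₂⟩ := (h.standing.Y_compact.isBounded).exists_norm_le
  refine ⟨‖p.gGradX x₀ y₀‖ + ‖p.gGradY x₀ y₀‖ + l * ((C₁ + C₁) + (C₂ + C₂)), ?_, ?_⟩
  · have := (norm_nonneg x₀).trans (hC₁ _ hx₀)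
    have := (norm_nonneg y₀).trans (hC₂ _ hy₀)
    have := h.l_nonneg
    positivity
  · intro x hx y hy
    have h1 := h.gGradX_sub_le hx hx₀ hy hy₀
    have h2 := h.gGradY_sub_le hx hx₀ hy hy₀
    have h3 : ‖x - x₀‖ ≤ C₁ + C₁ := (norm_sub_le _ _).trans (add_le_add (hC₁ _ hx) (hC₁ _ hx₀))
    have h4 : ‖y - y₀‖ ≤ C₂ + C₂ := (norm_sub_le _ _).trans (add_le_add (hC₂ _ hy) (hC₂ _ hy₀))
    have h5 : l * (‖x - x₀‖ + ‖y - y₀‖) ≤ l * ((C₁ + C₁) + (C₂ + C₂)) :=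
      mul_le_mul_of_nonneg_left (add_le_add h3 h4) h.l_nonneg
    have h6 := norm_sub_norm_le (p.gGradX x y) (p.gGradX x₀ y₀)
    have h7 := norm_sub_norm_le (p.gGradY x y) (p.gGradY x₀ y₀)
    have h8 := norm_nonneg (p.gGradX x₀ y₀)
    have h9 := norm_nonneg (p.gGradY x₀ y₀)
    constructor <;> linarith

theorem norm_le_sigmaY {y : Vec dy} (hy : y ∈ p.Y) : ‖y‖ ≤ p.sigmaY := by
  refine le_csSup ?_ ⟨y, hy, rfl⟩
  exact (h.standing.Y_compact.image continuous_norm).bddAbove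

theorem sigmaY_nonneg : 0 ≤ p.sigmaY := by
  obtain ⟨y, hy⟩ := h.standing.Y_nonempty
  exact (norm_nonneg y).trans (h.norm_le_sigmaY hy)

theorem continuousOn_regObj (ρ : ℝ) {x : Vec dx} (hx : x ∈ p.X) :
    ContinuousOn (p.regObj ρ x) p.Y := by
  have h1 : ContinuousOn (p.g x) p.Y := fun y hy => (h.hasGradientWithinAt_y hx hy).continuousWithinAt
  exact (h1.sub (by fun_prop)).sub h.standing.h_cont

theorem regArgmax_spec (ρ : ℝ) {x : Vec dx} (hx : x ∈ p.X) :
    p.regArgmax ρ x ∈ p.Y ∧ IsMaxOn (p.regObj ρ x) p.Y (p.regArgmax ρ x) := by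
  obtain ⟨z, hz, hmax⟩ := h.standing.Y_compact.exists_isMaxOn h.standing.Y_nonempty
    (h.continuousOn_regObj ρ hx)
  exact Classical.epsilon_spec (p := fun y => y ∈ p.Y ∧ IsMaxOn (p.regObj ρ x) p.Y y) ⟨z, hz, hmax⟩

theorem regArgmax_mem (ρ : ℝ) {x : Vec dx} (hx : x ∈ p.X) : p.regArgmax ρ x ∈ p.Y :=
  (h.regArgmax_spec ρ hx).1

theorem regMax_eq (ρ : ℝ) {x : Vec dx} (hx : x ∈ p.X) :
    p.regMax ρ x = p.regObj ρ x (p.regArgmax ρ x) := by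
  obtain ⟨h1, h2⟩ := h.regArgmax_spec ρ hx
  exact IsGreatest.csSup_eq ⟨⟨_, h1, rfl⟩, by rintro _ ⟨y, hy, rfl⟩; exact h2 hy⟩

theorem regObj_le_regMax (ρ : ℝ) {x : Vec dx} (hx : x ∈ p.X) {y : Vec dy} (hy : y ∈ p.Y) :
    p.regObj ρ x y ≤ p.regMax ρ x := by
  rw [h.regMax_eq ρ hx]
  exact (h.regArgmax_spec ρ hx).2 hy

/-- Quadratic growth of the regularized inner problem. -/
theorem regObj_add_le_regMax {ρ : ℝ} {x : Vec dx} (hx : x ∈ p.X) {y : Vec dy} (hy : y ∈ p.Y) :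
    p.regObj ρ x y + ρ / 2 * ‖y - p.regArgmax ρ x‖ ^ 2 ≤ p.regMax ρ x := by
  obtain ⟨h1, h2⟩ := h.regArgmax_spec ρ hx
  have hc : ConvexOn ℝ p.Y (fun y => p.h y - p.g x y) := h.standing.h_convex.sub (h.concaveOn_g hx)
  have h3 := quadratic_growth (c := ρ / 2) (u := 0) hc h1
    (fun z hz => by
      have := h2 hz
      simp only [Set.mem_ofPred_eq, regObj, sub_zero] at this ⊢
      linarith) hy
  rw [h.regMax_eq ρ hx]
  simp only [regObj, sub_zero] at h3 ⊢
  linarith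

/-- The maximizers move little when `x` and the regularization do. -/
theorem regArgmax_sub_sq_le {ρ ρ' : ℝ} (hρ' : 0 < ρ') (hle : ρ' ≤ ρ) {x x' : Vec dx}
    (hx : x ∈ p.X) (hx' : x' ∈ p.X) :
    ‖p.regArgmax ρ' x' - p.regArgmax ρ x‖ ^ 2 ≤ l ^ 2 / ρ' ^ 2 * ‖x' - x‖ ^ 2 +
      (ρ - ρ') / ρ' * (‖p.regArgmax ρ' x'‖ ^ 2 - ‖p.regArgmax ρ x‖ ^ 2) := by
  have m' := h.regArgmax_mem ρ' hx'
  have m := h.regArgmax_mem ρ hx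
  have h1 := h.regObj_add_le_regMax (ρ := ρ') hx' m
  have h2 := h.regObj_add_le_regMax (ρ := ρ) hx m'
  rw [h.regMax_eq ρ' hx'] at h1
  rw [h.regMax_eq ρ hx] at h2
  have h3 := (abs_le.1 (h.g_cross_le hx hx' m m')).2
  simp only [regObj] at h1 h2
  set u := p.regArgmax ρ x
  set u' := p.regArgmax ρ' x'
  rw [norm_sub_rev u u'] at h1
  set a := ‖u' - u‖
  set d := ‖x' - x‖
  -- Each maximizer is tested in the growth inequality of the other and the two are added: `g`
  -- leaves only the mixed difference, the regularizations leave the signed difference of squared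
  -- norms.
  have h4 : ρ' * a ^ 2 ≤ l * d * a + (ρ - ρ') / 2 * (‖u'‖ ^ 2 - ‖u‖ ^ 2) := by
    nlinarith [mul_nonneg (sub_nonneg.2 hle) (sq_nonneg a)]
  have h5 : 0 ≤ (ρ' * a - l * d) ^ 2 := sq_nonneg _
  have h6 : ρ' ^ 2 * a ^ 2 ≤ l ^ 2 * d ^ 2 + (ρ - ρ') * ρ' * (‖u'‖ ^ 2 - ‖u‖ ^ 2) := by
    nlinarith [mul_le_mul_of_nonneg_left h4 hρ'.le]
  have h7 : a ^ 2 ≤ (l ^ 2 * d ^ 2 + (ρ - ρ') * ρ' * (‖u'‖ ^ 2 - ‖u‖ ^ 2)) / ρ' ^ 2 := by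
    rw [le_div_iff₀ (by positivity)]; linarith
  refine h7.trans (le_of_eq ?_)
  field_simp

/-- The case of equal regularizations, where the drift term vanishes. It supplies the continuity
behind the measurability of the maximizer. -/
theorem norm_regArgmax_sub_le {ρ : ℝ} (hρ : 0 < ρ) {x x' : Vec dx} (hx : x ∈ p.X)
    (hx' : x' ∈ p.X) : ‖p.regArgmax ρ x' - p.regArgmax ρ x‖ ≤ l / ρ * ‖x' - x‖ := by
  have h1 := h.regArgmax_sub_sq_le hρ le_rfl hx hx'
  have := h.l_nonneg
  refine le_of_sq_le_sq ?_ (by positivity) 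
  rw [mul_pow, div_pow]
  simpa using h1

/-- The descent inequality for the regularized primal function. -/
theorem regMax_le_linear {ρ : ℝ} (hρ : 0 < ρ) {x x' : Vec dx} (hx : x ∈ p.X) (hx' : x' ∈ p.X) :
    p.regMax ρ x' ≤ p.regMax ρ x + inner ℝ (p.gGradX x (p.regArgmax ρ x)) (x' - x) +
      (l + l ^ 2 / (2 * ρ)) * ‖x' - x‖ ^ 2 := by
  have m' := h.regArgmax_mem ρ hx'
  have m := h.regArgmax_mem ρ hx
  have h1 := (abs_le.1 (h.abs_g_sub_linear_x_le hx hx' m)).2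
  have h2 := h.regObj_add_le_regMax (ρ := ρ) hx m'
  have h3 := (abs_le.1 (h.g_cross_le hx hx' m m')).2
  rw [h.regMax_eq ρ hx']
  simp only [regObj] at h2 ⊢
  set u := p.regArgmax ρ x
  set u' := p.regArgmax ρ x'
  set a := ‖u' - u‖
  set d := ‖x' - x‖
  -- Moving the maximizer costs `l d a` through the mixed difference, while quadratic growth at `x`
  -- refunds `ρ a² / 2`. This is a one-sided Danskin estimate that never differentiates the maximum.
  have h4 : l * d * a ≤ ρ / 2 * a ^ 2 + l ^ 2 / (2 * ρ) * d ^ 2 := by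
    have : ρ / 2 * a ^ 2 + l ^ 2 / (2 * ρ) * d ^ 2 - l * d * a = (ρ * a - l * d) ^ 2 / (2 * ρ) := by
      field_simp; ring
    have h5 : 0 ≤ (ρ * a - l * d) ^ 2 / (2 * ρ) := by positivity
    linarith
  linarith

theorem regMax_le_regMax_add {ρ ρ' : ℝ} (hle : ρ' ≤ ρ) {x : Vec dx} (hx : x ∈ p.X) :
    p.regMax ρ' x ≤ p.regMax ρ x + (ρ - ρ') / 2 * p.sigmaY ^ 2 := by
  have m' := h.regArgmax_mem ρ' hx
  have h1 := h.regObj_le_regMax ρ hx m'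
  rw [h.regMax_eq ρ' hx]
  simp only [regObj] at h1 ⊢
  have h2 : ‖p.regArgmax ρ' x‖ ^ 2 ≤ p.sigmaY ^ 2 :=
    pow_le_pow_left₀ (norm_nonneg _) (h.norm_le_sigmaY m') 2
  nlinarith [mul_le_mul_of_nonneg_left h2 (sub_nonneg.2 hle)]

theorem continuousOn_regMax (ρ : ℝ) : ContinuousOn (p.regMax ρ) p.X := by
  obtain ⟨M, hM0, hM⟩ := h.exists_gradient_bound
  have key : ∀ x ∈ p.X, ∀ x' ∈ p.X, p.regMax ρ x' ≤ p.regMax ρ x + M * ‖x' - x‖ := by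
    intro x hx x' hx'
    have m' := h.regArgmax_mem ρ hx'
    have h1 := h.regObj_le_regMax ρ hx m'
    have h2 := (abs_le.1 (abs_sub_le_of_norm_gradient_le h.standing.X_convex
      (fun x hx => h.hasGradientWithinAt_x hx m') (fun x hx => (hM x hx _ m').1) hx hx')).2
    rw [h.regMax_eq ρ hx']
    simp only [regObj] at h1 ⊢
    linarith
  refine (LipschitzOnWith.of_dist_le_mul (K := M.toNNReal) fun x hx x' hx' => ?_).continuousOn
  rw [dist_eq_norm, dist_eq_norm, Real.coe_toNNReal _ hM0, Real.norm_eq_abs, abs_sub_le_iff]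
  have h1 := key x hx x' hx'
  have h2 := key x' hx' x hx
  rw [norm_sub_rev x' x] at h1
  constructor <;> linarith

theorem continuousOn_regArgmax {ρ : ℝ} (hρ : 0 < ρ) : ContinuousOn (p.regArgmax ρ) p.X := by
  have := h.l_nonneg
  refine (LipschitzOnWith.of_dist_le_mul (K := (l / ρ).toNNReal) fun x hx x' hx' => ?_).continuousOn
  rw [dist_eq_norm, dist_eq_norm, Real.coe_toNNReal _ (by positivity)]
  exact h.norm_regArgmax_sub_le hρ hx' hx

end Regular

end Problem

/-! ### Deterministic inequalities for one iteration. -/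

namespace Problem

namespace Regular

variable {dx dy : ℕ} {Z : Type*} [MeasurableSpace Z]
variable {p : Problem dx dy Z} {l δ : ℝ} (h : p.Regular l δ)
include h

theorem proxX_mem (α : ℝ) (u : Vec dx) : prox p.f p.X α u ∈ p.X :=
  prox_mem h.standing.X_compact h.standing.X_nonempty h.standing.f_cont α u

theorem proxY_mem (α : ℝ) (u : Vec dy) : prox p.h p.Y α u ∈ p.Y :=
  prox_mem h.standing.Y_compact h.standing.Y_nonempty h.standing.h_cont α u

/-- Descent of the regularized primal function along one proximal step in `x`. -/
theorem regMax_step_le {ρ α η : ℝ} (hρ : 0 < ρ) (hα : 0 < α) (hη : 0 ≤ η) (hη1 : η ≤ 1)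
    (hK : α * (l + l ^ 2 / (2 * ρ)) ≤ 1 / 8) {x v : Vec dx} (hx : x ∈ p.X) {y : Vec dy}
    (hy : y ∈ p.Y) {xt x' : Vec dx} (hxt : xt = prox p.f p.X α (x - α • v))
    (hx' : x' = x + η • (xt - x)) :
    p.regMax ρ x' + p.f x' ≤ p.regMax ρ x + p.f x
      + 2 * (η * α) * l ^ 2 * ‖y - p.regArgmax ρ x‖ ^ 2
      + 2 * (η * α) * ‖p.gGradX x y - v‖ ^ 2 - 5 / 8 * (η / α) * ‖xt - x‖ ^ 2 := by
  have hxtX : xt ∈ p.X := hxt ▸ h.proxX_mem α _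
  have e0 : x' = (1 - η) • x + η • xt := by rw [hx']; module
  have hx'X : x' ∈ p.X := e0 ▸ h.standing.X_convex hx hxtX (sub_nonneg.2 hη1) hη (by ring)
  have hf := h.standing.f_convex.2 hx hxtX (sub_nonneg.2 hη1) hη (by ring)
  rw [← e0] at hf
  simp only [smul_eq_mul] at hf
  have hp1 := prox_le h.standing.X_compact h.standing.X_nonempty h.standing.f_convex
    h.standing.f_cont hα x v hx
  rw [← hxt, sub_self, norm_zero, norm_sub_rev x xt] at hp1
  have m := h.regArgmax_mem ρ hx
  have hΦ := h.regMax_le_linear hρ hx hx'X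
  have e1 : x' - x = η • (xt - x) := by rw [hx']; module
  rw [e1, inner_smul_right, norm_smul, Real.norm_of_nonneg hη] at hΦ
  set u := p.regArgmax ρ x
  set d := xt - x
  have hg := h.gGradX_sub_le hx hx m hy
  rw [sub_self, norm_zero, zero_add, norm_sub_rev u y] at hg
  have hg2 : ‖p.gGradX x u - p.gGradX x y‖ ^ 2 ≤ l ^ 2 * ‖y - u‖ ^ 2 := by
    rw [← mul_pow]; exact pow_le_pow_left₀ (norm_nonneg _) hg 2
  have e2 : inner ℝ (p.gGradX x u) d - inner ℝ v d =
      inner ℝ ((p.gGradX x u - p.gGradX x y) + (p.gGradX x y - v)) d := by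
    rw [← inner_sub_left]; congr 1; module
  set A := p.gGradX x u - p.gGradX x y
  set e := p.gGradX x y - v
  have h1 : inner ℝ (A + e) d ≤ α * ‖A + e‖ ^ 2 + 1 / (4 * α) * ‖d‖ ^ 2 := by
    have h2 := real_inner_le_norm (A + e) d
    have h3 : α * ‖A + e‖ ^ 2 + 1 / (4 * α) * ‖d‖ ^ 2 - ‖A + e‖ * ‖d‖ =
        (2 * α * ‖A + e‖ - ‖d‖) ^ 2 / (4 * α) := by field_simp; ring
    have h4 : 0 ≤ (2 * α * ‖A + e‖ - ‖d‖) ^ 2 / (4 * α) := by positivity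
    linarith
  have h2 : ‖A + e‖ ^ 2 ≤ 2 * ‖A‖ ^ 2 + 2 * ‖e‖ ^ 2 := by
    have := parallelogram_law_with_norm ℝ A e
    nlinarith [mul_self_nonneg ‖A - e‖]
  have h3 : (l + l ^ 2 / (2 * ρ)) * (η * ‖d‖) ^ 2 ≤ 1 / 8 * (η / α) * ‖d‖ ^ 2 := by
    have h4 : l + l ^ 2 / (2 * ρ) ≤ 1 / 8 / α := by rw [le_div_iff₀ hα]; linarith
    calc _ ≤ 1 / 8 / α * (η * ‖d‖) ^ 2 := mul_le_mul_of_nonneg_right h4 (by positivity)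
      _ = 1 / 8 * (η / α) * ‖d‖ ^ 2 * η := by ring
      _ ≤ _ := mul_le_of_le_one_right (by positivity) hη1
  have h5 : η * (inner ℝ (p.gGradX x u) d - inner ℝ v d) ≤
      η * (α * (2 * (l ^ 2 * ‖y - u‖ ^ 2) + 2 * ‖e‖ ^ 2) + 1 / (4 * α) * ‖d‖ ^ 2) := by
    refine mul_le_mul_of_nonneg_left ?_ hη
    rw [e2]
    refine h1.trans ?_
    have := mul_le_mul_of_nonneg_left
      (h2.trans (add_le_add_left (mul_le_mul_of_nonneg_left hg2 zero_le_two) _)) hα.le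
    linarith
  -- The proximal step yields `‖d‖² / α`. Young's inequality for the estimation error takes `1/4` of
  -- it and the curvature of the maximum `1/8`, which leaves the `5/8` of the statement.
  have h6 : η * (p.f xt - p.f x) ≤ η * (-inner ℝ v d - 1 / α * ‖d‖ ^ 2) := by
    refine mul_le_mul_of_nonneg_left ?_ hη
    have : 1 / (2 * α) * (0 ^ 2 - ‖d‖ ^ 2 - ‖d‖ ^ 2) = - (1 / α * ‖d‖ ^ 2) := by
      field_simp; ring
    linarith
  have h7 : η * (1 / α * ‖d‖ ^ 2) = η / α * ‖d‖ ^ 2 := by ring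
  have h8 : η * (1 / (4 * α) * ‖d‖ ^ 2) = 1 / 4 * (η / α * ‖d‖ ^ 2) := by field_simp
  linarith

/-- Contraction of the distance to the inner maximizer along one proximal step in `y`. -/
theorem norm_step_sub_regArgmax_sq_le {ρ β η : ℝ} (hρ : 0 < ρ) (hβ : 0 < β) (hη : 0 ≤ η)
    (hη1 : η ≤ 1) (hK : 2 * β * (l + ρ / 2) ≤ 1 / 3) {x : Vec dx} (hx : x ∈ p.X) {y w : Vec dy}
    (hy : y ∈ p.Y) {yt y' : Vec dy} (hyt : yt = prox p.h p.Y β (y + β • w))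
    (hy' : y' = y + η • (yt - y)) :
    ‖y' - p.regArgmax ρ x‖ ^ 2 ≤ (1 - η * β * ρ) * ‖y - p.regArgmax ρ x‖ ^ 2
      - 2 / 3 * η * ‖yt - y‖ ^ 2 + η * β / ρ * ‖p.gGradY x y - ρ • y - w‖ ^ 2 := by
  have hytY : yt ∈ p.Y := hyt ▸ h.proxY_mem β _
  have m := h.regArgmax_mem ρ hx
  have hp1 := prox_le h.standing.Y_compact h.standing.Y_nonempty h.standing.h_convex
    h.standing.h_cont hβ y (-w) m
  have e0 : y - β • -w = y + β • w := by module
  rw [e0, ← hyt, inner_neg_left] at hp1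
  have h1 := h.regObj_add_le_regMax (ρ := ρ) hx hytY
  rw [h.regMax_eq ρ hx] at h1
  have h2 := h.g_le_linear hx hy m
  have h3 := (abs_le.1 (h.abs_g_sub_linear_y_le hx hy hytY)).1
  simp only [regObj] at h1
  set u := p.regArgmax ρ x
  set e := p.gGradY x y - ρ • y - w with he
  have e1 : inner ℝ (p.gGradY x y) (u - y) - inner ℝ (p.gGradY x y) (yt - y) =
      inner ℝ e (u - yt) + ρ * inner ℝ y (u - yt) + inner ℝ w (u - yt) := by
    rw [← inner_sub_right, he, inner_sub_left, inner_sub_left, real_inner_smul_left]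
    have : u - y - (yt - y) = u - yt := by module
    rw [this]; ring
  have e2 : ‖u‖ ^ 2 = ‖y‖ ^ 2 + 2 * inner ℝ y (u - y) + ‖u - y‖ ^ 2 := by
    rw [← norm_add_sq_real]; congr 2; module
  have e3 : ‖yt‖ ^ 2 = ‖y‖ ^ 2 + 2 * inner ℝ y (yt - y) + ‖yt - y‖ ^ 2 := by
    rw [← norm_add_sq_real]; congr 2; module
  have e4 : inner ℝ y (u - y) - inner ℝ y (yt - y) = inner ℝ y (u - yt) := by
    rw [← inner_sub_right]; congr 1; module
  have e5 : inner ℝ w (yt - u) = - inner ℝ w (u - yt) := by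
    rw [← inner_neg_right]; congr 1; module
  rw [norm_sub_rev u y, norm_sub_rev u yt] at hp1
  rw [norm_sub_rev u y] at e2
  set a := ‖y - u‖
  set c := ‖yt - u‖
  set d := ‖yt - y‖
  have h4 : inner ℝ e (u - yt) ≤ ρ / 2 * c ^ 2 + 1 / (2 * ρ) * ‖e‖ ^ 2 := by
    have h5 := real_inner_le_norm e (u - yt)
    rw [norm_sub_rev u yt] at h5
    have h6 : ρ / 2 * c ^ 2 + 1 / (2 * ρ) * ‖e‖ ^ 2 - ‖e‖ * c = (ρ * c - ‖e‖) ^ 2 / (2 * ρ) := by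
      field_simp; ring
    have h7 : 0 ≤ (ρ * c - ‖e‖) ^ 2 / (2 * ρ) := by positivity
    linarith
  -- Growth at `yt`, concavity and the lower smoothness bound of `g` at `y`, the proximal inequality
  -- and Young are added. The growth term `ρ c² / 2` is spent on the error `e`; expanding the
  -- squared norms around `y` provides the new `ρ a² / 2` from which the contraction comes.
  have h8 : ρ / 2 * a ^ 2 ≤ 1 / (2 * ρ) * ‖e‖ ^ 2 + (l + ρ / 2) * d ^ 2 +
      1 / (2 * β) * (a ^ 2 - d ^ 2 - c ^ 2) := by
    linear_combination h1 + h2 + h3 + hp1 + h4 + e1 - ρ / 2 * e2 + ρ / 2 * e3 - ρ * e4 + e5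
  have h9 : c ^ 2 ≤ (1 - β * ρ) * a ^ 2 - 2 / 3 * d ^ 2 + β / ρ * ‖e‖ ^ 2 := by
    have h10 := mul_le_mul_of_nonneg_left h8 (by positivity : 0 ≤ 2 * β)
    have h11 : 2 * β * (1 / (2 * ρ) * ‖e‖ ^ 2 + (l + ρ / 2) * d ^ 2 +
        1 / (2 * β) * (a ^ 2 - d ^ 2 - c ^ 2)) = β / ρ * ‖e‖ ^ 2 + 2 * β * (l + ρ / 2) * d ^ 2 +
        (a ^ 2 - d ^ 2 - c ^ 2) := by
      field_simp
    have h12 := mul_le_mul_of_nonneg_right hK (sq_nonneg d)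
    linarith
  have e6 : ‖y' - u‖ ^ 2 = (1 - η) * a ^ 2 + η * c ^ 2 - η * (1 - η) * d ^ 2 := by
    have i1 : y' - u = (y - u) + η • (yt - y) := by rw [hy']; module
    have i2 : yt - u = (y - u) + (yt - y) := by module
    have i3 : c ^ 2 = a ^ 2 + 2 * inner ℝ (y - u) (yt - y) + d ^ 2 := by
      rw [← norm_add_sq_real, ← i2]
    rw [i1, norm_add_sq_real, norm_smul, inner_smul_right, Real.norm_of_nonneg hη]
    linear_combination -η * i3
  have h13 := mul_le_mul_of_nonneg_left h9 hη
  have h14 : 0 ≤ η * (1 - η) * d ^ 2 := by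
    have := sub_nonneg.2 hη1
    positivity
  rw [e6]
  have : η * (β / ρ * ‖e‖ ^ 2) = η * β / ρ * ‖e‖ ^ 2 := by ring
  linarith

/-- Bound for the stationarity gap by the steps and the errors of the estimators. -/
theorem norm_gap_le {ρ α β : ℝ} (hρ : 0 < ρ) (hα : 0 < α) (hβ : 0 < β) {x v xt : Vec dx}
    {y w yt : Vec dy} (hy : y ∈ p.Y)
    (hxt : xt = prox p.f p.X α (x - α • v)) (hyt : yt = prox p.h p.Y β (y + β • w)) {ε : ℝ}
    (hε : 0 < ε) :
    ‖p.gap α β x y‖ ≤ (2 / α ^ 2 * ‖xt - x‖ ^ 2 + 2 * ‖p.gGradX x y - v‖ ^ 2 +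
      2 / β ^ 2 * ‖yt - y‖ ^ 2 + 2 * ‖p.gGradY x y - ρ • y - w‖ ^ 2) / ε + ε / 4 +
      ρ * p.sigmaY := by
  set e := p.gGradX x y - v with he
  set e' := p.gGradY x y - ρ • y - w with he'
  set xb := prox p.f p.X α (x - α • p.gGradX x y) with hxb
  set yc := prox p.h p.Y β (y + β • (p.gGradY x y - ρ • y)) with hyc
  set yb := prox p.h p.Y β (y + β • p.gGradY x y) with hyb
  have h1 : ‖xb - xt‖ ≤ α * ‖e‖ := by
    rw [hxt, hxb]
    refine (norm_prox_sub_le h.standing.X_compact h.standing.X_nonempty h.standing.f_convex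
      h.standing.f_cont hα _ _).trans (le_of_eq ?_)
    rw [← norm_neg, he]
    have : -(x - α • p.gGradX x y - (x - α • v)) = α • (p.gGradX x y - v) := by module
    rw [this, norm_smul, Real.norm_of_nonneg hα.le]
  have hpY := norm_prox_sub_le h.standing.Y_compact h.standing.Y_nonempty h.standing.h_convex
      h.standing.h_cont hβ
  have h2 : ‖yc - yt‖ ≤ β * ‖e'‖ := by
    rw [hyt, hyc]
    refine (hpY _ _).trans (le_of_eq ?_)
    have : y + β • (p.gGradY x y - ρ • y) - (y + β • w) = β • (p.gGradY x y - ρ • y - w) := by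
      module
    rw [this, norm_smul, Real.norm_of_nonneg hβ.le]
  have h3 : ‖yc - yb‖ ≤ β * (ρ * p.sigmaY) := by
    refine (hpY _ _).trans ?_
    have : y + β • (p.gGradY x y - ρ • y) - (y + β • p.gGradY x y) = -(β • (ρ • y)) := by
      module
    rw [this, norm_neg, norm_smul, norm_smul, Real.norm_of_nonneg hβ.le, Real.norm_of_nonneg hρ.le]
    gcongr
    exact h.norm_le_sigmaY hy
  -- The gap of the regularized problem plus a bias, which is at most `ρ σ_y` since the proximity
  -- operator is nonexpansive.
  have e1 : p.gap α β x y = WithLp.toLp 2 ((1 / α) • (x - xb), (1 / β) • (y - yc)) +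
      WithLp.toLp 2 ((0 : Vec dx), (1 / β) • (yc - yb)) := by
    rw [← WithLp.toLp_add, Prod.mk_add_mk, add_zero, ← smul_add, sub_add_sub_cancel]
    rfl
  have h4 : ‖WithLp.toLp 2 ((0 : Vec dx), (1 / β) • (yc - yb))‖ ≤ ρ * p.sigmaY := by
    have h0 := WithLp.prod_norm_sq_eq_of_L2 (WithLp.toLp 2 ((0 : Vec dx), (1 / β) • (yc - yb)))
    simp only [WithLp.toLp_fst, WithLp.toLp_snd, norm_zero] at h0
    have h5 : ‖WithLp.toLp 2 ((0 : Vec dx), (1 / β) • (yc - yb))‖ = ‖(1 / β) • (yc - yb)‖ := by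
      rw [← sq_eq_sq₀ (norm_nonneg _) (norm_nonneg _), h0]; ring
    rw [h5, norm_smul, Real.norm_of_nonneg (by positivity), one_div, inv_mul_le_iff₀ hβ]
    exact h3
  set R := 2 / α ^ 2 * ‖xt - x‖ ^ 2 + 2 * ‖e‖ ^ 2 + 2 / β ^ 2 * ‖yt - y‖ ^ 2 + 2 * ‖e'‖ ^ 2
  have key : ∀ {n : ℕ} {c : ℝ} (hc : 0 < c) (a b d r : Vec n), ‖b - d‖ ≤ c * ‖r‖ →
      ‖(1 / c) • (a - b)‖ ^ 2 ≤ 2 / c ^ 2 * ‖d - a‖ ^ 2 + 2 * ‖r‖ ^ 2 := by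
    intro n c hc a b d r hr
    have i1 : ‖a - b‖ ≤ ‖d - a‖ + c * ‖r‖ := by
      calc ‖a - b‖ = ‖(a - d) - (b - d)‖ := by congr 1; module
        _ ≤ ‖a - d‖ + ‖b - d‖ := norm_sub_le _ _
        _ ≤ _ := by rw [norm_sub_rev a d]; linarith
    rw [norm_smul, mul_pow, Real.norm_of_nonneg (by positivity)]
    have i2 : ‖a - b‖ ^ 2 ≤ 2 * ‖d - a‖ ^ 2 + 2 * (c * ‖r‖) ^ 2 :=
      (pow_le_pow_left₀ (norm_nonneg _) i1 2).trans
        (by nlinarith [sq_nonneg (‖d - a‖ - c * ‖r‖)])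
    calc (1 / c) ^ 2 * ‖a - b‖ ^ 2 ≤ (1 / c) ^ 2 * (2 * ‖d - a‖ ^ 2 + 2 * (c * ‖r‖) ^ 2) :=
          mul_le_mul_of_nonneg_left i2 (by positivity)
      _ = _ := by field_simp
  have h5 : ‖WithLp.toLp 2 ((1 / α) • (x - xb), (1 / β) • (y - yc))‖ ^ 2 ≤ R := by
    rw [WithLp.prod_norm_sq_eq_of_L2]
    simp only [WithLp.toLp_fst, WithLp.toLp_snd]
    have i1 := key hα x xb xt e h1
    have i2 := key hβ y yc yt e' h2
    linarith
  have h6 : ‖WithLp.toLp 2 ((1 / α) • (x - xb), (1 / β) • (y - yc))‖ ≤ R / ε + ε / 4 := by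
    set t := ‖WithLp.toLp 2 ((1 / α) • (x - xb), (1 / β) • (y - yc))‖
    -- The norm is bounded by its square so that only second moments enter after taking
    -- expectations.
    have i1 : t ^ 2 / ε + ε / 4 - t = (t - ε / 2) ^ 2 / ε := by field_simp; ring
    have i2 : 0 ≤ (t - ε / 2) ^ 2 / ε := by positivity
    have i3 : t ^ 2 / ε ≤ R / ε := div_le_div_of_nonneg_right h5 hε.le
    linarith
  rw [e1]
  exact (norm_add_le _ _).trans (add_le_add h6 h4)

theorem continuousOn_gGradX :
    ContinuousOn (fun z : Vec dx × Vec dy => p.gGradX z.1 z.2) (p.X ×ˢ p.Y) := by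
  have hl := h.l_nonneg
  refine (LipschitzOnWith.of_dist_le_mul (K := (2 * l).toNNReal)
    fun z hz z' hz' => ?_).continuousOn
  rw [dist_eq_norm, dist_eq_norm, Real.coe_toNNReal _ (by positivity)]
  refine (h.gGradX_sub_le hz.1 hz'.1 hz.2 hz'.2).trans ?_
  have h1 : ‖z.1 - z'.1‖ ≤ ‖z - z'‖ := norm_fst_le (z - z')
  have h2 : ‖z.2 - z'.2‖ ≤ ‖z - z'‖ := norm_snd_le (z - z')
  nlinarith

theorem continuousOn_gGradY :
    ContinuousOn (fun z : Vec dx × Vec dy => p.gGradY z.1 z.2) (p.X ×ˢ p.Y) := by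
  have hl := h.l_nonneg
  refine (LipschitzOnWith.of_dist_le_mul (K := (2 * l).toNNReal)
    fun z hz z' hz' => ?_).continuousOn
  rw [dist_eq_norm, dist_eq_norm, Real.coe_toNNReal _ (by positivity)]
  refine (h.gGradY_sub_le hz.1 hz'.1 hz.2 hz'.2).trans ?_
  have h1 : ‖z.1 - z'.1‖ ≤ ‖z - z'‖ := norm_fst_le (z - z')
  have h2 : ‖z.2 - z'.2‖ ≤ ‖z - z'‖ := norm_snd_le (z - z')
  nlinarith

theorem continuousOn_gap {α β : ℝ} (hα : 0 < α) (hβ : 0 < β) :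
    ContinuousOn (fun z : Vec dx × Vec dy => p.gap α β z.1 z.2) (p.X ×ˢ p.Y) := by
  have c1 := h.continuousOn_gGradX
  have c2 := h.continuousOn_gGradY
  have c3 := continuous_prox h.standing.X_compact h.standing.X_nonempty h.standing.f_convex
    h.standing.f_cont hα
  have c4 := continuous_prox h.standing.Y_compact h.standing.Y_nonempty h.standing.h_convex
    h.standing.h_cont hβ
  unfold gap
  refine (WithLp.prod_continuous_toLp 2 _ _).comp_continuousOn (ContinuousOn.prodMk ?_ ?_)
  · have c5 : ContinuousOn (fun z : Vec dx × Vec dy =>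
        z.1 - prox p.f p.X α (z.1 - α • p.gGradX z.1 z.2)) (p.X ×ˢ p.Y) :=
      continuousOn_fst.sub (c3.comp_continuousOn (continuousOn_fst.sub (c1.const_smul α)))
    exact c5.const_smul (1 / α)
  · have c5 : ContinuousOn (fun z : Vec dx × Vec dy =>
        z.2 - prox p.h p.Y β (z.2 + β • p.gGradY z.1 z.2)) (p.X ×ˢ p.Y) :=
      continuousOn_snd.sub (c4.comp_continuousOn (continuousOn_snd.add (c2.const_smul β)))
    exact c5.const_smul (1 / β)

end Regular

end Problem

/-! ### Centered noise driven by independent samples. -/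

/-- The inner product of square integrable maps is integrable. -/
theorem integrable_inner_of_memLp {Ω : Type*} [MeasurableSpace Ω] {P : Measure Ω} {n : ℕ}
    {u v : Ω → Vec n} (hu : MemLp u 2 P) (hv : MemLp v 2 P) :
    Integrable (fun ω => inner ℝ (u ω) (v ω)) P := by
  have h1 : Integrable (fun ω => ‖u ω‖ ^ 2 + ‖v ω‖ ^ 2) P :=
    ((memLp_two_iff_integrable_sq_norm hu.1).1 hu).add
      ((memLp_two_iff_integrable_sq_norm hv.1).1 hv)
  refine h1.mono' (hu.1.inner hv.1) (Filter.Eventually.of_forall fun ω => ?_)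
  refine (norm_inner_le_norm _ _).trans ?_
  nlinarith [sq_nonneg (‖u ω‖ - ‖v ω‖), sq_nonneg (‖u ω‖), sq_nonneg (‖v ω‖)]

section Orthogonality

variable {Ω Z A : Type*} [mΩ : MeasurableSpace Ω] [MeasurableSpace Z] [MeasurableSpace A]
  {P : Measure Ω} [IsProbabilityMeasure P] {D : Measure Z} [IsProbabilityMeasure D] {n : ℕ}

/-- A family of noises `c a`, indexed by the parameter `a`, centered and with second moment at
most `ψ a`. -/
structure CenteredNoise (D : Measure Z) (c : A → Z → Vec n) (ψ : A → ℝ) : Prop where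
  measurable : Measurable (Function.uncurry c)
  integrable : ∀ a, Integrable (c a) D
  integral_eq_zero : ∀ a, ∫ z, c a z ∂D = 0
  integrable_sq : ∀ a, Integrable (fun z => ‖c a z‖ ^ 2) D
  integral_sq_le : ∀ a, ∫ z, ‖c a z‖ ^ 2 ∂D ≤ ψ a
  measurable_bound : Measurable ψ
  bounded : ∃ B, ∀ a, ψ a ≤ B

variable {c : A → Z → Vec n} {ψ : A → ℝ} (hc : CenteredNoise D c ψ)
include hc

omit [IsProbabilityMeasure D] in
theorem CenteredNoise.bound_nonneg (a : A) : 0 ≤ ψ a :=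
  (integral_nonneg fun _ => by positivity).trans (hc.integral_sq_le a)

omit [IsProbabilityMeasure D] in
theorem CenteredNoise.integrable_bound {U : Ω → A} (hU : Measurable U) :
    Integrable (fun ω => ψ (U ω)) P := by
  obtain ⟨B, hB⟩ := hc.bounded
  refine Integrable.of_bound (hc.measurable_bound.comp hU).aestronglyMeasurable B
    (Filter.Eventually.of_forall fun ω => ?_)
  rw [Real.norm_of_nonneg (hc.bound_nonneg _)]
  exact hB _

variable {U : Ω → A} (hU : Measurable U)
include hU

theorem CenteredNoise.integrable_prod_sq :
    Integrable (fun q : A × Z => ‖c q.1 q.2‖ ^ 2) ((P.map U).prod D) := by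
  have := Measure.isProbabilityMeasure_map (μ := P) hU.aemeasurable
  obtain ⟨B, hB⟩ := hc.bounded
  have hm : Measurable (fun q : A × Z => ‖c q.1 q.2‖ ^ 2) := hc.measurable.norm.pow_const 2
  rw [integrable_prod_iff hm.aestronglyMeasurable]
  refine ⟨Filter.Eventually.of_forall fun a => hc.integrable_sq a, ?_⟩
  refine Integrable.of_bound
    (hm.norm.stronglyMeasurable.integral_prod_right).aestronglyMeasurable B
    (Filter.Eventually.of_forall fun a => ?_)
  rw [Real.norm_of_nonneg (integral_nonneg fun _ => norm_nonneg _)]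
  simp only [norm_pow, norm_norm]
  exact (hc.integral_sq_le a).trans (hB a)

variable {W : Ω → Z} (hW : Measurable W) (hlaw : P.map W = D)
include hW hlaw

omit [IsProbabilityMeasure D] hc in
theorem map_prodMk_eq_prod (hind : IndepFun U W P) :
    P.map (fun ω => (U ω, W ω)) = (P.map U).prod D := by
  rw [(indepFun_iff_map_prod_eq_prod_map_map hU.aemeasurable hW.aemeasurable).1 hind, hlaw]

theorem CenteredNoise.memLp (hind : IndepFun U W P) :
    MemLp (fun ω => c (U ω) (W ω)) 2 P := by
  have hUW : Measurable (fun ω => (U ω, W ω)) := hU.prodMk hW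
  have hm : Measurable (fun ω => c (U ω) (W ω)) := hc.measurable.comp hUW
  rw [memLp_two_iff_integrable_sq_norm hm.aestronglyMeasurable]
  have h1 := hc.integrable_prod_sq (P := P) hU
  rw [← map_prodMk_eq_prod hU hW hlaw hind] at h1
  exact h1.comp_measurable hUW

theorem CenteredNoise.integral_sq_comp_le (hind : IndepFun U W P) :
    ∫ ω, ‖c (U ω) (W ω)‖ ^ 2 ∂P ≤ ∫ ω, ψ (U ω) ∂P := by
  have := Measure.isProbabilityMeasure_map (μ := P) hU.aemeasurable
  have hUW : Measurable (fun ω => (U ω, W ω)) := hU.prodMk hW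
  have hm : Measurable (fun q : A × Z => ‖c q.1 q.2‖ ^ 2) := hc.measurable.norm.pow_const 2
  have h1 := hc.integrable_prod_sq (P := P) hU
  calc ∫ ω, ‖c (U ω) (W ω)‖ ^ 2 ∂P
      = ∫ q : A × Z, ‖c q.1 q.2‖ ^ 2 ∂(P.map (fun ω => (U ω, W ω))) :=
        (integral_map hUW.aemeasurable hm.aestronglyMeasurable).symm
    _ = ∫ a, ∫ z, ‖c a z‖ ^ 2 ∂D ∂(P.map U) := by
        rw [map_prodMk_eq_prod hU hW hlaw hind, integral_prod _ h1]
    _ ≤ ∫ a, ψ a ∂(P.map U) := by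
        refine integral_mono h1.integral_prod_left ?_ hc.integral_sq_le
        rw [integrable_map_measure hc.measurable_bound.aestronglyMeasurable hU.aemeasurable]
        exact hc.integrable_bound hU
    _ = _ := integral_map hU.aemeasurable hc.measurable_bound.aestronglyMeasurable

/-- Fubini: `(M, U)` and `W` have a product law, and for a fixed value of `(M, U)` the integral over
the sample vanishes. This does the work of a conditional expectation. -/
theorem CenteredNoise.integral_inner_eq_zero {M : Ω → Vec n} (hM : Measurable M)
    (hM2 : MemLp M 2 P) (hind : IndepFun (fun ω => (M ω, U ω)) W P) :
    ∫ ω, inner ℝ (M ω) (c (U ω) (W ω)) ∂P = 0 := by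
  have hMU : Measurable (fun ω => (M ω, U ω)) := hM.prodMk hU
  have := Measure.isProbabilityMeasure_map (μ := P) hMU.aemeasurable
  have hindU : IndepFun U W P := hind.comp measurable_snd measurable_id
  have hF : Measurable (fun q : (Vec n × A) × Z => inner ℝ q.1.1 (c q.1.2 q.2)) :=
    measurable_fst.fst.inner (hc.measurable.comp (measurable_fst.snd.prodMk measurable_snd))
  have hall : Measurable (fun ω => ((M ω, U ω), W ω)) := hMU.prodMk hW
  have hmap : P.map (fun ω => ((M ω, U ω), W ω)) = (P.map (fun ω => (M ω, U ω))).prod D := by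
    rw [(indepFun_iff_map_prod_eq_prod_map_map hMU.aemeasurable hW.aemeasurable).1 hind, hlaw]
  have hint : Integrable (fun ω => inner ℝ (M ω) (c (U ω) (W ω))) P :=
    integrable_inner_of_memLp hM2 (hc.memLp hU hW hlaw hindU)
  have hint' : Integrable (fun q : (Vec n × A) × Z => inner ℝ q.1.1 (c q.1.2 q.2))
      ((P.map (fun ω => (M ω, U ω))).prod D) := by
    rw [← hmap, integrable_map_measure hF.aestronglyMeasurable hall.aemeasurable]
    exact hint
  calc ∫ ω, inner ℝ (M ω) (c (U ω) (W ω)) ∂P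
      = ∫ q : (Vec n × A) × Z, inner ℝ q.1.1 (c q.1.2 q.2)
          ∂(P.map (fun ω => ((M ω, U ω), W ω))) :=
        (integral_map hall.aemeasurable hF.aestronglyMeasurable).symm
    _ = ∫ r, ∫ z, inner ℝ r.1 (c r.2 z) ∂D ∂(P.map (fun ω => (M ω, U ω))) := by
        rw [hmap, integral_prod _ hint']
    _ = 0 := by
        simp_rw [integral_inner (hc.integrable _), hc.integral_eq_zero, inner_zero_right,
          integral_zero]

omit hW hlaw hU in
/-- Adding independent centered noises one after the other. -/
theorem CenteredNoise.integral_norm_add_sum_sq_le (N : ℕ) :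
    ∀ (F : Fin N → MeasurableSpace Ω) (W : Fin N → Ω → Z) (e : Ω → Vec n) (U : Ω → A),
    (∀ j, F j ≤ mΩ) → (∀ j, Indep (F j) (MeasurableSpace.comap (W j) inferInstance) P) →
    (∀ i j, i < j → Measurable[F j] (W i)) → (∀ j, Measurable[F j] U) →
    (∀ j, Measurable[F j] e) → (∀ j, Measurable (W j)) → (∀ j, P.map (W j) = D) →
    MemLp e 2 P →
    MemLp (fun ω => e ω + ∑ j, c (U ω) (W j ω)) 2 P ∧
    ∫ ω, ‖e ω + ∑ j, c (U ω) (W j ω)‖ ^ 2 ∂P ≤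
      ∫ ω, ‖e ω‖ ^ 2 ∂P + N * ∫ ω, ψ (U ω) ∂P := by
  induction N with
  | zero => intro F W e U _ _ _ _ _ _ _ he; simpa using he
  | succ N ih =>
    intro F W e U hF hind hWF hUF heF hW hlaw he
    -- Split off the last sample. The partial sum before it is `F L`-measurable, hence orthogonal to
    -- the last noise, so second moments add.
    obtain ⟨h1, h2⟩ := ih (fun j => F j.castSucc) (fun j => W j.castSucc) e U (fun j => hF _)
      (fun j => hind _) (fun i j hij => hWF _ _ (by simpa using hij)) (fun j => hUF _)
      (fun j => heF _) (fun j => hW _) (fun j => hlaw _) he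
    set L := Fin.last N
    have hUm : Measurable U := (hUF L).mono (hF L) le_rfl
    have hMF : Measurable[F L] (fun ω => e ω + ∑ j : Fin N, c (U ω) (W j.castSucc ω)) := by
      refine (heF L).add (Finset.measurable_sum _ fun j _ => ?_)
      exact hc.measurable.comp ((hUF L).prodMk (hWF _ _ (Fin.castSucc_lt_last j)))
    have hindM : IndepFun (fun ω => (e ω + ∑ j : Fin N, c (U ω) (W j.castSucc ω), U ω))
        (W L) P := by
      rw [IndepFun_iff_Indep]
      exact indep_of_indep_of_le_left (hind L) (hMF.prodMk (hUF L)).comap_le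
    have hindU : IndepFun U (W L) P := by
      rw [IndepFun_iff_Indep]
      exact indep_of_indep_of_le_left (hind L) (hUF L).comap_le
    have hMm := hMF.mono (hF L) le_rfl
    have h3 := hc.memLp hUm (hW L) (hlaw L) hindU
    have h4 := hc.integral_inner_eq_zero hUm (hW L) (hlaw L) hMm h1 hindM
    have h5 := hc.integral_sq_comp_le hUm (hW L) (hlaw L) hindU
    have e1 : ∀ ω, e ω + ∑ j, c (U ω) (W j ω) =
        (e ω + ∑ j : Fin N, c (U ω) (W j.castSucc ω)) + c (U ω) (W L ω) := by
      intro ω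
      rw [Fin.sum_univ_castSucc, add_assoc]
    simp_rw [e1]
    refine ⟨h1.add h3, ?_⟩
    set M := fun ω => e ω + ∑ j : Fin N, c (U ω) (W j.castSucc ω)
    have i1 : Integrable (fun ω => ‖M ω‖ ^ 2) P :=
      (memLp_two_iff_integrable_sq_norm h1.1).1 h1
    have i2 : Integrable (fun ω => ‖c (U ω) (W L ω)‖ ^ 2) P :=
      (memLp_two_iff_integrable_sq_norm h3.1).1 h3
    have i3 : Integrable (fun ω => inner ℝ (M ω) (c (U ω) (W L ω))) P :=
      integrable_inner_of_memLp h1 h3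
    have e2 : ∫ ω, ‖M ω + c (U ω) (W L ω)‖ ^ 2 ∂P =
        ∫ ω, ‖M ω‖ ^ 2 ∂P + ∫ ω, ‖c (U ω) (W L ω)‖ ^ 2 ∂P := by
      have i4 : Integrable (fun ω => 2 * inner ℝ (M ω) (c (U ω) (W L ω))) P := i3.const_mul 2
      have i5 : Integrable (fun ω => ‖M ω‖ ^ 2 + 2 * inner ℝ (M ω) (c (U ω) (W L ω))) P := i1.add i4
      simp_rw [norm_add_sq_real]
      rw [integral_add i5 i2, integral_add i1 i4, integral_const_mul, h4]
      ring
    change ∫ ω, ‖M ω + c (U ω) (W L ω)‖ ^ 2 ∂P ≤ _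
    rw [e2]
    push_cast
    linarith

end Orthogonality

/-! ### The recursive momentum estimator for a Lipschitz stochastic oracle. -/

section Oracle

variable {Ω Z V : Type*} [mΩ : MeasurableSpace Ω] [MeasurableSpace Z]
  {P : Measure Ω} [IsProbabilityMeasure P] {D : Measure Z} [IsProbabilityMeasure D] {n : ℕ}
  [MetricSpace V] [CompactSpace V] [SecondCountableTopology V] [MeasurableSpace V] [BorelSpace V]

/-- A stochastic oracle `Γ` on a space of points, `κ`-Lipschitz for every sample and of variance
at most `δ²`. -/
structure StochasticOracle (D : Measure Z) (Γ : V → Z → Vec n) (κ δ : ℝ) : Prop where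
  nonneg : 0 ≤ κ
  lip : ∀ a b z, ‖Γ a z - Γ b z‖ ≤ κ * dist a b
  measurable : ∀ a, Measurable (Γ a)
  integrable : ∀ a, Integrable (Γ a) D
  integrable_sq : ∀ a, Integrable (fun z => ‖Γ a z - ∫ z', Γ a z' ∂D‖ ^ 2) D
  var : ∀ a, ∫ z, ‖Γ a z - ∫ z', Γ a z' ∂D‖ ^ 2 ∂D ≤ δ ^ 2

/-- The noise of the recursive momentum estimator with factor `r` in a step from `q.2` to `q.1`. -/
def momentumNoise (D : Measure Z) (Γ : V → Z → Vec n) (r : ℝ) (q : V × V) (z : Z) : Vec n :=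
  (∫ z', Γ q.1 z' ∂D - Γ q.1 z) - r • (∫ z', Γ q.2 z' ∂D - Γ q.2 z)

variable {Γ : V → Z → Vec n} {κ δ : ℝ} (hΓ : StochasticOracle D Γ κ δ)
include hΓ

-- A Carathéodory function, continuous in the point and measurable in the sample, is jointly
-- measurable. This is why the oracle lives on a separable metric space of points.
omit [CompactSpace V] [IsProbabilityMeasure D] in
theorem StochasticOracle.measurable_uncurry : Measurable (Function.uncurry Γ) := by
  refine measurable_uncurry_of_continuous_of_measurable (fun z => ?_) hΓ.measurable
  refine (LipschitzWith.of_dist_le_mul (K := κ.toNNReal) fun a b => ?_).continuous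
  rw [dist_eq_norm, Real.coe_toNNReal _ hΓ.nonneg]
  exact hΓ.lip a b z

omit [CompactSpace V] [SecondCountableTopology V] [MeasurableSpace V] [BorelSpace V] in
theorem StochasticOracle.norm_mean_sub_le (a b : V) :
    ‖∫ z, Γ a z ∂D - ∫ z, Γ b z ∂D‖ ≤ κ * dist a b := by
  rw [← integral_sub (hΓ.integrable a) (hΓ.integrable b)]
  exact (norm_integral_le_of_norm_le_const
    (Filter.Eventually.of_forall fun z => hΓ.lip a b z)).trans (by simp)

omit [CompactSpace V] [SecondCountableTopology V] [MeasurableSpace V] [BorelSpace V] in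
theorem StochasticOracle.continuous_mean : Continuous (fun a => ∫ z, Γ a z ∂D) := by
  refine (LipschitzWith.of_dist_le_mul (K := κ.toNNReal) fun a b => ?_).continuous
  rw [dist_eq_norm, Real.coe_toNNReal _ hΓ.nonneg]
  exact hΓ.norm_mean_sub_le a b

/-- The noise is `r` times a difference of oracle values at two points, centered and controlled by
the Lipschitz constant, plus `1 - r` times the plain noise at the new point. The parabolic
inequality `(a + b)² ≤ 2a² + 2b²` gives the constants `8` and `2`. -/
theorem StochasticOracle.centeredNoise {r : ℝ} (hr0 : 0 ≤ r) (hr1 : r ≤ 1) (c : ℝ) :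
    CenteredNoise D (fun q z => c • momentumNoise D Γ r q z)
      (fun q => c ^ 2 * (8 * κ ^ 2 * dist q.1 q.2 ^ 2 + 2 * (1 - r) ^ 2 * δ ^ 2)) := by
  have hQ : ∀ a, Integrable (fun z => ∫ z', Γ a z' ∂D - Γ a z) D := fun a =>
    (integrable_const _).sub (hΓ.integrable a)
  have hN : ∀ q, Integrable (momentumNoise D Γ r q) D := fun q =>
    (hQ q.1).sub ((hQ q.2).smul r)
  have hQ0 : ∀ a, ∫ z, (∫ z', Γ a z' ∂D - Γ a z) ∂D = 0 := fun a => by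
    rw [integral_sub (integrable_const _) (hΓ.integrable a)]; simp
  have hm : Measurable (Function.uncurry (momentumNoise D Γ r)) := by
    have h1 := hΓ.measurable_uncurry
    have h2 := hΓ.continuous_mean.measurable
    refine ((h2.comp measurable_fst.fst).sub
      (h1.comp (measurable_fst.fst.prodMk measurable_snd))).sub
      (((h2.comp measurable_fst.snd).sub
        (h1.comp (measurable_fst.snd.prodMk measurable_snd))).const_smul r)
  have hle : ∀ q z, ‖momentumNoise D Γ r q z‖ ^ 2 ≤ 8 * κ ^ 2 * dist q.1 q.2 ^ 2 +
      2 * (1 - r) ^ 2 * ‖Γ q.1 z - ∫ z', Γ q.1 z' ∂D‖ ^ 2 := by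
    intro q z
    have e : momentumNoise D Γ r q z =
        r • ((∫ z', Γ q.1 z' ∂D - ∫ z', Γ q.2 z' ∂D) - (Γ q.1 z - Γ q.2 z)) +
        (1 - r) • (∫ z', Γ q.1 z' ∂D - Γ q.1 z) := by
      unfold momentumNoise; module
    have h1 := hΓ.norm_mean_sub_le q.1 q.2
    have h2 := hΓ.lip q.1 q.2 z
    have hd : 0 ≤ κ * dist q.1 q.2 := mul_nonneg hΓ.nonneg dist_nonneg
    have h3 : ‖r • ((∫ z', Γ q.1 z' ∂D - ∫ z', Γ q.2 z' ∂D) - (Γ q.1 z - Γ q.2 z))‖ ≤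
        2 * (κ * dist q.1 q.2) := by
      rw [norm_smul, Real.norm_of_nonneg hr0]
      refine (mul_le_of_le_one_left (norm_nonneg _) hr1).trans ((norm_sub_le _ _).trans ?_)
      linarith
    have h4 : ‖(1 - r) • (∫ z', Γ q.1 z' ∂D - Γ q.1 z)‖ =
        (1 - r) * ‖Γ q.1 z - ∫ z', Γ q.1 z' ∂D‖ := by
      rw [norm_smul, Real.norm_of_nonneg (sub_nonneg.2 hr1), norm_sub_rev]
    have h5 := norm_add_le (r • ((∫ z', Γ q.1 z' ∂D - ∫ z', Γ q.2 z' ∂D) - (Γ q.1 z - Γ q.2 z)))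
      ((1 - r) • (∫ z', Γ q.1 z' ∂D - Γ q.1 z))
    rw [← e, h4] at h5
    have h6 := h5.trans (add_le_add_left h3 _)
    refine (pow_le_pow_left₀ (norm_nonneg _) h6 2).trans ?_
    nlinarith [sq_nonneg (2 * (κ * dist q.1 q.2) - (1 - r) * ‖Γ q.1 z - ∫ z', Γ q.1 z' ∂D‖)]
  have hb : ∀ q : V × V, Integrable (fun z => 8 * κ ^ 2 * dist q.1 q.2 ^ 2 +
      2 * (1 - r) ^ 2 * ‖Γ q.1 z - ∫ z', Γ q.1 z' ∂D‖ ^ 2) D := fun q =>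
    (integrable_const _).add ((hΓ.integrable_sq q.1).const_mul _)
  have hsq : ∀ q, Integrable (fun z => ‖momentumNoise D Γ r q z‖ ^ 2) D := fun q =>
    (hb q).mono' ((hm.comp measurable_prodMk_left).norm.pow_const 2).aestronglyMeasurable
      (Filter.Eventually.of_forall fun z => by
        rw [Real.norm_of_nonneg (by positivity)]; exact hle q z)
  have hcsq : ∀ q z, ‖c • momentumNoise D Γ r q z‖ ^ 2 =
      c ^ 2 * ‖momentumNoise D Γ r q z‖ ^ 2 := fun q z => by
    rw [norm_smul, mul_pow, Real.norm_eq_abs, sq_abs]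
  have hcont : Continuous (fun q : V × V =>
      c ^ 2 * (8 * κ ^ 2 * dist q.1 q.2 ^ 2 + 2 * (1 - r) ^ 2 * δ ^ 2)) := by fun_prop
  refine ⟨hm.const_smul c, fun q => (hN q).smul c, fun q => ?_, fun q => ?_, fun q => ?_,
    hcont.measurable, ?_⟩
  · rw [integral_smul]
    unfold momentumNoise
    have h1 : Integrable (fun z => r • (∫ z', Γ q.2 z' ∂D - Γ q.2 z)) D := (hQ q.2).smul r
    rw [integral_sub (hQ q.1) h1, integral_smul, hQ0, hQ0]
    simp
  · simp_rw [hcsq]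
    exact (hsq q).const_mul _
  · simp_rw [hcsq]
    rw [integral_const_mul]
    refine mul_le_mul_of_nonneg_left ?_ (sq_nonneg c)
    refine (integral_mono (hsq q) (hb q) (hle q)).trans ?_
    rw [integral_add (integrable_const _) ((hΓ.integrable_sq q.1).const_mul _),
      integral_const_mul (2 * (1 - r) ^ 2)]
    have := mul_le_mul_of_nonneg_left (hΓ.var q.1) (by positivity : 0 ≤ 2 * (1 - r) ^ 2)
    simp only [integral_const, probReal_univ, smul_eq_mul, one_mul]
    linarith
  · obtain ⟨B, hB⟩ := (isCompact_range hcont).bddAbove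
    exact ⟨B, fun q => hB ⟨q, rfl⟩⟩

/-- The error recursion of the momentum estimator over a mini-batch of independent samples. -/
theorem StochasticOracle.momentum_step {b : ℕ} (hb : 0 < b) {r : ℝ} (hr0 : 0 ≤ r) (hr1 : r ≤ 1)
    {F : Fin b → MeasurableSpace Ω} {W : Fin b → Ω → Z} {e : Ω → Vec n} {z' z : Ω → V}
    (hF : ∀ j, F j ≤ mΩ) (hind : ∀ j, Indep (F j) (MeasurableSpace.comap (W j) inferInstance) P)
    (hWF : ∀ i j, i < j → Measurable[F j] (W i)) (hz' : ∀ j, Measurable[F j] z')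
    (hz : ∀ j, Measurable[F j] z) (heF : ∀ j, Measurable[F j] e) (hW : ∀ j, Measurable (W j))
    (hlaw : ∀ j, P.map (W j) = D) (he : MemLp e 2 P) :
    MemLp (fun ω => r • e ω + ∑ j, (1 / (b : ℝ)) • momentumNoise D Γ r (z' ω, z ω) (W j ω)) 2 P ∧
    ∫ ω, ‖r • e ω + ∑ j, (1 / (b : ℝ)) • momentumNoise D Γ r (z' ω, z ω) (W j ω)‖ ^ 2 ∂P ≤
      r ^ 2 * ∫ ω, ‖e ω‖ ^ 2 ∂P +
      (8 * κ ^ 2 * ∫ ω, dist (z' ω) (z ω) ^ 2 ∂P + 2 * (1 - r) ^ 2 * δ ^ 2) / b := by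
  have hc := hΓ.centeredNoise hr0 hr1 (1 / (b : ℝ))
  obtain ⟨h1, h2⟩ := hc.integral_norm_add_sum_sq_le (P := P) b F W (fun ω => r • e ω)
    (fun ω => (z' ω, z ω)) hF hind hWF (fun j => (hz' j).prodMk (hz j))
    (fun j => (heF j).const_smul r) hW hlaw (he.const_smul r)
  refine ⟨h1, h2.trans (le_of_eq ?_)⟩
  -- Each of the `b` noises carries the factor `1 / b²`, so the variance bound is divided by `b`.
  have hU : Measurable (fun ω => (z' ω, z ω)) :=
    ((hz' ⟨0, hb⟩).mono (hF _) le_rfl).prodMk ((hz ⟨0, hb⟩).mono (hF _) le_rfl)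
  have hd : Integrable (fun ω => dist (z' ω) (z ω) ^ 2) P := by
    have hcont : Continuous (fun q : V × V => dist q.1 q.2 ^ 2) := by fun_prop
    obtain ⟨B, hB⟩ := (isCompact_range hcont).bddAbove
    refine Integrable.of_bound (hcont.measurable.comp hU).aestronglyMeasurable B
      (Filter.Eventually.of_forall fun ω => ?_)
    rw [Real.norm_of_nonneg (by positivity)]
    exact hB ⟨(z' ω, z ω), rfl⟩
  have e1 : ∫ ω, (1 / (b : ℝ)) ^ 2 * (8 * κ ^ 2 * dist (z' ω) (z ω) ^ 2 +
      2 * (1 - r) ^ 2 * δ ^ 2) ∂P = (1 / (b : ℝ)) ^ 2 * (8 * κ ^ 2 *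
        ∫ ω, dist (z' ω) (z ω) ^ 2 ∂P + 2 * (1 - r) ^ 2 * δ ^ 2) := by
    rw [integral_const_mul, integral_add (hd.const_mul _) (integrable_const _),
      integral_const_mul]
    simp
  have e2 : ∀ ω, ‖r • e ω‖ ^ 2 = r ^ 2 * ‖e ω‖ ^ 2 := fun ω => by
    rw [norm_smul, mul_pow, Real.norm_of_nonneg hr0]
  simp_rw [e2]
  rw [e1, integral_const_mul]
  have : (b : ℝ) ≠ 0 := by positivity
  field_simp

end Oracle

/-! ### The partial gradients of `G` as oracles on `X × Y`. -/

section Problem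

variable {dx dy : ℕ} {Z : Type*} [MeasurableSpace Z] {p : Problem dx dy Z}

/-- `∇ₓ G` as an oracle on `X × Y`. -/
def oracleX (p : Problem dx dy Z) (q : p.X × p.Y) (z : Z) : Vec dx := gradX p.G q.1 q.2 z

/-- `∇_y G` as an oracle on `X × Y`. -/
def oracleY (p : Problem dx dy Z) (q : p.X × p.Y) (z : Z) : Vec dy := gradY p.G q.1 q.2 z

theorem Problem.Regular.norm_sub_add_norm_sub_le (a c : p.X × p.Y) :
    ‖(a.1 : Vec dx) - c.1‖ + ‖(a.2 : Vec dy) - c.2‖ ≤ 2 * dist a c := by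
  have h1 : dist a.1 c.1 ≤ dist a c := le_max_left _ _
  have h2 : dist a.2 c.2 ≤ dist a c := le_max_right _ _
  rw [Subtype.dist_eq, dist_eq_norm] at h1 h2
  linarith

theorem dist_sq_le (a c : p.X × p.Y) :
    dist a c ^ 2 ≤ ‖(a.1 : Vec dx) - c.1‖ ^ 2 + ‖(a.2 : Vec dy) - c.2‖ ^ 2 := by
  rw [Prod.dist_eq, Subtype.dist_eq, Subtype.dist_eq, dist_eq_norm, dist_eq_norm]
  rcases max_choice ‖(a.1 : Vec dx) - c.1‖ ‖(a.2 : Vec dy) - c.2‖ with h | h <;> rw [h] <;>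
    nlinarith [sq_nonneg ‖(a.1 : Vec dx) - c.1‖, sq_nonneg ‖(a.2 : Vec dy) - c.2‖]

variable {l δ : ℝ} (h : p.Regular l δ)
include h

theorem Problem.Regular.stochasticOracle_oracleX :
    StochasticOracle p.D (oracleX p) (2 * l) δ where
  nonneg := by have := h.l_nonneg; positivity
  lip := fun a c z => by
    have e1 := h.lip.xx a.1 a.1.2 c.1 c.1.2 a.2 a.2.2 z
    have e2 := h.lip.xy c.1 c.1.2 a.2 a.2.2 c.2 c.2.2 z
    have e3 := mul_le_mul_of_nonneg_left
      (Problem.Regular.norm_sub_add_norm_sub_le a c) h.l_nonneg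
    calc ‖oracleX p a z - oracleX p c z‖ = ‖(gradX p.G a.1 a.2 z - gradX p.G c.1 a.2 z) +
        (gradX p.G c.1 a.2 z - gradX p.G c.1 c.2 z)‖ := by
          congr 1; simp only [oracleX]; module
      _ ≤ _ := norm_add_le _ _
      _ ≤ _ := by linarith
  measurable := fun a => h.standing.gradX_measurable a.1 a.1.2 a.2 a.2.2
  integrable := fun a => h.integrable_gradX a.1.2 a.2.2
  integrable_sq := fun a => h.var.integrable_x a.1 a.1.2 a.2 a.2.2
  var := fun a => h.var.var_x a.1 a.1.2 a.2 a.2.2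

theorem Problem.Regular.stochasticOracle_oracleY :
    StochasticOracle p.D (oracleY p) (2 * l) δ where
  nonneg := by have := h.l_nonneg; positivity
  lip := fun a c z => by
    have e1 := h.lip.yx a.1 a.1.2 c.1 c.1.2 a.2 a.2.2 z
    have e2 := h.lip.yy c.1 c.1.2 a.2 a.2.2 c.2 c.2.2 z
    have e3 := mul_le_mul_of_nonneg_left
      (Problem.Regular.norm_sub_add_norm_sub_le a c) h.l_nonneg
    calc ‖oracleY p a z - oracleY p c z‖ = ‖(gradY p.G a.1 a.2 z - gradY p.G c.1 a.2 z) +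
        (gradY p.G c.1 a.2 z - gradY p.G c.1 c.2 z)‖ := by
          congr 1; simp only [oracleY]; module
      _ ≤ _ := norm_add_le _ _
      _ ≤ _ := by linarith
  measurable := fun a => h.standing.gradY_measurable a.1 a.1.2 a.2 a.2.2
  integrable := fun a => h.integrable_gradY a.1.2 a.2.2
  integrable_sq := fun a => h.var.integrable_y a.1 a.1.2 a.2 a.2.2
  var := fun a => h.var.var_y a.1 a.1.2 a.2 a.2.2

omit h in
theorem batchGradX_Gt (s : Params) (k : ℕ) (x : Vec dx) (y : Vec dy) {b : ℕ} (I : Fin b → Z) :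
    batchGradX (Gt p s k) x y I = ∑ j, (1 / (b : ℝ)) • gradX p.G x y (I j) := by
  unfold batchGradX
  rw [Finset.smul_sum]
  refine Finset.sum_congr rfl fun j _ => ?_
  congr 1
  unfold gradX Gt regularize gradient
  rw [fderiv_sub_const]

/-- The regularization contributes the same vector for every sample. It therefore drops out of the
noise, and the error of `w_k` obeys the same recursion as that of `v_k`. -/
theorem Problem.Regular.batchGradY_Gt (s : Params) (k : ℕ) {x : Vec dx} (hx : x ∈ p.X)
    {y : Vec dy} (hy : y ∈ p.Y) {b : ℕ} (hb : 0 < b) (I : Fin b → Z) :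
    batchGradY (Gt p s k) x y I = ∑ j, (1 / (b : ℝ)) • gradY p.G x y (I j) - s.ρ k • y := by
  have h1 : ∀ z, gradY (Gt p s k) x y z = gradY p.G x y z - s.ρ k • y := by
    intro z
    have h2 := (h.standing.diff_y x hx y hy z).hasGradientAt.hasFDerivAt
    have h3 := (hasStrictFDerivAt_norm_sq y).hasFDerivAt.const_mul (s.ρ k / 2)
    have h4 := h2.sub h3
    have h5 : HasGradientAt (fun y' => Gt p s k x y' z)
        (gradient (fun y' => p.G x y' z) y - s.ρ k • y) y := by
      rw [hasGradientAt_iff_hasFDerivAt]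
      have e : (InnerProductSpace.toDual ℝ (Vec dy))
          (gradient (fun y' => p.G x y' z) y - s.ρ k • y) =
          (InnerProductSpace.toDual ℝ (Vec dy)) (gradient (fun y' => p.G x y' z) y) -
            (s.ρ k / 2) • 2 • (innerSL ℝ) y := by
        rw [map_sub]
        congr 1
        ext v
        simp
        ring
      rw [e]
      exact h4
    exact h5.gradient
  unfold batchGradY
  simp_rw [h1]
  have : (b : ℝ) ≠ 0 := by positivity
  rw [Finset.sum_sub_distrib, smul_sub, Finset.smul_sum, Finset.sum_const, Finset.card_univ,
    Fintype.card_fin, ← Nat.cast_smul_eq_nsmul ℝ, smul_smul, one_div_mul_cancel this, one_smul]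

end Problem

/-! ### The parameter sequences and their elementary bounds. -/

/-- The basic power `(k + 1)^{1/13}` in which all parameter sequences are monomials. -/
def root (k : ℕ) : ℝ := ((k : ℝ) + 1) ^ (1 / 13 : ℝ)

theorem root_pow (k n : ℕ) : root k ^ n = ((k : ℝ) + 1) ^ ((n : ℝ) / 13) := by
  rw [root, ← Real.rpow_natCast, ← Real.rpow_mul (by positivity)]
  congr 1
  ring

theorem root_pow_thirteen (k : ℕ) : root k ^ 13 = (k : ℝ) + 1 := by
  rw [root_pow]; norm_num

theorem one_le_root (k : ℕ) : 1 ≤ root k :=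
  Real.one_le_rpow (by linarith [(Nat.cast_nonneg k : (0 : ℝ) ≤ k)]) (by norm_num)

theorem root_pos (k : ℕ) : 0 < root k := one_pos.trans_le (one_le_root k)

theorem root_le_root {j k : ℕ} (hjk : j ≤ k) : root j ≤ root k := by
  refine Real.rpow_le_rpow (by positivity) ?_ (by norm_num)
  have : (j : ℝ) ≤ k := by exact_mod_cast hjk
  linarith

namespace Params

variable (s : Params)

theorem η_eq (k : ℕ) : s.η k = 1 / root (k + 1) ^ 5 := by
  rw [root_pow, η]; push_cast; congr 2; ring

theorem α_eq (k : ℕ) : s.α k = s.a₄ / root (k + 1) ^ 4 := by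
  rw [root_pow, α]; push_cast; congr 2; ring

theorem ρ_eq (k : ℕ) : s.ρ k = s.L / root k ^ 2 := by
  rw [root_pow, ρ]; push_cast; rfl

theorem γ_eq (k : ℕ) : s.γ k = s.a₅ / root (k + 1) ^ 12 := by
  rw [root_pow, γ]; push_cast; congr 2; ring

theorem θ_eq (k : ℕ) : s.θ k = s.a₆ / root (k + 1) ^ 8 := by
  rw [root_pow, θ]; push_cast; congr 2; ring

theorem D₁_eq (k : ℕ) : s.D₁ k = s.a₁ * root (k + 1) ^ 3 := by
  rw [root_pow, D₁]; push_cast; congr 2; ring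

theorem D₂_eq (k : ℕ) : s.D₂ k = s.a₂ * root (k + 1) ^ 3 := by
  rw [root_pow, D₂]; push_cast; congr 2; ring

theorem η_pos (k : ℕ) : 0 < s.η k := by
  rw [η_eq]; have := root_pos (k + 1); positivity

theorem η_le_one (k : ℕ) : s.η k ≤ 1 := by
  rw [η_eq]
  exact div_le_one_of_le₀ (one_le_pow₀ (one_le_root _)) (pow_nonneg (root_pos _).le _)

namespace Admissible

variable {s} {l : ℝ} (hs : s.Admissible l) (hl : 0 < l)
include hs

theorem α_pos (k : ℕ) : 0 < s.α k := by
  rw [α_eq]; have := root_pos (k + 1); have := hs.a₄_pos; positivity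

theorem b_pos' : (0 : ℝ) < s.b := by exact_mod_cast hs.b_pos

theorem twelve_le_a₅_mul : 4 * s.a₄ + 12 / 13 * s.a₁ ≤ s.a₁ * s.a₅ := by
  have h1 := mul_le_mul_of_nonneg_left hs.a₅_ge hs.a₁_pos.le
  have h2 : s.a₁ * (4 * s.a₄ / s.a₁ + 12 / 13) = 4 * s.a₄ + 12 / 13 * s.a₁ := by
    have := hs.a₁_pos
    field_simp
  linarith

theorem eighty_le_a₆_mul : 80 * s.a₄ + 12 / 13 * s.a₂ ≤ s.a₂ * s.a₆ := by
  have h1 := mul_le_mul_of_nonneg_left hs.a₆_ge hs.a₂_pos.le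
  have h2 : s.a₂ * (80 * s.a₄ / s.a₂ + 12 / 13) = 80 * s.a₄ + 12 / 13 * s.a₂ := by
    have := hs.a₂_pos
    field_simp
  linarith

theorem a₅_pos : 0 < s.a₅ := by
  have h1 := hs.a₅_ge
  have h2 := hs.a₄_pos
  have h3 := hs.a₁_pos
  have : 0 < 4 * s.a₄ / s.a₁ := by positivity
  linarith

theorem a₆_pos : 0 < s.a₆ := by
  have h1 := hs.a₆_ge
  have h2 := hs.a₄_pos
  have h3 := hs.a₂_pos
  have : 0 < 80 * s.a₄ / s.a₂ := by positivity
  linarith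

theorem γ_pos (k : ℕ) : 0 < s.γ k := by
  rw [γ_eq]; have := root_pos (k + 1); have := hs.a₅_pos; positivity

theorem θ_pos (k : ℕ) : 0 < s.θ k := by
  rw [θ_eq]; have := root_pos (k + 1); have := hs.a₆_pos; positivity

theorem a₄_sq_le : 320 * s.a₄ ^ 2 ≤ s.β ^ 2 := by
  have h1 := hs.a₄_le.trans (min_le_right _ _)
  rw [le_div_iff₀ (by positivity)] at h1
  have h2 := pow_le_pow_left₀ (by have := hs.a₄_pos; positivity) h1 2
  have h3 : (s.a₄ * (8 * √5)) ^ 2 = 64 * s.a₄ ^ 2 * (√5) ^ 2 := by ring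
  rw [h3, Real.sq_sqrt (by norm_num)] at h2
  linarith

include hl

/-- If `L ≤ 0`, then `ρ₁ ≥ L`, and `L = l + ρ₁` contradicts `l > 0`. -/
theorem L_pos : 0 < s.L := by
  have h1 := hs.L_eq
  rw [ρ_eq] at h1
  have h2 := one_le_root 1
  by_contra! h3
  have h4 : s.L ≤ s.L / root 1 ^ 2 := by
    rw [le_div_iff₀ (by positivity)]
    nlinarith [one_le_pow₀ h2 (n := 2)]
  linarith

/-- The Lipschitz constant `l` of the unregularized gradients is much smaller than `L`. -/
theorem l_le : l ≤ s.L / 8 := by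
  have h1 := hs.L_eq
  rw [ρ_eq] at h1
  have hL := hs.L_pos hl
  -- Here `root 1 ^ 2 = 2^{2/13} = 4^{1/13}`, and `(8/7)^13 ≥ 4`. So `ρ₁ ≥ 7L/8`.
  have h2 : root 1 ^ 2 ≤ 8 / 7 := by
    rw [root_pow]
    have h3 : ((8 / 7 : ℝ) ^ (13 : ℕ)) ^ ((2 : ℝ) / 13 / 2) = 8 / 7 := by
      rw [← Real.rpow_natCast, ← Real.rpow_mul (by norm_num)]; norm_num
    rw [← h3]
    have h4 : (((1 : ℕ) : ℝ) + 1) ^ (((2 : ℕ) : ℝ) / 13) = ((4 : ℝ)) ^ ((2 : ℝ) / 13 / 2) := by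
      have : (4 : ℝ) = 2 ^ (2 : ℝ) := by norm_num
      rw [this, ← Real.rpow_mul (by norm_num)]
      norm_num
    rw [h4]
    exact Real.rpow_le_rpow (by norm_num) (by norm_num) (by norm_num)
  have h5 : s.L * (7 / 8) ≤ s.L / root 1 ^ 2 := by
    rw [le_div_iff₀ (pow_pos (root_pos 1) 2)]
    nlinarith
  linarith

theorem ρ_pos (k : ℕ) : 0 < s.ρ k := by
  rw [ρ_eq]; have := root_pos k; have := hs.L_pos hl; positivity

theorem ρ_succ_le (k : ℕ) : s.ρ (k + 1) ≤ s.ρ k := by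
  rw [ρ_eq, ρ_eq]
  have := root_pos k
  exact div_le_div_of_nonneg_left (hs.L_pos hl).le (by positivity)
    (pow_le_pow_left₀ this.le (root_le_root k.le_succ) 2)

theorem ρ_le (k : ℕ) : s.ρ k ≤ s.L := by
  rw [ρ_eq]
  exact div_le_self (hs.L_pos hl).le (one_le_pow₀ (one_le_root k))

theorem β_mul_L_le : s.β * s.L ≤ 1 / 6 := by
  have h1 := hs.β_le
  have := hs.L_pos hl
  rw [le_div_iff₀ (by positivity)] at h1
  linarith

theorem a₄_mul_L_le : s.a₄ * s.L ≤ 1 / 8 := by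
  have h1 := hs.a₄_le.trans (min_le_left _ _)
  have := hs.L_pos hl
  rw [le_div_iff₀ (by positivity)] at h1
  linarith

theorem a₁_mul_le : s.a₁ * (32 * s.a₄ * s.L ^ 2) ≤ s.b ∧ s.a₁ * (2 * s.L * s.β) ≤ s.b * s.a₄ := by
  have := hs.L_pos hl
  have := hs.a₄_pos
  have := hs.β_pos
  have h1 := hs.a₁_le.trans (min_le_left _ _)
  have h2 := hs.a₁_le.trans (min_le_right _ _)
  rw [le_div_iff₀ (by positivity)] at h1 h2
  exact ⟨h1, h2⟩

theorem a₂_mul_le : s.a₂ * (32 * s.a₄ * s.L ^ 2) ≤ s.b ∧ s.a₂ * (2 * s.L * s.β) ≤ s.b * s.a₄ := by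
  have := hs.L_pos hl
  have := hs.a₄_pos
  have := hs.β_pos
  have h1 := hs.a₂_le.trans (min_le_left _ _)
  have h2 := hs.a₂_le.trans (min_le_right _ _)
  rw [le_div_iff₀ (by positivity)] at h1 h2
  exact ⟨h1, h2⟩

end Admissible

end Params

/-! ### Runs of the algorithm: error recursions and measurability. -/

/-- The assumptions on a run of the algorithm, bundled. -/
structure Run {dx dy : ℕ} {Z Ω : Type*} [MeasurableSpace Z] {mΩ : MeasurableSpace Ω} (P : Measure Ω)
    (p : Problem dx dy Z) (l δ : ℝ) (s : Params) (ζ : ℕ → Fin s.b → Ω → Z) (x₁ : Vec dx)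
    (y₁ : Vec dy) (it : Iterates dx dy Ω) : Prop where
  regular : p.Regular l δ
  l_pos : 0 < l
  adm : s.Admissible l
  iid : IsIIDSample p P ζ
  x₁_mem : x₁ ∈ p.X
  y₁_mem : y₁ ∈ p.Y
  alg : IsFORMDANS p s ζ x₁ y₁ it

/-- The error of the estimator `v_k`. -/
def errX {dx dy : ℕ} {Z Ω : Type*} [MeasurableSpace Z] (p : Problem dx dy Z)
    (it : Iterates dx dy Ω) (k : ℕ) (ω : Ω) : Vec dx :=
  p.gGradX (it.x k ω) (it.y k ω) - it.v k ω

/-- The error of the estimator `w_k`. -/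
def errY {dx dy : ℕ} {Z Ω : Type*} [MeasurableSpace Z] (p : Problem dx dy Z) (s : Params)
    (it : Iterates dx dy Ω) (k : ℕ) (ω : Ω) : Vec dy :=
  p.gGradY (it.x k ω) (it.y k ω) - s.ρ k • it.y k ω - it.w k ω

/-- The `σ`-algebra generated by the samples with index in `S`. -/
@[reducible]
def sampleAlgebra {Z Ω : Type*} [MeasurableSpace Z] {b : ℕ} (ζ : ℕ → Fin b → Ω → Z)
    (S : Set (ℕ × Fin b)) : MeasurableSpace Ω :=
  ⨆ i ∈ S, MeasurableSpace.comap (ζ (i.1 + 1) i.2) inferInstance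

theorem measurable_sampleAlgebra {Z Ω : Type*} [MeasurableSpace Z] {b : ℕ}
    {ζ : ℕ → Fin b → Ω → Z} {S : Set (ℕ × Fin b)} {k : ℕ} {j : Fin b} (h : (k, j) ∈ S) :
    Measurable[sampleAlgebra ζ S] (ζ (k + 1) j) :=
  measurable_iff_comap_le.2
    (le_iSup₂_of_le (f := fun (i : ℕ × Fin b) (_ : i ∈ S) =>
      MeasurableSpace.comap (ζ (i.1 + 1) i.2) inferInstance) (k, j) h le_rfl)

namespace Run

variable {dx dy : ℕ} {Z Ω : Type*} [MeasurableSpace Z] {mΩ : MeasurableSpace Ω} {P : Measure Ω}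
  {p : Problem dx dy Z} {l δ : ℝ} {s : Params} {ζ : ℕ → Fin s.b → Ω → Z} {x₁ : Vec dx}
  {y₁ : Vec dy} {it : Iterates dx dy Ω} (R : Run P p l δ s ζ x₁ y₁ it)
include R

theorem sampleAlgebra_le (S : Set (ℕ × Fin s.b)) : sampleAlgebra ζ S ≤ mΩ :=
  iSup₂_le fun i _ => (R.iid.measurable (i.1 + 1) (Nat.le_add_left 1 _) i.2).comap_le

theorem indep_sampleAlgebra {S : Set (ℕ × Fin s.b)} {k : ℕ} {j : Fin s.b} (h : (k, j) ∉ S) :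
    Indep (sampleAlgebra ζ S) (MeasurableSpace.comap (ζ (k + 1) j) inferInstance) P := by
  have h1 := indep_iSup_of_disjoint
    (m := fun i : ℕ × Fin s.b => MeasurableSpace.comap (ζ (i.1 + 1) i.2) inferInstance)
    (fun i => (R.iid.measurable (i.1 + 1) (Nat.le_add_left 1 _) i.2).comap_le)
    ((iIndepFun_iff_iIndep _ _ _).1 R.iid.indep) (S := S) (T := {(k, j)}) (by simpa using h)
  simpa [sampleAlgebra] using h1

theorem mem (k : ℕ) (hk : 1 ≤ k) (ω : Ω) : it.x k ω ∈ p.X ∧ it.y k ω ∈ p.Y := by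
  induction k, hk using Nat.le_induction with
  | base => rw [R.alg.x_one, R.alg.y_one]; exact ⟨R.x₁_mem, R.y₁_mem⟩
  | succ k hk ih =>
    have e : ∀ {n : ℕ} (x xt : Vec n), x + s.η k • (xt - x) = (1 - s.η k) • x + s.η k • xt := by
      intro n x xt; module
    have h0 := (s.η_pos k).le
    have h1 := sub_nonneg.2 (s.η_le_one k)
    rw [R.alg.x_succ k hk, R.alg.y_succ k hk, R.alg.xt_succ k hk, R.alg.yt_succ k hk, e, e]
    exact ⟨R.regular.standing.X_convex ih.1 (R.regular.proxX_mem _ _) h1 h0 (by ring),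
      R.regular.standing.Y_convex ih.2 (R.regular.proxY_mem _ _) h1 h0 (by ring)⟩

theorem x_mem {k : ℕ} (hk : 1 ≤ k) (ω : Ω) : it.x k ω ∈ p.X := (R.mem k hk ω).1

theorem y_mem {k : ℕ} (hk : 1 ≤ k) (ω : Ω) : it.y k ω ∈ p.Y := (R.mem k hk ω).2

/-- The iterate `(x_k, y_k)` as a point of `X × Y`. -/
def point {k : ℕ} (hk : 1 ≤ k) (ω : Ω) : p.X × p.Y :=
  (⟨it.x k ω, R.x_mem hk ω⟩, ⟨it.y k ω, R.y_mem hk ω⟩)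

theorem v_succ_eq {k : ℕ} (hk : 1 ≤ k) (ω : Ω) : it.v (k + 1) ω =
    ∑ j, (1 / (s.b : ℝ)) • gradX p.G (it.x (k + 1) ω) (it.y (k + 1) ω) (ζ (k + 1) j ω) +
    (1 - s.γ k) • (it.v k ω -
      ∑ j, (1 / (s.b : ℝ)) • gradX p.G (it.x k ω) (it.y k ω) (ζ (k + 1) j ω)) := by
  rw [R.alg.v_succ k hk, batchGradX_Gt, batchGradX_Gt]

theorem w_succ_eq {k : ℕ} (hk : 1 ≤ k) (ω : Ω) : it.w (k + 1) ω =
    ∑ j, (1 / (s.b : ℝ)) • gradY p.G (it.x (k + 1) ω) (it.y (k + 1) ω) (ζ (k + 1) j ω)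
      - s.ρ (k + 1) • it.y (k + 1) ω +
    (1 - s.θ k) • (it.w k ω -
      (∑ j, (1 / (s.b : ℝ)) • gradY p.G (it.x k ω) (it.y k ω) (ζ (k + 1) j ω)
        - s.ρ k • it.y k ω)) := by
  rw [R.alg.w_succ k hk,
    R.regular.batchGradY_Gt s _ (R.x_mem (by omega) ω) (R.y_mem (by omega) ω) R.adm.b_pos,
    R.regular.batchGradY_Gt s _ (R.x_mem hk ω) (R.y_mem hk ω) R.adm.b_pos]

theorem sum_one_div_smul {n : ℕ} (u : Vec n) : ∑ _j : Fin s.b, (1 / (s.b : ℝ)) • u = u := by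
  have := R.adm.b_pos'
  rw [Finset.sum_const, Finset.card_univ, Fintype.card_fin, ← Nat.cast_smul_eq_nsmul ℝ, smul_smul,
    mul_one_div_cancel this.ne', one_smul]

/-- Puts the algorithm into the form of the abstract momentum step, with factor `1 - γ_k` and one
noise per sample of the batch. -/
theorem errX_succ {k : ℕ} (hk : 1 ≤ k) (ω : Ω) : errX p it (k + 1) ω =
    (1 - s.γ k) • errX p it k ω + ∑ j, (1 / (s.b : ℝ)) • momentumNoise p.D (oracleX p) (1 - s.γ k)
      (R.point (Nat.le_add_left 1 k) ω, R.point hk ω) (ζ (k + 1) j ω) := by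
  simp only [momentumNoise, errX, R.v_succ_eq hk, smul_sub, Finset.sum_sub_distrib,
    R.sum_one_div_smul, Finset.smul_sum, smul_comm (1 - s.γ k) (1 / (s.b : ℝ))]
  simp only [oracleX, point, Problem.gGradX]
  abel

end Run

namespace Run

variable {dx dy : ℕ} {Z Ω : Type*} [MeasurableSpace Z] {mΩ : MeasurableSpace Ω} {P : Measure Ω}
  {p : Problem dx dy Z} {l δ : ℝ} {s : Params} {ζ : ℕ → Fin s.b → Ω → Z} {x₁ : Vec dx}
  {y₁ : Vec dy} {it : Iterates dx dy Ω} (R : Run P p l δ s ζ x₁ y₁ it)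
include R

theorem errY_succ {k : ℕ} (hk : 1 ≤ k) (ω : Ω) : errY p s it (k + 1) ω =
    (1 - s.θ k) • errY p s it k ω + ∑ j, (1 / (s.b : ℝ)) • momentumNoise p.D (oracleY p)
      (1 - s.θ k) (R.point (Nat.le_add_left 1 k) ω, R.point hk ω) (ζ (k + 1) j ω) := by
  simp only [momentumNoise, errY, R.w_succ_eq hk, smul_sub, Finset.sum_sub_distrib,
    R.sum_one_div_smul, Finset.smul_sum, smul_comm (1 - s.θ k) (1 / (s.b : ℝ))]
  simp only [oracleY, point, Problem.gGradY]
  abel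

/-- The convention `γ₀ = 1`: the first error is a momentum step with factor `0` from a zero error.
The preceding point is then irrelevant and is taken to be the starting point. -/
theorem errX_one (ω : Ω) : errX p it 1 ω =
    (0 : ℝ) • (0 : Vec dx) + ∑ j, (1 / (s.b : ℝ)) • momentumNoise p.D (oracleX p) 0
      (R.point le_rfl ω, R.point le_rfl ω) (ζ 1 j ω) := by
  simp only [momentumNoise, errX, R.alg.v_one, batchGradX_Gt, zero_smul, zero_add, sub_zero,
    smul_sub, Finset.sum_sub_distrib, R.sum_one_div_smul]
  rfl

theorem errY_one (ω : Ω) : errY p s it 1 ω =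
    (0 : ℝ) • (0 : Vec dy) + ∑ j, (1 / (s.b : ℝ)) • momentumNoise p.D (oracleY p) 0
      (R.point le_rfl ω, R.point le_rfl ω) (ζ 1 j ω) := by
  simp only [momentumNoise, errY, R.alg.w_one,
    R.regular.batchGradY_Gt s 1 (R.x_mem le_rfl ω) (R.y_mem le_rfl ω) R.adm.b_pos, zero_smul,
    zero_add, sub_zero, smul_sub, Finset.sum_sub_distrib, R.sum_one_div_smul]
  rw [sub_sub_sub_cancel_right]
  rfl

section Measurability

omit R mΩ in
theorem _root_.FORMDA.Problem.Regular.measurable_gradX_comp (h : p.Regular l δ)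
    {m : MeasurableSpace Ω} {x : Ω → Vec dx} {y : Ω → Vec dy} {z : Ω → Z}
    (hxX : ∀ ω, x ω ∈ p.X) (hyY : ∀ ω, y ω ∈ p.Y) (hx : Measurable x) (hy : Measurable y)
    (hz : Measurable z) : Measurable fun ω => gradX p.G (x ω) (y ω) (z ω) := by
  have := h.standing.prob
  exact h.stochasticOracle_oracleX.measurable_uncurry.comp
    (((hx.subtype_mk (h := hxX)).prodMk (hy.subtype_mk (h := hyY))).prodMk hz)

omit R mΩ in
theorem _root_.FORMDA.Problem.Regular.measurable_gradY_comp (h : p.Regular l δ)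
    {m : MeasurableSpace Ω} {x : Ω → Vec dx} {y : Ω → Vec dy} {z : Ω → Z}
    (hxX : ∀ ω, x ω ∈ p.X) (hyY : ∀ ω, y ω ∈ p.Y) (hx : Measurable x) (hy : Measurable y)
    (hz : Measurable z) : Measurable fun ω => gradY p.G (x ω) (y ω) (z ω) := by
  have := h.standing.prob
  exact h.stochasticOracle_oracleY.measurable_uncurry.comp
    (((hx.subtype_mk (h := hxX)).prodMk (hy.subtype_mk (h := hyY))).prodMk hz)

omit mΩ R in
theorem _root_.FORMDA.measurable_comp_of_continuousOn {V : Type*} [TopologicalSpace V]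
    [MeasurableSpace V] [BorelSpace V] {S : Set V} {T : Type*}
    [TopologicalSpace T] [MeasurableSpace T] [BorelSpace T] {φ : V → T} {m : MeasurableSpace Ω}
    {x : Ω → V} (hφ : ContinuousOn φ S) (hxS : ∀ ω, x ω ∈ S) (hx : Measurable x) :
    Measurable fun ω => φ (x ω) :=
  (continuousOn_iff_continuous_domRestrict.1 hφ).measurable.comp (hx.subtype_mk (h := hxS))

omit mΩ R in
theorem _root_.FORMDA.measurable_const_smul {n : ℕ} {m : MeasurableSpace Ω} {u : Ω → Vec n}
    (hu : Measurable u) (c : ℝ) : Measurable fun ω => c • u ω := hu.const_smul c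

theorem measurable_step {m : MeasurableSpace Ω} {k : ℕ} (hk : 1 ≤ k) (hx : Measurable[m] (it.x k))
    (hy : Measurable[m] (it.y k)) (hv : Measurable[m] (it.v k)) (hw : Measurable[m] (it.w k)) :
    (Measurable[m] (it.xt (k + 1)) ∧ Measurable[m] (it.x (k + 1))) ∧
      (Measurable[m] (it.yt (k + 1)) ∧ Measurable[m] (it.y (k + 1))) := by
  have h := R.regular.standing
  have c1 := (continuous_prox h.X_compact h.X_nonempty h.f_convex h.f_cont
    (R.adm.α_pos k)).measurable
  have c2 := (continuous_prox h.Y_compact h.Y_nonempty h.h_convex h.h_cont R.adm.β_pos).measurable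
  have e1 : it.xt (k + 1) = fun ω => prox p.f p.X (s.α k) (it.x k ω - s.α k • it.v k ω) :=
    funext (R.alg.xt_succ k hk)
  have e2 : it.yt (k + 1) = fun ω => prox p.h p.Y s.β (it.y k ω + s.β • it.w k ω) :=
    funext (R.alg.yt_succ k hk)
  have e3 : it.x (k + 1) = fun ω => it.x k ω + s.η k • (it.xt (k + 1) ω - it.x k ω) :=
    funext (R.alg.x_succ k hk)
  have e4 : it.y (k + 1) = fun ω => it.y k ω + s.η k • (it.yt (k + 1) ω - it.y k ω) :=
    funext (R.alg.y_succ k hk)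
  have h1 : Measurable[m] (it.xt (k + 1)) := e1 ▸ c1.comp (hx.sub (measurable_const_smul hv _))
  have h2 : Measurable[m] (it.yt (k + 1)) := e2 ▸ c2.comp (hy.add (measurable_const_smul hw _))
  exact ⟨⟨h1, e3 ▸ hx.add (measurable_const_smul (h1.sub hx) _)⟩, h2, e4 ▸ hy.add (measurable_const_smul (h2.sub hy) _)⟩

/-- Stated for an arbitrary `σ`-algebra, because it is needed both for the ambient one and for those
generated by the samples drawn so far. -/
theorem measurable_iterates {m : MeasurableSpace Ω} {k : ℕ} (hk : 1 ≤ k) :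
    (∀ i, 1 ≤ i → i ≤ k → ∀ j, Measurable[m] (ζ i j)) →
    (Measurable[m] (it.x k) ∧ Measurable[m] (it.y k)) ∧
      Measurable[m] (it.v k) ∧ Measurable[m] (it.w k) := by
  induction k, hk using Nat.le_induction with
  | base =>
    intro hζ
    have e1 : it.x 1 = fun _ => x₁ := funext R.alg.x_one
    have e2 : it.y 1 = fun _ => y₁ := funext R.alg.y_one
    have hx : Measurable[m] (it.x 1) := e1 ▸ measurable_const
    have hy : Measurable[m] (it.y 1) := e2 ▸ measurable_const
    refine ⟨⟨hx, hy⟩, ?_, ?_⟩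
    · have e3 : it.v 1 = _ := funext fun ω => (R.alg.v_one ω).trans (batchGradX_Gt _ _ _ _ _)
      rw [e3]
      exact Finset.measurable_sum _ fun j _ => measurable_const_smul (R.regular.measurable_gradX_comp
        (R.x_mem le_rfl) (R.y_mem le_rfl) hx hy (hζ 1 le_rfl le_rfl j)) _
    · have e3 : it.w 1 = _ := funext fun ω => (R.alg.w_one ω).trans
        (R.regular.batchGradY_Gt s 1 (R.x_mem le_rfl ω) (R.y_mem le_rfl ω) R.adm.b_pos _)
      rw [e3]
      exact (Finset.measurable_sum _ fun j _ => measurable_const_smul (R.regular.measurable_gradY_comp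
        (R.x_mem le_rfl) (R.y_mem le_rfl) hx hy (hζ 1 le_rfl le_rfl j)) _).sub
        (measurable_const_smul hy _)
  | succ k hk ih =>
    intro hζ
    obtain ⟨⟨hx, hy⟩, hv, hw⟩ := ih fun i h1 h2 => hζ i h1 (by omega)
    obtain ⟨⟨-, hx'⟩, -, hy'⟩ := R.measurable_step hk hx hy hv hw
    have hk' : 1 ≤ k + 1 := by omega
    refine ⟨⟨hx', hy'⟩, ?_, ?_⟩
    · have e3 : it.v (k + 1) = _ := funext fun ω => R.v_succ_eq hk ω
      rw [e3]
      refine Measurable.add ?_ (measurable_const_smul (hv.sub ?_) _)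
      · exact Finset.measurable_sum _ fun j _ => measurable_const_smul (R.regular.measurable_gradX_comp
          (R.x_mem hk') (R.y_mem hk') hx' hy' (hζ _ hk' le_rfl j)) _
      · exact Finset.measurable_sum _ fun j _ => measurable_const_smul (R.regular.measurable_gradX_comp
          (R.x_mem hk) (R.y_mem hk) hx hy (hζ _ hk' le_rfl j)) _
    · have e3 : it.w (k + 1) = _ := funext fun ω => R.w_succ_eq hk ω
      rw [e3]
      refine Measurable.add (Measurable.sub ?_ (measurable_const_smul hy' _))
        (measurable_const_smul (hw.sub (Measurable.sub ?_ (measurable_const_smul hy _))) _)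
      · exact Finset.measurable_sum _ fun j _ => measurable_const_smul (R.regular.measurable_gradY_comp
          (R.x_mem hk') (R.y_mem hk') hx' hy' (hζ _ hk' le_rfl j)) _
      · exact Finset.measurable_sum _ fun j _ => measurable_const_smul (R.regular.measurable_gradY_comp
          (R.x_mem hk) (R.y_mem hk) hx hy (hζ _ hk' le_rfl j)) _

theorem measurable_point {m : MeasurableSpace Ω} {k : ℕ} (hk : 1 ≤ k) (hx : Measurable[m] (it.x k))
    (hy : Measurable[m] (it.y k)) : Measurable[m] (R.point hk) :=
  (hx.subtype_mk (h := R.x_mem hk)).prodMk (hy.subtype_mk (h := R.y_mem hk))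

theorem measurable_errX {m : MeasurableSpace Ω} {k : ℕ} (hk : 1 ≤ k) (hx : Measurable[m] (it.x k))
    (hy : Measurable[m] (it.y k)) (hv : Measurable[m] (it.v k)) : Measurable[m] (errX p it k) := by
  have := R.regular.standing.prob
  have h1 := R.regular.stochasticOracle_oracleX.continuous_mean.measurable
  exact (h1.comp (R.measurable_point hk hx hy)).sub hv

theorem measurable_errY {m : MeasurableSpace Ω} {k : ℕ} (hk : 1 ≤ k) (hx : Measurable[m] (it.x k))
    (hy : Measurable[m] (it.y k)) (hw : Measurable[m] (it.w k)) :
    Measurable[m] (errY p s it k) := by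
  have := R.regular.standing.prob
  have h1 := R.regular.stochasticOracle_oracleY.continuous_mean.measurable
  exact ((h1.comp (R.measurable_point hk hx hy)).sub (measurable_const_smul hy _)).sub hw

/-- Indices of the samples drawn before sample `j` of iteration `k + 1`. -/
def _root_.FORMDA.before {b : ℕ} (k : ℕ) (j : Fin b) : Set (ℕ × Fin b) :=
  {i | i.1 < k ∨ i.1 = k ∧ i.2 < j}

theorem measurable_iterates_before {k : ℕ} (hk : 1 ≤ k) (j : Fin s.b) :
    (Measurable[sampleAlgebra ζ (before k j)] (it.x k) ∧
      Measurable[sampleAlgebra ζ (before k j)] (it.y k)) ∧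
      Measurable[sampleAlgebra ζ (before k j)] (it.v k) ∧
      Measurable[sampleAlgebra ζ (before k j)] (it.w k) := by
  refine R.measurable_iterates hk fun i h1 h2 j' => ?_
  obtain ⟨i, rfl⟩ := Nat.exists_eq_add_of_le' h1
  exact measurable_sampleAlgebra (Or.inl (Nat.lt_of_succ_le h2))

theorem measurable_all {k : ℕ} (hk : 1 ≤ k) : (Measurable (it.x k) ∧ Measurable (it.y k)) ∧
    Measurable (it.v k) ∧ Measurable (it.w k) :=
  R.measurable_iterates hk fun i h1 _ j => R.iid.measurable i h1 j

end Measurability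

/-! ### Mean-square errors of the estimators. -/

section Moments

variable [IsProbabilityMeasure P]

/-- Mean-square recursion of the estimation errors, stated for both estimators at once. -/
theorem momentum_step {n : ℕ} {Γ : p.X × p.Y → Z → Vec n} {κ : ℝ}
    (hΓ : StochasticOracle p.D Γ κ δ) {r : ℝ} (hr0 : 0 ≤ r) (hr1 : r ≤ 1) {k : ℕ}
    {e : Ω → Vec n} {z' z : Ω → p.X × p.Y}
    (he : ∀ j : Fin s.b, Measurable[sampleAlgebra ζ (before k j)] e)
    (hz' : ∀ j : Fin s.b, Measurable[sampleAlgebra ζ (before k j)] z')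
    (hz : ∀ j : Fin s.b, Measurable[sampleAlgebra ζ (before k j)] z) (he2 : MemLp e 2 P) :
    MemLp (fun ω => r • e ω + ∑ j, (1 / (s.b : ℝ)) •
      momentumNoise p.D Γ r (z' ω, z ω) (ζ (k + 1) j ω)) 2 P ∧
    ∫ ω, ‖r • e ω + ∑ j, (1 / (s.b : ℝ)) •
      momentumNoise p.D Γ r (z' ω, z ω) (ζ (k + 1) j ω)‖ ^ 2 ∂P ≤
      r ^ 2 * ∫ ω, ‖e ω‖ ^ 2 ∂P +
      (8 * κ ^ 2 * ∫ ω, dist (z' ω) (z ω) ^ 2 ∂P + 2 * (1 - r) ^ 2 * δ ^ 2) / s.b := by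
  have := R.regular.standing.prob
  have := isCompact_iff_compactSpace.1 R.regular.standing.X_compact
  have := isCompact_iff_compactSpace.1 R.regular.standing.Y_compact
  have hk : 1 ≤ k + 1 := by omega
  exact hΓ.momentum_step R.adm.b_pos hr0 hr1 (fun j => R.sampleAlgebra_le (before k j))
    (fun j => R.indep_sampleAlgebra (by simp [before]))
    (fun i j hij => measurable_sampleAlgebra (Or.inr ⟨rfl, hij⟩)) hz' hz he
    (fun j => R.iid.measurable _ hk j) (fun j => R.iid.law _ hk j) he2

theorem memLp_err_one : MemLp (errX p it 1) 2 P ∧ MemLp (errY p s it 1) 2 P := by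
  have hz : ∀ j : Fin s.b, Measurable[sampleAlgebra ζ (before 0 j)] (R.point le_rfl) := fun j =>
    R.measurable_point (m := sampleAlgebra ζ (before 0 j)) le_rfl
      (by rw [funext R.alg.x_one]; exact measurable_const)
      (by rw [funext R.alg.y_one]; exact measurable_const)
  have h1 := (R.momentum_step R.regular.stochasticOracle_oracleX le_rfl zero_le_one (k := 0)
    (fun j => measurable_const) hz hz (memLp_const (0 : Vec dx))).1
  have h2 := (R.momentum_step R.regular.stochasticOracle_oracleY le_rfl zero_le_one (k := 0)
    (fun j => measurable_const) hz hz (memLp_const (0 : Vec dy))).1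
  rw [funext R.errX_one, funext R.errY_one]
  exact ⟨h1, h2⟩

theorem point_dist_integral_le {k : ℕ} (hk : 1 ≤ k) :
    Integrable (fun ω => ‖it.xt (k + 1) ω - it.x k ω‖ ^ 2) P ∧
    Integrable (fun ω => ‖it.yt (k + 1) ω - it.y k ω‖ ^ 2) P ∧
    ∫ ω, dist (R.point (Nat.le_add_left 1 k) ω) (R.point hk ω) ^ 2 ∂P ≤
      s.η k ^ 2 * (∫ ω, ‖it.xt (k + 1) ω - it.x k ω‖ ^ 2 ∂P +
        ∫ ω, ‖it.yt (k + 1) ω - it.y k ω‖ ^ 2 ∂P) := by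
  obtain ⟨⟨hx, hy⟩, hv, hw⟩ := R.measurable_all hk
  obtain ⟨⟨hxt, -⟩, hyt, -⟩ := R.measurable_step hk hx hy hv hw
  obtain ⟨C₁, hC₁⟩ := (R.regular.standing.X_compact.isBounded).exists_norm_le
  obtain ⟨C₂, hC₂⟩ := (R.regular.standing.Y_compact.isBounded).exists_norm_le
  have i1 : Integrable (fun ω => ‖it.xt (k + 1) ω - it.x k ω‖ ^ 2) P := by
    refine Integrable.of_bound ((hxt.sub hx).norm.pow_const 2).aestronglyMeasurable
      ((C₁ + C₁) ^ 2) (Filter.Eventually.of_forall fun ω => ?_)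
    rw [Real.norm_of_nonneg (by positivity)]
    refine pow_le_pow_left₀ (norm_nonneg _) ((norm_sub_le _ _).trans
      (add_le_add (hC₁ _ ?_) (hC₁ _ (R.x_mem hk ω)))) 2
    rw [R.alg.xt_succ k hk]
    exact R.regular.proxX_mem _ _
  have i2 : Integrable (fun ω => ‖it.yt (k + 1) ω - it.y k ω‖ ^ 2) P := by
    refine Integrable.of_bound ((hyt.sub hy).norm.pow_const 2).aestronglyMeasurable
      ((C₂ + C₂) ^ 2) (Filter.Eventually.of_forall fun ω => ?_)
    rw [Real.norm_of_nonneg (by positivity)]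
    refine pow_le_pow_left₀ (norm_nonneg _) ((norm_sub_le _ _).trans
      (add_le_add (hC₂ _ ?_) (hC₂ _ (R.y_mem hk ω)))) 2
    rw [R.alg.yt_succ k hk]
    exact R.regular.proxY_mem _ _
  refine ⟨i1, i2, ?_⟩
  rw [← integral_add i1 i2, ← integral_const_mul]
  refine integral_mono_of_nonneg (Filter.Eventually.of_forall fun ω => by positivity)
    ((i1.add i2).const_mul _) (Filter.Eventually.of_forall fun ω => ?_)
  refine (dist_sq_le _ _).trans (le_of_eq ?_)
  simp only [point, R.alg.x_succ k hk, R.alg.y_succ k hk, add_sub_cancel_left, norm_smul, mul_pow,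
    Real.norm_eq_abs, sq_abs]
  ring

theorem err_succ {k : ℕ} (hk : 1 ≤ k) (h1 : MemLp (errX p it k) 2 P)
    (h2 : MemLp (errY p s it k) 2 P) :
    (MemLp (errX p it (k + 1)) 2 P ∧ MemLp (errY p s it (k + 1)) 2 P) ∧
    ∫ ω, ‖errX p it (k + 1) ω‖ ^ 2 ∂P ≤ (1 - s.γ k) ^ 2 * ∫ ω, ‖errX p it k ω‖ ^ 2 ∂P +
      (s.L ^ 2 * s.η k ^ 2 * (∫ ω, ‖it.xt (k + 1) ω - it.x k ω‖ ^ 2 ∂P +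
        ∫ ω, ‖it.yt (k + 1) ω - it.y k ω‖ ^ 2 ∂P) + 2 * s.γ k ^ 2 * δ ^ 2) / s.b ∧
    ∫ ω, ‖errY p s it (k + 1) ω‖ ^ 2 ∂P ≤ (1 - s.θ k) ^ 2 * ∫ ω, ‖errY p s it k ω‖ ^ 2 ∂P +
      (s.L ^ 2 * s.η k ^ 2 * (∫ ω, ‖it.xt (k + 1) ω - it.x k ω‖ ^ 2 ∂P +
        ∫ ω, ‖it.yt (k + 1) ω - it.y k ω‖ ^ 2 ∂P) + 2 * s.θ k ^ 2 * δ ^ 2) / s.b := by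
  have hb := R.adm.b_pos'
  have hm := fun j => R.measurable_iterates_before hk j
  have hm' := fun j => R.measurable_step hk (hm j).1.1 (hm j).1.2 (hm j).2.1 (hm j).2.2
  have hz : ∀ j, Measurable[sampleAlgebra ζ (before k j)] (R.point hk) := fun j =>
    R.measurable_point hk (hm j).1.1 (hm j).1.2
  have hz' : ∀ j, Measurable[sampleAlgebra ζ (before k j)] (R.point (Nat.le_add_left 1 k)) :=
    fun j => R.measurable_point _ (hm' j).1.2 (hm' j).2.2
  have hex := fun j => R.measurable_errX hk (hm j).1.1 (hm j).1.2 (hm j).2.1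
  have hey := fun j => R.measurable_errY hk (hm j).1.1 (hm j).1.2 (hm j).2.2
  obtain ⟨a1, a2⟩ := R.momentum_step R.regular.stochasticOracle_oracleX
    (sub_nonneg.2 (R.adm.γ_le_one k hk)) (sub_le_self _ (R.adm.γ_pos k).le) hex hz' hz h1
  obtain ⟨b1, b2⟩ := R.momentum_step R.regular.stochasticOracle_oracleY
    (sub_nonneg.2 (R.adm.θ_le_one k hk)) (sub_le_self _ (R.adm.θ_pos k).le) hey hz' hz h2
  obtain ⟨-, -, hd⟩ := R.point_dist_integral_le (P := P) hk
  -- In the maximum metric on `X × Y` the oracles are `2l`-Lipschitz, and `32 l² ≤ L² / 2` because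
  -- `l ≤ L / 8`.
  have hl : 8 * (2 * l) ^ 2 ≤ s.L ^ 2 := by
    have := pow_le_pow_left₀ R.l_pos.le (R.adm.l_le R.l_pos) 2
    nlinarith [sq_nonneg s.L]
  have hd' : 8 * (2 * l) ^ 2 * ∫ ω, dist (R.point (Nat.le_add_left 1 k) ω) (R.point hk ω) ^ 2 ∂P ≤
      s.L ^ 2 * s.η k ^ 2 * (∫ ω, ‖it.xt (k + 1) ω - it.x k ω‖ ^ 2 ∂P +
        ∫ ω, ‖it.yt (k + 1) ω - it.y k ω‖ ^ 2 ∂P) := by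
    rw [mul_assoc (s.L ^ 2)]
    exact mul_le_mul hl hd (integral_nonneg fun _ => by positivity) (sq_nonneg _)
  rw [sub_sub_cancel] at a2 b2
  rw [funext (R.errX_succ hk), funext (R.errY_succ hk)]
  refine ⟨⟨a1, b1⟩, a2.trans ?_, b2.trans ?_⟩
  · gcongr
  · gcongr

theorem memLp_err {k : ℕ} (hk : 1 ≤ k) : MemLp (errX p it k) 2 P ∧ MemLp (errY p s it k) 2 P := by
  induction k, hk using Nat.le_induction with
  | base => exact R.memLp_err_one
  | succ k hk ih => exact (R.err_succ hk ih.1 ih.2).1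

end Moments

end Run

/-! ### The one-step inequalities in expectation. -/

section Expectations

variable {dx dy : ℕ} {Z Ω : Type*} [MeasurableSpace Z] [MeasurableSpace Ω]
  (p : Problem dx dy Z) (s : Params) (P : Measure Ω) (it : Iterates dx dy Ω) (k : ℕ)

/-- Expected regularized primal value. -/
def meanPrimal : ℝ := ∫ ω, (p.regMax (s.ρ k) (it.x k ω) + p.f (it.x k ω)) ∂P

/-- Mean-square error of `v_k`. -/
def meanErrX : ℝ := ∫ ω, ‖errX p it k ω‖ ^ 2 ∂P

/-- Mean-square error of `w_k`. -/
def meanErrY : ℝ := ∫ ω, ‖errY p s it k ω‖ ^ 2 ∂P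

/-- Mean-square distance to the inner maximizer. -/
def meanDist : ℝ := ∫ ω, ‖it.y k ω - p.regArgmax (s.ρ k) (it.x k ω)‖ ^ 2 ∂P

/-- Mean-square norm of the inner maximizer. -/
def meanArg : ℝ := ∫ ω, ‖p.regArgmax (s.ρ k) (it.x k ω)‖ ^ 2 ∂P

/-- Mean-square proximal step in `x`. -/
def meanStepX : ℝ := ∫ ω, ‖it.xt (k + 1) ω - it.x k ω‖ ^ 2 ∂P

/-- Mean-square proximal step in `y`. -/
def meanStepY : ℝ := ∫ ω, ‖it.yt (k + 1) ω - it.y k ω‖ ^ 2 ∂P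

/-- The quantity that controls the squared gap of the regularized problem. -/
def meanGapSq : ℝ := 2 / s.α k ^ 2 * meanStepX P it k + 2 * meanErrX p P it k +
  2 / s.β ^ 2 * meanStepY P it k + 2 * meanErrY p s P it k

theorem potential_eq : potential p s P it k = meanPrimal p s P it (k + 1)
    + s.D₁ k * meanErrX p P it (k + 1)
    + 8 * s.α k * s.L ^ 2 / (s.β * s.ρ (k + 1)) * meanDist p s P it (k + 1)
    + s.D₂ k * meanErrY p s P it (k + 1)
    - 40 * s.α (k + 1) * s.L ^ 2 * (s.ρ (k + 1) - s.ρ (k + 2)) /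
        (s.η (k + 1) * s.β ^ 2 * s.ρ (k + 2) ^ 3) * meanArg p s P it (k + 1)
    + 4 * s.D₂ (k + 1) * s.ρ (k + 1) ^ 2 * p.sigmaY ^ 2 / s.b := rfl

theorem meanErrX_nonneg : 0 ≤ meanErrX p P it k := integral_nonneg fun _ => by positivity
theorem meanErrY_nonneg : 0 ≤ meanErrY p s P it k := integral_nonneg fun _ => by positivity
theorem meanDist_nonneg : 0 ≤ meanDist p s P it k := integral_nonneg fun _ => by positivity
theorem meanArg_nonneg : 0 ≤ meanArg p s P it k := integral_nonneg fun _ => by positivity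
theorem meanStepX_nonneg : 0 ≤ meanStepX P it k := integral_nonneg fun _ => by positivity
theorem meanStepY_nonneg : 0 ≤ meanStepY P it k := integral_nonneg fun _ => by positivity

theorem integrable_comp_of_continuousOn {V : Type*} [TopologicalSpace V] [MeasurableSpace V]
    [BorelSpace V] {S : Set V} (hS : IsCompact S)
    [IsFiniteMeasure P] {φ : V → ℝ} {x : Ω → V} (hφ : ContinuousOn φ S)
    (hxS : ∀ ω, x ω ∈ S) (hx : Measurable x) : Integrable (fun ω => φ (x ω)) P := by
  obtain ⟨C, hC⟩ := hS.exists_bound_of_continuousOn hφ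
  exact Integrable.of_bound (measurable_comp_of_continuousOn hφ hxS hx).aestronglyMeasurable C
    (Filter.Eventually.of_forall fun ω => hC _ (hxS ω))

end Expectations

namespace Run

variable {dx dy : ℕ} {Z Ω : Type*} [MeasurableSpace Z] {mΩ : MeasurableSpace Ω} {P : Measure Ω}
  {p : Problem dx dy Z} {l δ : ℝ} {s : Params} {ζ : ℕ → Fin s.b → Ω → Z} {x₁ : Vec dx}
  {y₁ : Vec dy} {it : Iterates dx dy Ω} (R : Run P p l δ s ζ x₁ y₁ it) [IsProbabilityMeasure P]
include R

theorem integrable_primal (ρ : ℝ) {k : ℕ} (hk : 1 ≤ k) :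
    Integrable (fun ω => p.regMax ρ (it.x k ω) + p.f (it.x k ω)) P :=
  integrable_comp_of_continuousOn P R.regular.standing.X_compact
    (φ := fun x => p.regMax ρ x + p.f x)
    ((R.regular.continuousOn_regMax ρ).add R.regular.standing.f_cont) (R.x_mem hk)
    (R.measurable_all hk).1.1

theorem integrable_errX {k : ℕ} (hk : 1 ≤ k) : Integrable (fun ω => ‖errX p it k ω‖ ^ 2) P :=
  (memLp_two_iff_integrable_sq_norm (R.memLp_err hk).1.1).1 (R.memLp_err hk).1

theorem integrable_errY {k : ℕ} (hk : 1 ≤ k) : Integrable (fun ω => ‖errY p s it k ω‖ ^ 2) P :=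
  (memLp_two_iff_integrable_sq_norm (R.memLp_err hk).2.1).1 (R.memLp_err hk).2

omit [IsProbabilityMeasure P] in
theorem measurable_arg {ρ : ℝ} (hρ : 0 < ρ) {k : ℕ} (hk : 1 ≤ k) :
    Measurable (fun ω => p.regArgmax ρ (it.x k ω)) :=
  measurable_comp_of_continuousOn (R.regular.continuousOn_regArgmax hρ) (R.x_mem hk)
    (R.measurable_all hk).1.1

theorem integrable_arg {k : ℕ} (hk : 1 ≤ k) :
    Integrable (fun ω => ‖p.regArgmax (s.ρ k) (it.x k ω)‖ ^ 2) P := by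
  refine Integrable.of_bound ((R.measurable_arg (R.adm.ρ_pos R.l_pos k) hk).norm.pow_const
    2).aestronglyMeasurable (p.sigmaY ^ 2) (Filter.Eventually.of_forall fun ω => ?_)
  rw [Real.norm_of_nonneg (by positivity)]
  exact pow_le_pow_left₀ (norm_nonneg _)
    (R.regular.norm_le_sigmaY (R.regular.regArgmax_mem _ (R.x_mem hk ω))) 2

theorem meanArg_le {k : ℕ} (hk : 1 ≤ k) : meanArg p s P it k ≤ p.sigmaY ^ 2 := by
  have h := integral_mono (R.integrable_arg (P := P) hk) (integrable_const (p.sigmaY ^ 2)) fun ω =>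
    pow_le_pow_left₀ (norm_nonneg _)
      (R.regular.norm_le_sigmaY (R.regular.regArgmax_mem (s.ρ k) (R.x_mem hk ω))) 2
  simpa [meanArg] using h

theorem integrable_dist {k : ℕ} (hk : 1 ≤ k) :
    Integrable (fun ω => ‖it.y k ω - p.regArgmax (s.ρ k) (it.x k ω)‖ ^ 2) P := by
  refine Integrable.of_bound (((R.measurable_all hk).1.2.sub
    (R.measurable_arg (R.adm.ρ_pos R.l_pos k) hk)).norm.pow_const 2).aestronglyMeasurable
    ((p.sigmaY + p.sigmaY) ^ 2) (Filter.Eventually.of_forall fun ω => ?_)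
  rw [Real.norm_of_nonneg (by positivity)]
  exact pow_le_pow_left₀ (norm_nonneg _) ((norm_sub_le _ _).trans (add_le_add
    (R.regular.norm_le_sigmaY (R.y_mem hk ω))
    (R.regular.norm_le_sigmaY (R.regular.regArgmax_mem _ (R.x_mem hk ω))))) 2

theorem integrable_gap {k : ℕ} (hk : 1 ≤ k) :
    Integrable (fun ω => ‖p.gap (s.α k) s.β (it.x k ω) (it.y k ω)‖) P := by
  have hc : ContinuousOn (fun z : Vec dx × Vec dy => ‖p.gap (s.α k) s.β z.1 z.2‖) (p.X ×ˢ p.Y) :=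
    (R.regular.continuousOn_gap (R.adm.α_pos k) R.adm.β_pos).norm
  have hm : Measurable (fun ω => (it.x k ω, it.y k ω)) :=
    (R.measurable_all hk).1.1.prodMk (R.measurable_all hk).1.2
  have h := integrable_comp_of_continuousOn P
    (R.regular.standing.X_compact.prod R.regular.standing.Y_compact) hc
    (fun ω => Set.mk_mem_prod (R.x_mem hk ω) (R.y_mem hk ω)) hm
  exact h

theorem expGap_le {k : ℕ} (hk : 1 ≤ k) {ε : ℝ} (hε : 0 < ε) :
    expGap p s P it k ≤ meanGapSq p s P it k / ε + ε / 4 + s.ρ k * p.sigmaY := by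
  obtain ⟨i1, i2, -⟩ := R.point_dist_integral_le (P := P) hk
  have i3 := R.integrable_errX (P := P) hk
  have i4 := R.integrable_errY (P := P) hk
  have j1 := i1.const_mul (2 / s.α k ^ 2)
  have j2 := i3.const_mul 2
  have j3 := i2.const_mul (2 / s.β ^ 2)
  have j4 := i4.const_mul 2
  have j12 : Integrable (fun ω => 2 / s.α k ^ 2 * ‖it.xt (k + 1) ω - it.x k ω‖ ^ 2 +
      2 * ‖errX p it k ω‖ ^ 2) P := j1.add j2
  have j13 : Integrable (fun ω => 2 / s.α k ^ 2 * ‖it.xt (k + 1) ω - it.x k ω‖ ^ 2 +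
      2 * ‖errX p it k ω‖ ^ 2 + 2 / s.β ^ 2 * ‖it.yt (k + 1) ω - it.y k ω‖ ^ 2) P := j12.add j3
  have j14 : Integrable (fun ω => 2 / s.α k ^ 2 * ‖it.xt (k + 1) ω - it.x k ω‖ ^ 2 +
      2 * ‖errX p it k ω‖ ^ 2 + 2 / s.β ^ 2 * ‖it.yt (k + 1) ω - it.y k ω‖ ^ 2 +
      2 * ‖errY p s it k ω‖ ^ 2) P := j13.add j4
  have e : ∫ ω, (2 / s.α k ^ 2 * ‖it.xt (k + 1) ω - it.x k ω‖ ^ 2 +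
      2 * ‖errX p it k ω‖ ^ 2 + 2 / s.β ^ 2 * ‖it.yt (k + 1) ω - it.y k ω‖ ^ 2 +
      2 * ‖errY p s it k ω‖ ^ 2) ∂P = meanGapSq p s P it k := by
    rw [integral_add j13 j4, integral_add j12 j3, integral_add j1 j2]
    simp only [integral_const_mul]
    rfl
  have j15 : Integrable (fun ω => (2 / s.α k ^ 2 * ‖it.xt (k + 1) ω - it.x k ω‖ ^ 2 +
      2 * ‖errX p it k ω‖ ^ 2 + 2 / s.β ^ 2 * ‖it.yt (k + 1) ω - it.y k ω‖ ^ 2 +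
      2 * ‖errY p s it k ω‖ ^ 2) / ε + (ε / 4 + s.ρ k * p.sigmaY)) P :=
    (j14.div_const ε).add (integrable_const _)
  have h := integral_mono (R.integrable_gap hk) j15 fun ω =>
    (R.regular.norm_gap_le (R.adm.ρ_pos R.l_pos k) (R.adm.α_pos k) R.adm.β_pos
      (R.y_mem hk ω) (R.alg.xt_succ k hk ω) (R.alg.yt_succ k hk ω) hε).trans_eq (add_assoc _ _ _)
  refine h.trans (le_of_eq ?_)
  rw [integral_add (j14.div_const ε) (integrable_const _), integral_div, e]
  simp only [integral_const, probReal_univ, one_smul]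
  ring

theorem meanPrimal_succ_le {k : ℕ} (hk : 1 ≤ k) :
    meanPrimal p s P it (k + 1) ≤ meanPrimal p s P it k
      + 2 * (s.η k * s.α k) * s.L ^ 2 * meanDist p s P it k
      + 2 * (s.η k * s.α k) * meanErrX p P it k - 5 / 8 * (s.η k / s.α k) * meanStepX P it k
      + (s.ρ k - s.ρ (k + 1)) / 2 * p.sigmaY ^ 2 := by
  have hα := R.adm.α_pos k
  have hη := s.η_pos k
  have hρ := R.adm.ρ_pos R.l_pos k
  have hL := R.adm.L_pos R.l_pos
  have hl := R.adm.l_le R.l_pos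
  have hl2 : l ^ 2 ≤ s.L ^ 2 := pow_le_pow_left₀ R.l_pos.le (by linarith) 2
  have hK : s.α k * (l + l ^ 2 / (2 * s.ρ k)) ≤ 1 / 8 := by
    have h1 := R.adm.a₄_mul_L_le R.l_pos
    have h2 := one_le_root (k + 1)
    have h3 := root_le_root k.le_succ
    have h4 := one_le_root k
    have ha := R.adm.a₄_pos
    -- The curvature of the regularized maximum grows like `1 / ρ_k`, that is `root k ^ 2`; the step
    -- `α_k`, of order `root (k + 1) ^ (-4)`, more than compensates it.
    have h5 : l + l ^ 2 / (2 * s.ρ k) ≤ s.L * root (k + 1) ^ 4 := by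
      rw [Params.ρ_eq]
      have e : l ^ 2 / (2 * (s.L / root k ^ 2)) = l ^ 2 * root k ^ 2 / (2 * s.L) := by
        field_simp
      have h6 : l ^ 2 * root k ^ 2 / (2 * s.L) ≤ s.L / 2 * root k ^ 2 := by
        rw [div_le_iff₀ (by positivity)]
        nlinarith [mul_le_mul_of_nonneg_right hl2 (sq_nonneg (root k))]
      have h7 : root k ^ 2 ≤ root (k + 1) ^ 4 :=
        (pow_le_pow_left₀ (by linarith) h3 2).trans (pow_le_pow_right₀ h2 (by norm_num))
      have h8 : 1 ≤ root (k + 1) ^ 4 := one_le_pow₀ h2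
      rw [e]
      nlinarith [mul_le_mul_of_nonneg_left h7 hL.le, mul_le_mul_of_nonneg_left h8 hL.le]
    calc s.α k * (l + l ^ 2 / (2 * s.ρ k)) ≤ s.α k * (s.L * root (k + 1) ^ 4) :=
          mul_le_mul_of_nonneg_left h5 hα.le
      _ = s.a₄ * s.L := by
          rw [Params.α_eq]
          have : root (k + 1) ≠ 0 := (root_pos _).ne'
          field_simp
      _ ≤ 1 / 8 := h1
  obtain ⟨i1, -, -⟩ := R.point_dist_integral_le (P := P) hk
  have j0 := R.integrable_primal (P := P) (s.ρ k) hk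
  have j1 := (R.integrable_dist (P := P) hk).const_mul (2 * (s.η k * s.α k) * s.L ^ 2)
  have j2 := (R.integrable_errX (P := P) hk).const_mul (2 * (s.η k * s.α k))
  have j3 := i1.const_mul (5 / 8 * (s.η k / s.α k))
  have j4 : Integrable (fun _ : Ω => (s.ρ k - s.ρ (k + 1)) / 2 * p.sigmaY ^ 2) P :=
    integrable_const _
  have h := integral_mono (R.integrable_primal (P := P) (s.ρ (k + 1)) (Nat.le_add_left 1 k))
    ((((j0.add j1).add j2).sub j3).add j4) fun ω => by
      have h1 := R.regular.regMax_le_regMax_add (R.adm.ρ_succ_le R.l_pos k)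
        (R.x_mem (Nat.le_add_left 1 k) ω)
      have h2 := R.regular.regMax_step_le hρ hα hη.le (s.η_le_one k) hK (R.x_mem hk ω)
        (R.y_mem hk ω) (R.alg.xt_succ k hk ω) (R.alg.x_succ k hk ω)
      have h3 : 2 * (s.η k * s.α k) * l ^ 2 * ‖it.y k ω - p.regArgmax (s.ρ k) (it.x k ω)‖ ^ 2 ≤
          2 * (s.η k * s.α k) * s.L ^ 2 *
            ‖it.y k ω - p.regArgmax (s.ρ k) (it.x k ω)‖ ^ 2 := by
        gcongr
      simp only [Pi.add_apply, Pi.sub_apply, errX]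
      linarith
  refine h.trans (le_of_eq ?_)
  rw [integral_add' (((j0.add j1).add j2).sub j3) j4, integral_sub' ((j0.add j1).add j2) j3,
    integral_add' (j0.add j1) j2, integral_add' j0 j1]
  simp only [integral_const_mul, integral_const, probReal_univ, one_smul]
  rfl

/-- Contraction towards the old maximizer, then passage to the new one by Young's inequality with
weight `t / 4`, where `t = η_k β ρ_{k+1}`. A quarter of the contraction is given up for this. -/
theorem meanDist_succ_le {k : ℕ} (hk : 1 ≤ k) :
    meanDist p s P it (k + 1) ≤
      (1 - 3 / 4 * (s.η k * s.β * s.ρ (k + 1))) * meanDist p s P it k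
      - 2 / 3 * s.η k * meanStepY P it k + 2 * (s.η k * s.β / s.ρ k) * meanErrY p s P it k
      + 5 / (s.η k * s.β * s.ρ (k + 1)) *
        (s.L ^ 2 / s.ρ (k + 1) ^ 2 * s.η k ^ 2 * meanStepX P it k +
          (s.ρ k - s.ρ (k + 1)) / s.ρ (k + 1) *
            (meanArg p s P it (k + 1) - meanArg p s P it k)) := by
  have hβ := R.adm.β_pos
  have hη := s.η_pos k
  have hη1 := s.η_le_one k
  have hρ := R.adm.ρ_pos R.l_pos k
  have hρ' := R.adm.ρ_pos R.l_pos (k + 1)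
  have hρρ := R.adm.ρ_succ_le R.l_pos k
  have hρL := R.adm.ρ_le R.l_pos k
  have hL := R.adm.L_pos R.l_pos
  have hl := R.adm.l_le R.l_pos
  have hl2 : l ^ 2 ≤ s.L ^ 2 := pow_le_pow_left₀ R.l_pos.le (by linarith) 2
  have hβL := R.adm.β_mul_L_le R.l_pos
  have hK : 2 * s.β * (l + s.ρ k / 2) ≤ 1 / 3 := by nlinarith
  obtain ⟨i1, i2, -⟩ := R.point_dist_integral_le (P := P) hk
  set t := s.η k * s.β * s.ρ (k + 1) with ht
  have ht0 : 0 < t := by positivity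
  have ht1 : t ≤ 1 / 6 := by
    calc t ≤ 1 * s.β * s.L := by
          rw [ht]; gcongr; exact hρρ.trans hρL
      _ ≤ 1 / 6 := by linarith
  have j1 := (R.integrable_dist (P := P) hk).const_mul (1 - 3 / 4 * t)
  have j2 := i2.const_mul (2 / 3 * s.η k)
  have j3 := (R.integrable_errY (P := P) hk).const_mul (2 * (s.η k * s.β / s.ρ k))
  have j4 := i1.const_mul (s.L ^ 2 / s.ρ (k + 1) ^ 2 * s.η k ^ 2)
  have j5 := ((R.integrable_arg (P := P) (Nat.le_add_left 1 k)).sub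
    (R.integrable_arg (P := P) hk)).const_mul ((s.ρ k - s.ρ (k + 1)) / s.ρ (k + 1))
  have j6 := (j4.add j5).const_mul (5 / t)
  have h := integral_mono (R.integrable_dist (P := P) (Nat.le_add_left 1 k))
    (((j1.sub j2).add j3).add j6) fun ω => by
      have h1 := R.regular.norm_step_sub_regArgmax_sq_le hρ hβ hη.le hη1 hK (R.x_mem hk ω)
        (R.y_mem hk ω) (R.alg.yt_succ k hk ω) (R.alg.y_succ k hk ω)
      have h2 := R.regular.regArgmax_sub_sq_le hρ' hρρ (R.x_mem hk ω)
        (R.x_mem (Nat.le_add_left 1 k) ω)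
      have e1 : it.x (k + 1) ω - it.x k ω = s.η k • (it.xt (k + 1) ω - it.x k ω) := by
        rw [R.alg.x_succ k hk]; module
      rw [e1, norm_smul, mul_pow, Real.norm_of_nonneg hη.le] at h2
      simp only [Pi.add_apply, Pi.sub_apply, errY]
      set u := p.regArgmax (s.ρ k) (it.x k ω)
      set u' := p.regArgmax (s.ρ (k + 1)) (it.x (k + 1) ω)
      set y' := it.y (k + 1) ω
      set a := ‖it.y k ω - u‖
      set d := ‖it.yt (k + 1) ω - it.y k ω‖
      set d' := ‖it.xt (k + 1) ω - it.x k ω‖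
      set e := ‖p.gGradY (it.x k ω) (it.y k ω) - s.ρ k • it.y k ω - it.w k ω‖
      have h3 : ‖y' - u'‖ ^ 2 ≤ (1 + t / 4) * ‖y' - u‖ ^ 2 + (1 + 4 / t) * ‖u' - u‖ ^ 2 := by
        have h4 : ‖y' - u'‖ ≤ ‖y' - u‖ + ‖u' - u‖ := by
          calc ‖y' - u'‖ = ‖(y' - u) - (u' - u)‖ := by congr 1; module
            _ ≤ _ := norm_sub_le _ _
        have h5 : (1 + t / 4) * ‖y' - u‖ ^ 2 + (1 + 4 / t) * ‖u' - u‖ ^ 2 -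
            (‖y' - u‖ + ‖u' - u‖) ^ 2 = (t * ‖y' - u‖ - 4 * ‖u' - u‖) ^ 2 / (4 * t) := by
          field_simp; ring
        have h6 : 0 ≤ (t * ‖y' - u‖ - 4 * ‖u' - u‖) ^ 2 / (4 * t) := by positivity
        have h7 := pow_le_pow_left₀ (norm_nonneg _) h4 2
        linarith
      have h4 : ‖y' - u‖ ^ 2 ≤ (1 - t) * a ^ 2 - 2 / 3 * s.η k * d ^ 2 +
          s.η k * s.β / s.ρ k * e ^ 2 := by
        have : t * a ^ 2 ≤ s.η k * s.β * s.ρ k * a ^ 2 := by rw [ht]; gcongr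
        linarith
      -- Uses `(1 + t/4)(1 - t) ≤ 1 - 3t/4` and, on the error term, `1 + t/4 ≤ 2`.
      have h5 : (1 + t / 4) * ‖y' - u‖ ^ 2 ≤ (1 - 3 / 4 * t) * a ^ 2 - 2 / 3 * s.η k * d ^ 2 +
          2 * (s.η k * s.β / s.ρ k) * e ^ 2 := by
        have q1 := mul_le_mul_of_nonneg_left h4 (by linarith : 0 ≤ 1 + t / 4)
        have q2 : 0 ≤ s.η k * s.β / s.ρ k * e ^ 2 := by positivity
        have q3 : 0 ≤ s.η k * d ^ 2 := by positivity
        have q4 : 0 ≤ a ^ 2 := sq_nonneg a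
        nlinarith [mul_nonneg ht0.le q3, mul_nonneg (by linarith : 0 ≤ 1 - t / 4) q2,
          mul_nonneg (sq_nonneg t) q4]
      have h6 : (1 + 4 / t) * ‖u' - u‖ ^ 2 ≤ 5 / t * (s.L ^ 2 / s.ρ (k + 1) ^ 2 * s.η k ^ 2 *
          d' ^ 2 + (s.ρ k - s.ρ (k + 1)) / s.ρ (k + 1) * (‖u'‖ ^ 2 - ‖u‖ ^ 2)) := by
        have q1 : 1 + 4 / t ≤ 5 / t := by
          rw [le_div_iff₀ ht0, add_mul, div_mul_cancel₀ _ ht0.ne']; linarith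
        have q2 : l ^ 2 / s.ρ (k + 1) ^ 2 * (s.η k ^ 2 * d' ^ 2) ≤
            s.L ^ 2 / s.ρ (k + 1) ^ 2 * s.η k ^ 2 * d' ^ 2 := by
          rw [← mul_assoc]; gcongr
        exact mul_le_mul q1 (by linarith) (sq_nonneg _) (by positivity)
      linarith
  refine h.trans (le_of_eq ?_)
  rw [integral_add' ((j1.sub j2).add j3) j6, integral_add' (j1.sub j2) j3, integral_sub' j1 j2,
    integral_const_mul (5 / t)]
  simp only [Pi.add_apply]
  rw [integral_add j4 j5, integral_const_mul ((s.ρ k - s.ρ (k + 1)) / s.ρ (k + 1))]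
  simp only [Pi.sub_apply]
  rw [integral_sub (R.integrable_arg (P := P) (Nat.le_add_left 1 k)) (R.integrable_arg hk)]
  simp only [integral_const_mul]
  rfl

theorem meanErr_succ_le {k : ℕ} (hk : 1 ≤ k) :
    meanErrX p P it (k + 1) ≤ (1 - s.γ k) ^ 2 * meanErrX p P it k +
      (s.L ^ 2 * s.η k ^ 2 * (meanStepX P it k + meanStepY P it k) + 2 * s.γ k ^ 2 * δ ^ 2) / s.b ∧
    meanErrY p s P it (k + 1) ≤ (1 - s.θ k) ^ 2 * meanErrY p s P it k +
      (s.L ^ 2 * s.η k ^ 2 * (meanStepX P it k + meanStepY P it k) + 2 * s.θ k ^ 2 * δ ^ 2) / s.b :=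
  (R.err_succ hk (R.memLp_err hk).1 (R.memLp_err hk).2).2

/-- The maximum over `Y` is at least the value at one fixed `y₀`, which is bounded below on the
compact `X` uniformly in `k` because `ρ_k ≤ L`. -/
theorem exists_meanPrimal_ge : ∃ M : ℝ, ∀ k, 1 ≤ k → M ≤ meanPrimal p s P it k := by
  have h := R.regular.standing
  obtain ⟨y₀, hy₀⟩ := h.Y_nonempty
  have hg : ContinuousOn (fun x => p.g x y₀ + p.f x) p.X :=
    ContinuousOn.add (fun x hx => (R.regular.hasGradientWithinAt_x hx hy₀).continuousWithinAt)
      h.f_cont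
  obtain ⟨C, hC⟩ := h.X_compact.exists_bound_of_continuousOn hg
  refine ⟨-C - s.L / 2 * ‖y₀‖ ^ 2 - p.h y₀, fun k hk => ?_⟩
  have h1 := integral_mono (integrable_const (-C - s.L / 2 * ‖y₀‖ ^ 2 - p.h y₀))
    (R.integrable_primal (P := P) (s.ρ k) hk) fun ω => by
      have hx := R.x_mem hk ω
      have h1 := R.regular.regObj_le_regMax (s.ρ k) hx hy₀
      have h2 := (abs_le.1 ((Real.norm_eq_abs _).symm.le.trans (hC _ hx))).1
      have h3 := mul_le_mul_of_nonneg_right (R.adm.ρ_le R.l_pos k) (sq_nonneg ‖y₀‖)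
      simp only [Problem.regObj] at h1
      linarith
  simpa [meanPrimal] using h1

end Run

/-! ### Finite differences of powers of `root`. -/

theorem four_mul_pow_sub_le {a b : ℝ} (ha : 0 ≤ a) (hb : 0 ≤ b) :
    4 * (b ^ 13 - a ^ 13) ≤ 13 * b ^ 9 * (b ^ 4 - a ^ 4) := by
  -- Weighted AM-GM is the tangent inequality of the concave power `4/13`. Applied with both orders
  -- of `a`, `b` it compares the sum of `1 / root ^ 9` with its integral from both sides.
  have h := Real.geom_mean_le_arith_mean2_weighted (w₁ := 9 / 13) (w₂ := 4 / 13) (by norm_num)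
    (by norm_num) (pow_nonneg hb 13) (pow_nonneg ha 13) (by norm_num)
  have e1 : (b ^ 13) ^ (9 / 13 : ℝ) = b ^ 9 := by
    rw [← Real.rpow_natCast, ← Real.rpow_natCast, ← Real.rpow_mul hb]; norm_num
  have e2 : (a ^ 13) ^ (4 / 13 : ℝ) = a ^ 4 := by
    rw [← Real.rpow_natCast, ← Real.rpow_natCast, ← Real.rpow_mul ha]; norm_num
  rw [e1, e2] at h
  linarith

theorem root_succ_pow (k : ℕ) : root (k + 1) ^ 13 = root k ^ 13 + 1 := by
  rw [root_pow_thirteen, root_pow_thirteen]; push_cast; ring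

theorem one_div_root_le (k : ℕ) :
    1 / root (k + 1) ^ 9 ≤ 13 / 4 * (root (k + 1) ^ 4 - root k ^ 4) := by
  have h := four_mul_pow_sub_le (root_pos k).le (root_pos (k + 1)).le
  rw [div_le_iff₀ (pow_pos (root_pos _) 9)]
  linarith [root_succ_pow k]

theorem le_one_div_root (k : ℕ) :
    13 / 4 * (root (k + 1) ^ 4 - root k ^ 4) ≤ 1 / root k ^ 9 := by
  have h := four_mul_pow_sub_le (root_pos (k + 1)).le (root_pos k).le
  rw [le_div_iff₀ (pow_pos (root_pos _) 9)]
  linarith [root_succ_pow k]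

/-- Bounds the growth of the weights `D₁`, `D₂`. The derivative of the power `3/13` suggests `3/13`;
the factor two is slack, and `k ≥ 1` keeps consecutive values comparable. The constant is half of
the `12/13` in the conditions on `a₅`, `a₆`. -/
theorem root_cube_sub_le {k : ℕ} (hk : 1 ≤ k) :
    (root (k + 1) ^ 3 - root k ^ 3) * root (k + 1) ^ 9 ≤ 6 / 13 := by
  have hq := root_pos k
  have hq1 := one_le_root k
  have hqr := root_le_root k.le_succ
  have h13 := root_succ_pow k
  have hq13 : 2 ≤ root k ^ 13 := by
    rw [root_pow_thirteen]
    have : (1 : ℝ) ≤ k := by exact_mod_cast hk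
    linarith
  set r := root (k + 1)
  set q := root k
  have hr : 0 < r := hq.trans_le hqr
  have h1 : 13 * q ^ 12 * (r - q) ≤ 1 := by
    have h2 := one_add_mul_le_pow (a := r / q - 1) (by
      have : 0 ≤ r / q := by positivity
      linarith) 13
    rw [add_sub_cancel, div_pow, le_div_iff₀ (by positivity)] at h2
    have h3 : (1 + (13 : ℕ) * (r / q - 1)) * q ^ 13 = q ^ 13 + 13 * q ^ 12 * (r - q) := by
      field_simp; push_cast; ring
    rw [h3] at h2
    linarith
  have h2 : r ^ 11 ≤ 3 / 2 * q ^ 11 := by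
    have h3 : r ^ 11 * q ^ 2 ≤ r ^ 13 := by
      calc r ^ 11 * q ^ 2 ≤ r ^ 11 * r ^ 2 := by gcongr
        _ = r ^ 13 := by ring
    have h4 : r ^ 11 * q ^ 2 ≤ (3 / 2 * q ^ 11) * q ^ 2 := by
      calc _ ≤ r ^ 13 := h3
        _ ≤ 3 / 2 * q ^ 13 := by linarith
        _ = _ := by ring
    exact le_of_mul_le_mul_right h4 (by positivity)
  have h3 : r ^ 3 - q ^ 3 ≤ 3 * r ^ 2 * (r - q) := by
    nlinarith [mul_nonneg (sub_nonneg.2 hqr) (mul_nonneg hr.le (sub_nonneg.2 hqr)),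
      mul_nonneg (sub_nonneg.2 hqr) (mul_nonneg hq.le (sub_nonneg.2 hqr))]
  calc (r ^ 3 - q ^ 3) * r ^ 9 ≤ 3 * r ^ 2 * (r - q) * r ^ 9 := by gcongr
    _ = 3 * (r - q) * r ^ 11 := by ring
    _ ≤ 3 * (r - q) * (3 / 2 * q ^ 11) := by
        have := sub_nonneg.2 hqr
        gcongr
    _ ≤ 3 * (r - q) * (2 * q ^ 12) := by
        have := sub_nonneg.2 hqr
        gcongr ?_ * ?_
        have : q ^ 11 ≤ q ^ 12 := pow_le_pow_right₀ hq1 (by norm_num)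
        have : 0 ≤ q ^ 11 := by positivity
        linarith
    _ ≤ 6 / 13 := by linarith

theorem root_mul_root_le (k : ℕ) : root (k + 2) * root k ≤ root (k + 1) ^ 2 := by
  rw [← pow_le_pow_iff_left₀ (mul_pos (root_pos _) (root_pos _)).le
    (pow_nonneg (root_pos _).le 2) (show 13 ≠ 0 by norm_num), mul_pow, root_pow_thirteen,
    root_pow_thirteen]
  have : (root (k + 1) ^ 2) ^ 13 = (root (k + 1) ^ 13) ^ 2 := by ring
  rw [this, root_pow_thirteen]
  push_cast
  nlinarith

/-- The weights of the telescoping term of the potential decrease. -/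
theorem root_weight_succ_le (k : ℕ) :
    root (k + 2) ^ 5 * ((root (k + 2) / root (k + 1)) ^ 2 - 1) ≤
      root (k + 1) ^ 5 * ((root (k + 1) / root k) ^ 2 - 1) := by
  have hq := root_pos k
  have hr := root_pos (k + 1)
  have hn := root_pos (k + 2)
  have hqr := root_le_root k.le_succ
  have hrn := root_le_root (k + 1).le_succ
  have h1 := root_succ_pow k
  have h2 := root_succ_pow (k + 1)
  simp only [Nat.succ_eq_add_one] at hqr hrn
  set q := root k
  set r := root (k + 1)
  set n := root (k + 2)
  set c : ℝ := (r / n) ^ 13 with hc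
  have hc0 : 0 ≤ c := by positivity
  have hc1 : c ≤ 1 := pow_le_one₀ (by positivity) (div_le_one_of_le₀ hrn hn.le)
  have e1 : (q / r) ^ 13 = 1 + -(1 / r ^ 13) := by
    rw [div_pow]; field_simp; linarith
  have e2 : 1 + c * -(1 / r ^ 13) = (r / n) ^ 13 := by
    rw [hc, div_pow]; field_simp; linarith
  -- Bernoulli with exponent `c ∈ [0, 1]`: since `r^13 = q^13 + 1` and `n^13 = r^13 + 1`, the number
  -- `c = (r/n)^13` makes the linear bound `1 - c / r^13` equal to `(r/n)^13`.
  have h3 : ((q / r) ^ 13) ^ c ≤ (r / n) ^ 13 := by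
    rw [e1, ← e2]
    refine rpow_one_add_le_one_add_mul_self ?_ hc0 hc1
    have : 0 ≤ (q / r) ^ 13 := by positivity
    linarith
  have h4 : (q / r) ^ c ≤ r / n := by
    rw [← pow_le_pow_iff_left₀ (by positivity) (by positivity) (show 13 ≠ 0 by norm_num)]
    refine le_trans (le_of_eq ?_) h3
    rw [← Real.rpow_natCast, ← Real.rpow_natCast, ← Real.rpow_mul (by positivity),
      ← Real.rpow_mul (by positivity), mul_comm]
  have h5 : n / r ≤ (r / q) ^ c := by
    have : (r / q) ^ c = ((q / r) ^ c)⁻¹ := by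
      rw [← Real.inv_rpow (by positivity), inv_div]
    rw [this, ← inv_div r n]
    exact inv_anti₀ (by positivity) h4
  -- A second Bernoulli inequality pulls `c` out of the exponent; then `n^5 c = r^5 (r/n)^8 ≤ r^5`.
  have h6 : ((r / q) ^ 2) ^ c ≤ 1 + c * ((r / q) ^ 2 - 1) := by
    have h7 := rpow_one_add_le_one_add_mul_self (s := (r / q) ^ 2 - 1) (p := c) (by
      have : 0 ≤ (r / q) ^ 2 := by positivity
      linarith) hc0 hc1
    rwa [add_sub_cancel] at h7
  have h7 : (n / r) ^ 2 - 1 ≤ c * ((r / q) ^ 2 - 1) := by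
    have h8 : (n / r) ^ 2 ≤ ((r / q) ^ c) ^ 2 := pow_le_pow_left₀ (by positivity) h5 2
    have h9 : ((r / q) ^ c) ^ 2 = ((r / q) ^ 2) ^ c := by
      rw [← Real.rpow_natCast, ← Real.rpow_natCast, ← Real.rpow_mul (by positivity),
        ← Real.rpow_mul (by positivity), mul_comm]
    linarith
  have h8 : 0 ≤ (r / q) ^ 2 - 1 := by
    have : 1 ≤ r / q := (one_le_div hq).2 hqr
    nlinarith
  calc n ^ 5 * ((n / r) ^ 2 - 1) ≤ n ^ 5 * (c * ((r / q) ^ 2 - 1)) := by gcongr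
    _ = r ^ 5 * ((r / n) ^ 8 * ((r / q) ^ 2 - 1)) := by rw [hc]; field_simp
    _ ≤ r ^ 5 * (1 * ((r / q) ^ 2 - 1)) := by
        gcongr
        exact pow_le_one₀ (by positivity) (div_le_one_of_le₀ hrn hn.le)
    _ = _ := by rw [one_mul]

/-! ### Matching the coefficients of the potential. -/

namespace Params

variable (s : Params)

/-- The coefficient of the expected squared norm of the inner maximizer in the potential. -/
def weight (k : ℕ) : ℝ :=
  40 * s.α k * s.L ^ 2 * (s.ρ k - s.ρ (k + 1)) / (s.η k * s.β ^ 2 * s.ρ (k + 1) ^ 3)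

theorem η_mul_α (k : ℕ) : s.η k * s.α k = s.a₄ / root (k + 1) ^ 9 := by
  have := root_pos (k + 1)
  rw [η_eq, α_eq]; field_simp

namespace Admissible

variable {s} {l : ℝ} (hs : s.Admissible l) (hl : 0 < l)
include hs

include hl

theorem weight_eq (k : ℕ) : s.weight k =
    40 * s.a₄ / s.β ^ 2 * (root (k + 1) ^ 5 * ((root (k + 1) / root k) ^ 2 - 1)) := by
  have := root_pos (k + 1)
  have := root_pos k
  have := hs.L_pos hl
  have := hs.β_pos
  rw [weight, η_eq, α_eq, ρ_eq, ρ_eq]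
  field_simp

theorem weight_succ_le (k : ℕ) : s.weight (k + 1) ≤ s.weight k := by
  rw [hs.weight_eq hl, hs.weight_eq hl]
  have := hs.a₄_pos
  have := hs.β_pos
  exact mul_le_mul_of_nonneg_left (root_weight_succ_le k) (by positivity)

theorem weight_nonneg (k : ℕ) : 0 ≤ s.weight k := by
  rw [hs.weight_eq hl]
  have := hs.a₄_pos
  have := hs.β_pos
  have hq := root_pos k
  have hr := root_pos (k + 1)
  have : 1 ≤ root (k + 1) / root k := (one_le_div hq).2 (root_le_root k.le_succ)
  have : 0 ≤ (root (k + 1) / root k) ^ 2 - 1 := by nlinarith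
  positivity

/-- The contraction frees `6 η α L²`, more than the `2 η α L²` demanded by the primal descent; the
weight itself decreases like `root ^ (-2)`. -/
theorem coeff_dist (k : ℕ) : 2 * (s.η (k + 1) * s.α (k + 1)) * s.L ^ 2 +
    8 * s.α (k + 1) * s.L ^ 2 / (s.β * s.ρ (k + 2)) *
      (1 - 3 / 4 * (s.η (k + 1) * s.β * s.ρ (k + 2))) ≤
    8 * s.α k * s.L ^ 2 / (s.β * s.ρ (k + 1)) := by
  have hq := root_pos (k + 1)
  have hr := root_pos (k + 2)
  have hL := hs.L_pos hl
  have hβ := hs.β_pos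
  have ha := hs.a₄_pos
  have hρ := hs.ρ_pos hl (k + 2)
  have hη := s.η_pos (k + 1)
  have hα := hs.α_pos (k + 1)
  have e1 : 8 * s.α (k + 1) * s.L ^ 2 / (s.β * s.ρ (k + 2)) *
      (1 - 3 / 4 * (s.η (k + 1) * s.β * s.ρ (k + 2))) =
      8 * s.α (k + 1) * s.L ^ 2 / (s.β * s.ρ (k + 2)) -
        6 * (s.η (k + 1) * s.α (k + 1)) * s.L ^ 2 := by
    field_simp; ring
  have e2 : 8 * s.α (k + 1) * s.L ^ 2 / (s.β * s.ρ (k + 2)) =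
      8 * s.a₄ * s.L / s.β / root (k + 2) ^ 2 := by
    rw [α_eq, ρ_eq]; field_simp
  have e3 : 8 * s.α k * s.L ^ 2 / (s.β * s.ρ (k + 1)) =
      8 * s.a₄ * s.L / s.β / root (k + 1) ^ 2 := by
    rw [α_eq, ρ_eq]; field_simp
  have h1 : 8 * s.a₄ * s.L / s.β / root (k + 2) ^ 2 ≤
      8 * s.a₄ * s.L / s.β / root (k + 1) ^ 2 := by
    gcongr
    exact root_le_root (k + 1).le_succ
  have h2 : 0 ≤ s.η (k + 1) * s.α (k + 1) * s.L ^ 2 := by positivity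
  rw [e1, e2, e3]
  linarith

variable {d₁ : ℝ} (hd : 0 < d₁)

-- The contraction provides `a₁ a₅ / root ^ 9`. Half of it covers `2 d₁ a₄` by the choice of `d₁`;
-- the other half is at least `2 a₄ + (6/13) a₁`, the demand of the primal descent and the growth of
-- `D₁`.
omit hl in
theorem coeff_errX (hd₃ : d₁ ≤ s.a₁ * s.a₅ / (4 * s.a₄)) (k : ℕ) :
    2 * (s.η (k + 1) * s.α (k + 1)) + s.D₁ (k + 1) * (1 - s.γ (k + 1)) ^ 2 +
      2 * (d₁ * (s.η (k + 1) * s.α (k + 1))) ≤ s.D₁ k := by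
  have hr := root_pos (k + 2)
  have ha := hs.a₄_pos
  have ha1 := hs.a₁_pos
  have hc := root_cube_sub_le (Nat.le_add_left 1 k)
  rw [le_div_iff₀ (by positivity)] at hd₃
  have h1 := hs.twelve_le_a₅_mul
  have hγ := hs.γ_pos (k + 1)
  have hγ1 := hs.γ_le_one (k + 1) (Nat.le_add_left 1 k)
  have h2 : s.D₁ (k + 1) * (1 - s.γ (k + 1)) ^ 2 ≤ s.D₁ (k + 1) - s.D₁ (k + 1) * s.γ (k + 1) := by
    have h3 : (1 - s.γ (k + 1)) ^ 2 ≤ 1 - s.γ (k + 1) := by nlinarith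
    have h4 : 0 ≤ s.D₁ (k + 1) := by rw [D₁_eq]; positivity
    nlinarith [mul_le_mul_of_nonneg_left h3 h4]
  have e1 : s.D₁ (k + 1) * s.γ (k + 1) = s.a₁ * s.a₅ / root (k + 2) ^ 9 := by
    rw [D₁_eq, γ_eq]; field_simp
  rw [e1] at h2
  rw [η_mul_α]
  rw [D₁_eq] at h2
  rw [D₁_eq, D₁_eq]
  have h3 : s.a₁ * (root (k + 2) ^ 3 - root (k + 1) ^ 3) ≤
      (s.a₁ * s.a₅ - 2 * s.a₄ - 2 * d₁ * s.a₄) / root (k + 2) ^ 9 := by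
    rw [le_div_iff₀ (by positivity)]
    nlinarith [mul_le_mul_of_nonneg_left hc ha1.le]
  have e2 : (s.a₁ * s.a₅ - 2 * s.a₄ - 2 * d₁ * s.a₄) / root (k + 2) ^ 9 =
      s.a₁ * s.a₅ / root (k + 2) ^ 9 - 2 * (s.a₄ / root (k + 2) ^ 9) -
        2 * (d₁ * (s.a₄ / root (k + 2) ^ 9)) := by ring
  linarith

-- The same budget as for the other estimator, at the larger scale `root ^ (-5)`; the demand is now
-- `16 a₄` and comes from the recursion of the inner distance.
include hd in
theorem coeff_errY (hd₃ : d₁ ≤ s.a₂ * s.a₆ / (4 * s.a₄)) (k : ℕ) :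
    8 * s.α (k + 1) * s.L ^ 2 / (s.β * s.ρ (k + 2)) *
      (2 * (s.η (k + 1) * s.β / s.ρ (k + 1))) + s.D₂ (k + 1) * (1 - s.θ (k + 1)) ^ 2 +
      2 * (d₁ * (s.η (k + 1) * s.α (k + 1))) ≤ s.D₂ k := by
  have hr := root_pos (k + 2)
  have hr1 := one_le_root (k + 2)
  have hq := root_pos (k + 1)
  have hqr := root_le_root (k + 1).le_succ
  have ha := hs.a₄_pos
  have ha1 := hs.a₂_pos
  have hL := hs.L_pos hl
  have hβ := hs.β_pos
  have hc := root_cube_sub_le (Nat.le_add_left 1 k)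
  rw [le_div_iff₀ (by positivity)] at hd₃
  have h1 := hs.eighty_le_a₆_mul
  have hγ := hs.θ_pos (k + 1)
  have hγ1 := hs.θ_le_one (k + 1) (Nat.le_add_left 1 k)
  have h2 : s.D₂ (k + 1) * (1 - s.θ (k + 1)) ^ 2 ≤ s.D₂ (k + 1) - s.D₂ (k + 1) * s.θ (k + 1) := by
    have h3 : (1 - s.θ (k + 1)) ^ 2 ≤ 1 - s.θ (k + 1) := by nlinarith
    have h4 : 0 ≤ s.D₂ (k + 1) := by rw [D₂_eq]; positivity
    nlinarith [mul_le_mul_of_nonneg_left h3 h4]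
  have e1 : s.D₂ (k + 1) * s.θ (k + 1) = s.a₂ * s.a₆ / root (k + 2) ^ 5 := by
    rw [D₂_eq, θ_eq]; field_simp
  have e3 : 8 * s.α (k + 1) * s.L ^ 2 / (s.β * s.ρ (k + 2)) *
      (2 * (s.η (k + 1) * s.β / s.ρ (k + 1))) =
      16 * (s.a₄ * root (k + 1) ^ 2 / root (k + 2) ^ 7) := by
    rw [α_eq, η_eq, ρ_eq, ρ_eq]; field_simp; ring
  have h4 : s.a₄ * root (k + 1) ^ 2 / root (k + 2) ^ 7 ≤ s.a₄ / root (k + 2) ^ 5 := by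
    rw [div_le_div_iff₀ (by positivity) (by positivity)]
    calc s.a₄ * root (k + 1) ^ 2 * root (k + 2) ^ 5 ≤
          s.a₄ * root (k + 2) ^ 2 * root (k + 2) ^ 5 := by gcongr
      _ = _ := by ring
  have h5 : s.a₄ / root (k + 2) ^ 9 ≤ s.a₄ / root (k + 2) ^ 5 :=
    div_le_div_of_nonneg_left ha.le (by positivity) (pow_le_pow_right₀ hr1 (by norm_num))
  rw [e1] at h2
  rw [η_mul_α, e3]
  rw [D₂_eq] at h2
  rw [D₂_eq, D₂_eq]
  have h3 : s.a₂ * (root (k + 2) ^ 3 - root (k + 1) ^ 3) ≤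
      (s.a₂ * s.a₆ - 16 * s.a₄ - 2 * d₁ * s.a₄) / root (k + 2) ^ 5 := by
    rw [le_div_iff₀ (by positivity)]
    have h6 : (root (k + 2) ^ 3 - root (k + 1) ^ 3) * root (k + 2) ^ 5 ≤ 6 / 13 := by
      refine le_trans (mul_le_mul_of_nonneg_left
        (pow_le_pow_right₀ hr1 (by norm_num : 5 ≤ 9)) ?_) hc
      exact sub_nonneg.2 (pow_le_pow_left₀ hq.le hqr 3)
    nlinarith [mul_le_mul_of_nonneg_left h6 ha1.le]
  have e2 : (s.a₂ * s.a₆ - 16 * s.a₄ - 2 * d₁ * s.a₄) / root (k + 2) ^ 5 =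
      s.a₂ * s.a₆ / root (k + 2) ^ 5 - 16 * (s.a₄ / root (k + 2) ^ 5) -
        2 * (d₁ * (s.a₄ / root (k + 2) ^ 5)) := by ring
  have h7 := mul_le_mul_of_nonneg_left h5 hd.le
  linarith

/-- In units of `η / α`, the estimators cost `1/16`, the drift of the maximizer `1/8` (this fixes
the bound `β / (8√5)` on `a₄`) and the gap `2 d₁ ≤ 1/4`, within the available `5/8`. -/
theorem coeff_stepX (hd₃ : d₁ ≤ 1 / 8) (k : ℕ) :
    (s.D₁ k + s.D₂ k) * (s.L ^ 2 * s.η k ^ 2 / s.b) +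
      8 * s.α k * s.L ^ 2 / (s.β * s.ρ (k + 1)) * (5 / (s.η k * s.β * s.ρ (k + 1)) *
        (s.L ^ 2 / s.ρ (k + 1) ^ 2 * s.η k ^ 2)) + d₁ * (s.η k * s.α k) * (2 / s.α k ^ 2) ≤
    5 / 8 * (s.η k / s.α k) := by
  have hr := root_pos (k + 1)
  have hr1 := one_le_root (k + 1)
  have ha := hs.a₄_pos
  have ha1 := hs.a₁_pos
  have ha2 := hs.a₂_pos
  have hL := hs.L_pos hl
  have hβ := hs.β_pos
  have hb := hs.b_pos'
  have hη := s.η_pos k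
  have hα := hs.α_pos k
  have h1 := (hs.a₁_mul_le hl).1
  have h2 := (hs.a₂_mul_le hl).1
  have h3 := hs.a₄_sq_le
  have e1 : (s.D₁ k + s.D₂ k) * (s.L ^ 2 * s.η k ^ 2 / s.b) =
      ((s.a₁ + s.a₂) * s.a₄ * s.L ^ 2 / s.b / root (k + 1) ^ 6) * (s.η k / s.α k) := by
    rw [D₁_eq, D₂_eq, η_eq, α_eq]; field_simp
  have e2 : 8 * s.α k * s.L ^ 2 / (s.β * s.ρ (k + 1)) * (5 / (s.η k * s.β * s.ρ (k + 1)) *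
      (s.L ^ 2 / s.ρ (k + 1) ^ 2 * s.η k ^ 2)) = 40 * s.a₄ ^ 2 / s.β ^ 2 * (s.η k / s.α k) := by
    rw [ρ_eq, η_eq, α_eq]; field_simp; ring
  have e3 : d₁ * (s.η k * s.α k) * (2 / s.α k ^ 2) = 2 * d₁ * (s.η k / s.α k) := by
    field_simp
  have h4 : (s.a₁ + s.a₂) * s.a₄ * s.L ^ 2 / s.b / root (k + 1) ^ 6 ≤ 1 / 16 := by
    refine (div_le_self (by positivity) (one_le_pow₀ hr1)).trans ?_
    rw [div_le_iff₀ hb]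
    linarith
  have h5 : 40 * s.a₄ ^ 2 / s.β ^ 2 ≤ 1 / 8 := by
    rw [div_le_iff₀ (by positivity)]
    linarith
  rw [e1, e2, e3, ← add_mul, ← add_mul]
  refine mul_le_mul_of_nonneg_right ?_ (by positivity)
  linarith

/-- In units of `(a₄ L / β) (η / root ^ 2)`, the estimators cost at most `1` and the gap at most
`2`, out of the `16/3` supplied by the inner step. -/
theorem coeff_stepY (hd₃ : d₁ ≤ s.L * s.β) (k : ℕ) :
    (s.D₁ k + s.D₂ k) * (s.L ^ 2 * s.η k ^ 2 / s.b) + d₁ * (s.η k * s.α k) * (2 / s.β ^ 2) ≤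
      8 * s.α k * s.L ^ 2 / (s.β * s.ρ (k + 1)) * (2 / 3 * s.η k) := by
  have hr := root_pos (k + 1)
  have hr1 := one_le_root (k + 1)
  have ha := hs.a₄_pos
  have ha1 := hs.a₁_pos
  have ha2 := hs.a₂_pos
  have hL := hs.L_pos hl
  have hβ := hs.β_pos
  have hb := hs.b_pos'
  have hη := s.η_pos k
  have h1 := (hs.a₁_mul_le hl).2
  have h2 := (hs.a₂_mul_le hl).2
  have e1 : (s.D₁ k + s.D₂ k) * (s.L ^ 2 * s.η k ^ 2 / s.b) =
      (s.a₁ + s.a₂) * s.L ^ 2 / s.b * (s.η k / root (k + 1) ^ 2) := by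
    rw [D₁_eq, D₂_eq, η_eq]; field_simp
  have e2 : 8 * s.α k * s.L ^ 2 / (s.β * s.ρ (k + 1)) * (2 / 3 * s.η k) =
      16 / 3 * (s.a₄ * s.L / s.β) * (s.η k / root (k + 1) ^ 2) := by
    rw [ρ_eq, α_eq]; field_simp; ring
  have e3 : d₁ * (s.η k * s.α k) * (2 / s.β ^ 2) =
      2 * d₁ * s.a₄ / s.β ^ 2 / root (k + 1) ^ 2 * (s.η k / root (k + 1) ^ 2) := by
    rw [α_eq]; field_simp
  have h3 : (s.a₁ + s.a₂) * s.L ^ 2 / s.b ≤ s.a₄ * s.L / s.β := by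
    rw [div_le_div_iff₀ hb hβ]
    nlinarith
  have h4 : 2 * d₁ * s.a₄ / s.β ^ 2 / root (k + 1) ^ 2 ≤ 2 * (s.a₄ * s.L / s.β) := by
    have h5 : 2 * d₁ * s.a₄ / s.β ^ 2 ≤ 2 * (s.a₄ * s.L / s.β) := by
      rw [div_le_iff₀ (by positivity)]
      have : 2 * (s.a₄ * s.L / s.β) * s.β ^ 2 = 2 * (s.L * s.β) * s.a₄ := by field_simp
      rw [this]
      gcongr
    have h6 : 0 ≤ 2 * (s.a₄ * s.L / s.β) := by positivity
    rw [div_le_iff₀ (by positivity)]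
    nlinarith [one_le_pow₀ hr1 (n := 2)]
  have h5 : 0 ≤ s.a₄ * s.L / s.β := by positivity
  rw [e1, e2, e3, ← add_mul]
  refine mul_le_mul_of_nonneg_right ?_ (by positivity)
  linarith

-- This noise is of order `root ^ (-21)`, summable with room to spare. The one of `w_k` is exactly
-- of order `root ^ (-13)`, the critical harmonic rate that produces the logarithm.
omit hl in
theorem D₁_mul_γ_sq_le (k : ℕ) : s.D₁ k * s.γ k ^ 2 ≤ s.a₅ ^ 2 * s.a₁ * (1 / ((k : ℝ) + 2)) := by
  have hr := root_pos (k + 1)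
  have ha1 := hs.a₁_pos
  have e1 : s.D₁ k * s.γ k ^ 2 = s.a₅ ^ 2 * s.a₁ * (1 / root (k + 1) ^ 21) := by
    rw [D₁_eq, γ_eq]; field_simp
  have e2 : (k : ℝ) + 2 = root (k + 1) ^ 13 := by rw [root_pow_thirteen]; push_cast; ring
  rw [e1, e2]
  gcongr
  · exact one_le_root _
  · norm_num

omit hl hs in
theorem _root_.FORMDA.Params.D₂_mul_θ_sq (k : ℕ) :
    s.D₂ k * s.θ k ^ 2 = s.a₆ ^ 2 * s.a₂ * (1 / ((k : ℝ) + 2)) := by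
  have hr := root_pos (k + 1)
  have e2 : (k : ℝ) + 2 = root (k + 1) ^ 13 := by rw [root_pow_thirteen]; push_cast; ring
  rw [e2, D₂_eq, θ_eq]
  field_simp

omit hl in
theorem D₂_mul_ρ_sq_succ_le (k : ℕ) :
    s.D₂ (k + 1) * s.ρ (k + 1) ^ 2 ≤ s.D₂ k * s.ρ k ^ 2 := by
  have hq := root_pos k
  have hr := root_pos (k + 1)
  have hn := root_pos (k + 2)
  have ha2 := hs.a₂_pos
  have e1 : s.D₂ (k + 1) * s.ρ (k + 1) ^ 2 =
      s.a₂ * s.L ^ 2 * (root (k + 2) ^ 3 / root (k + 1) ^ 4) := by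
    rw [D₂_eq, ρ_eq]; field_simp
  have e2 : s.D₂ k * s.ρ k ^ 2 = s.a₂ * s.L ^ 2 * (root (k + 1) ^ 3 / root k ^ 4) := by
    rw [D₂_eq, ρ_eq]; field_simp
  rw [e1, e2]
  refine mul_le_mul_of_nonneg_left ?_ (by positivity)
  rw [div_le_div_iff₀ (by positivity) (by positivity)]
  calc root (k + 2) ^ 3 * root k ^ 4 = (root (k + 2) * root k) ^ 3 * root k := by ring
    _ ≤ (root (k + 1) ^ 2) ^ 3 * root (k + 1) := by
        gcongr
        · exact root_mul_root_le k
        · exact root_le_root k.le_succ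
    _ = _ := by ring

end Admissible

end Params

/-! ### Decrease of the potential. -/

namespace Run

variable {dx dy : ℕ} {Z Ω : Type*} [MeasurableSpace Z] {mΩ : MeasurableSpace Ω} {P : Measure Ω}
  {p : Problem dx dy Z} {l δ : ℝ} {s : Params} {ζ : ℕ → Fin s.b → Ω → Z} {x₁ : Vec dx}
  {y₁ : Vec dy} {it : Iterates dx dy Ω} (R : Run P p l δ s ζ x₁ y₁ it) [IsProbabilityMeasure P]
  {d₁ : ℝ} (hd₁ : 0 < d₁)
  (hd₁_le : d₁ ≤ min (min (1 / 8) (s.L * s.β))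
    (min (s.a₁ * s.a₅ / (4 * s.a₄)) (s.a₂ * s.a₆ / (4 * s.a₄))))
include R

-- The factor with which the drift of the maximizer enters the potential is precisely the weight of
-- its negative term, which is what makes the drift telescope.
omit [IsProbabilityMeasure P] in
theorem weight_mul_eq (k : ℕ) : 8 * s.α k * s.L ^ 2 / (s.β * s.ρ (k + 1)) *
    (5 / (s.η k * s.β * s.ρ (k + 1)) * ((s.ρ k - s.ρ (k + 1)) / s.ρ (k + 1))) = s.weight k := by
  have := R.adm.ρ_pos R.l_pos (k + 1)
  have := R.adm.β_pos
  have := s.η_pos k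
  rw [Params.weight]
  field_simp
  ring

include hd₁ hd₁_le

/-- One step of the potential decrease. -/
theorem potential_succ_le (k : ℕ) :
    potential p s P it (k + 1) +
      d₁ * (s.η (k + 1) * s.α (k + 1) * meanGapSq p s P it (k + 1)) ≤
    potential p s P it k + (s.ρ (k + 1) - s.ρ (k + 2)) / 2 * p.sigmaY ^ 2 +
      (s.weight (k + 1) - s.weight (k + 2)) * p.sigmaY ^ 2 +
      2 * δ ^ 2 * (s.a₅ ^ 2 * s.a₁ + s.a₆ ^ 2 * s.a₂) / s.b * (1 / ((k : ℝ) + 3)) := by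
  have hk : 1 ≤ k + 1 := Nat.le_add_left 1 k
  have hd1 := hd₁_le.trans ((min_le_left _ _).trans (min_le_left _ _))
  have hd2 := hd₁_le.trans ((min_le_left _ _).trans (min_le_right _ _))
  have hd3 := hd₁_le.trans ((min_le_right _ _).trans (min_le_left _ _))
  have hd4 := hd₁_le.trans ((min_le_right _ _).trans (min_le_right _ _))
  have hb := R.adm.b_pos'
  have hρ := R.adm.ρ_pos R.l_pos (k + 2)
  have hα := R.adm.α_pos (k + 1)
  have hβ := R.adm.β_pos
  have hD1 : 0 ≤ s.D₁ (k + 1) := by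
    rw [Params.D₁_eq]; have := R.adm.a₁_pos; have := root_pos (k + 2); positivity
  have hD2 : 0 ≤ s.D₂ (k + 1) := by
    rw [Params.D₂_eq]; have := R.adm.a₂_pos; have := root_pos (k + 2); positivity
  set W := 8 * s.α (k + 1) * s.L ^ 2 / (s.β * s.ρ (k + 2)) with hW
  have hW0 : 0 ≤ W := by positivity
  set F := meanPrimal p s P it (k + 1)
  set F' := meanPrimal p s P it (k + 2)
  set X := meanErrX p P it (k + 1)
  set X' := meanErrX p P it (k + 2)
  set Y := meanErrY p s P it (k + 1)
  set Y' := meanErrY p s P it (k + 2)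
  set V := meanDist p s P it (k + 1)
  set V' := meanDist p s P it (k + 2)
  set U := meanArg p s P it (k + 1)
  set U' := meanArg p s P it (k + 2)
  set A := meanStepX P it (k + 1)
  set B := meanStepY P it (k + 1)
  have m1 : F' ≤ _ := R.meanPrimal_succ_le (P := P) hk
  have m2 : W * V' ≤ W * _ := mul_le_mul_of_nonneg_left (R.meanDist_succ_le (P := P) hk) hW0
  have m3 : s.D₁ (k + 1) * X' ≤ _ := mul_le_mul_of_nonneg_left (R.meanErr_succ_le (P := P) hk).1 hD1
  have m4 : s.D₂ (k + 1) * Y' ≤ _ := mul_le_mul_of_nonneg_left (R.meanErr_succ_le (P := P) hk).2 hD2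
  have c1 := mul_le_mul_of_nonneg_right (R.adm.coeff_dist R.l_pos k)
    (meanDist_nonneg p s P it (k + 1))
  have c2 := mul_le_mul_of_nonneg_right (R.adm.coeff_errX hd3 k)
    (meanErrX_nonneg p P it (k + 1))
  have c3 := mul_le_mul_of_nonneg_right (R.adm.coeff_errY R.l_pos hd₁ hd4 k)
    (meanErrY_nonneg p s P it (k + 1))
  have c4 := mul_le_mul_of_nonneg_right (R.adm.coeff_stepX R.l_pos hd1 (k + 1))
    (meanStepX_nonneg P it (k + 1))
  have c5 := mul_le_mul_of_nonneg_right (R.adm.coeff_stepY R.l_pos hd2 (k + 1))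
    (meanStepY_nonneg P it (k + 1))
  have c6 := R.weight_mul_eq (k + 1)
  have c7 := mul_le_mul_of_nonneg_left (R.meanArg_le (P := P) (Nat.le_add_left 1 (k + 1)))
    (sub_nonneg.2 (R.adm.weight_succ_le R.l_pos (k + 1)))
  have c8 : 4 * s.D₂ (k + 2) * s.ρ (k + 2) ^ 2 * p.sigmaY ^ 2 / s.b ≤
      4 * s.D₂ (k + 1) * s.ρ (k + 1) ^ 2 * p.sigmaY ^ 2 / s.b := by
    have := R.adm.D₂_mul_ρ_sq_succ_le (k + 1)
    have e : ∀ D ρ : ℝ, 4 * D * ρ ^ 2 * p.sigmaY ^ 2 / s.b =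
        4 * p.sigmaY ^ 2 / s.b * (D * ρ ^ 2) := fun D ρ => by ring
    rw [e, e]
    exact mul_le_mul_of_nonneg_left this (by positivity)
  have c9 := mul_le_mul_of_nonneg_left (add_le_add (R.adm.D₁_mul_γ_sq_le (k + 1))
    (Params.D₂_mul_θ_sq (s := s) (k + 1)).le) (by positivity : 0 ≤ 2 * δ ^ 2 / s.b)
  have e1 : ((k + 1 : ℕ) : ℝ) + 2 = (k : ℝ) + 3 := by push_cast; ring
  rw [e1] at c9
  rw [potential_eq, potential_eq, meanGapSq]
  change F' + _ * X' + W * V' + _ * Y' - s.weight (k + 2) * U' + _ + _ ≤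
    F + _ * X + _ * V + _ * Y - s.weight (k + 1) * U + _ + _ + _ + _
  -- The four recursions `m1`–`m4` and the coefficient bounds `c1`–`c5` carry the decrease; `c6` and
  -- `c7` perform the summation by parts in the norms of the maximizers, and `c8`, `c9` handle the
  -- deterministic term and the noise.
  linear_combination m1 + m2 + m3 + m4 + c1 + c2 + c3 + c4 + c5 + (U' - U) * c6 + c7 + c8 + c9

end Run

/-! ### Summation over the iterations and the rate. -/

/-- The constant of the logarithmic term in the potential decrease. -/
def noiseConst (s : Params) (δ : ℝ) : ℝ :=
  2 * δ ^ 2 * (s.a₅ ^ 2 * s.a₁ + s.a₆ ^ 2 * s.a₂) / s.b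

theorem one_div_add_log_le (t : ℕ) :
    1 / ((t : ℝ) + 3) + Real.log ((t : ℝ) + 2) ≤ Real.log ((t : ℝ) + 3) := by
  have h2 : (0 : ℝ) < (t : ℝ) + 2 := by positivity
  have h3 : (0 : ℝ) < (t : ℝ) + 3 := by positivity
  have h := Real.log_le_sub_one_of_pos (div_pos h2 h3)
  rw [Real.log_div h2.ne' h3.ne'] at h
  have e : ((t : ℝ) + 2) / (t + 3) - 1 = -(1 / ((t : ℝ) + 3)) := by field_simp; ring
  linarith

theorem le_sum_one_div_root (t : ℕ) : 13 / 4 * (root (t + 2) ^ 4 - root 2 ^ 4) ≤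
    ∑ k ∈ Finset.range t, 1 / root (k + 2) ^ 9 := by
  induction t with
  | zero => simp
  | succ t ih =>
    rw [Finset.sum_range_succ]
    have := le_one_div_root (t + 2)
    have e : t + 1 + 2 = t + 2 + 1 := by ring
    rw [e]
    linarith

-- The condition singles out the indices with `ρ_{k+1} σ_y > ε / 2` when `K = 2 L σ_y / ε`. They
-- form an initial segment, so the sum telescopes until `root ^ 4` reaches `K²`; the minimum is the
-- invariant that survives the induction.
open Classical in
theorem sum_bad_le (K : ℝ) (t : ℕ) :
    ∑ k ∈ Finset.range t, (if root (k + 1) ^ 2 < K then 1 / root (k + 2) ^ 9 else 0) ≤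
      13 / 4 * min (root t ^ 4) (K ^ 2) := by
  induction t with
  | zero =>
    have := root_pos 0
    simp only [Finset.range_zero, Finset.sum_empty]
    positivity
  | succ t ih =>
    rw [Finset.sum_range_succ]
    have h0 := root_pos t
    have h1 := root_pos (t + 1)
    have hle : root t ^ 4 ≤ root (t + 1) ^ 4 := pow_le_pow_left₀ h0.le (root_le_root t.le_succ) 4
    split_ifs with h
    · have h2 : root (t + 1) ^ 4 ≤ K ^ 2 := by
        have := pow_le_pow_left₀ (by positivity) h.le 2
        calc root (t + 1) ^ 4 = (root (t + 1) ^ 2) ^ 2 := by ring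
          _ ≤ K ^ 2 := this
      rw [min_eq_left h2]
      rw [min_eq_left (hle.trans h2)] at ih
      have h3 := one_div_root_le t
      have h4 : 1 / root (t + 2) ^ 9 ≤ 1 / root (t + 1) ^ 9 :=
        one_div_le_one_div_of_le (by positivity)
          (pow_le_pow_left₀ h1.le (root_le_root (t + 1).le_succ) 9)
      linarith
    · have : min (root t ^ 4) (K ^ 2) ≤ min (root (t + 1) ^ 4) (K ^ 2) :=
        min_le_min_right _ hle
      linarith

namespace Run

variable {dx dy : ℕ} {Z Ω : Type*} [MeasurableSpace Z] {mΩ : MeasurableSpace Ω} {P : Measure Ω}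
  {p : Problem dx dy Z} {l δ : ℝ} {s : Params} {ζ : ℕ → Fin s.b → Ω → Z} {x₁ : Vec dx}
  {y₁ : Vec dy} {it : Iterates dx dy Ω} (R : Run P p l δ s ζ x₁ y₁ it) [IsProbabilityMeasure P]
  {d₁ : ℝ} (hd₁ : 0 < d₁)
  (hd₁_le : d₁ ≤ min (min (1 / 8) (s.L * s.β))
    (min (s.a₁ * s.a₅ / (4 * s.a₄)) (s.a₂ * s.a₆ / (4 * s.a₄))))
include R

omit [IsProbabilityMeasure P] in
theorem noiseConst_nonneg : 0 ≤ noiseConst s δ := by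
  have := R.adm.a₁_pos
  have := R.adm.a₂_pos
  have := R.adm.b_pos'
  unfold noiseConst
  positivity

/-- The only negative correction is the weighted norm of the maximizer, bounded by the first weight
times `σ_y²`. -/
theorem bddBelow_potential : BddBelow (Set.range (potential p s P it)) := by
  obtain ⟨M, hM⟩ := R.exists_meanPrimal_ge (P := P)
  refine ⟨M - s.weight 0 * p.sigmaY ^ 2, ?_⟩
  rintro _ ⟨k, rfl⟩
  have hk : 1 ≤ k + 1 := Nat.le_add_left 1 k
  have hw : s.weight (k + 1) ≤ s.weight 0 :=
    antitone_nat_of_succ_le (f := s.weight) (R.adm.weight_succ_le R.l_pos) (Nat.zero_le _)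
  have hw0 := R.adm.weight_nonneg R.l_pos 0
  have h1 : s.weight (k + 1) * meanArg p s P it (k + 1) ≤ s.weight 0 * p.sigmaY ^ 2 :=
    mul_le_mul hw (R.meanArg_le hk) (meanArg_nonneg p s P it _) hw0
  have ha1 := R.adm.a₁_pos
  have ha2 := R.adm.a₂_pos
  have hr := root_pos (k + 1)
  have hr2 := root_pos (k + 2)
  have hα := R.adm.α_pos k
  have hβ := R.adm.β_pos
  have hρ := R.adm.ρ_pos R.l_pos (k + 1)
  have hL := R.adm.L_pos R.l_pos
  have hX := meanErrX_nonneg p P it (k + 1)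
  have hY := meanErrY_nonneg p s P it (k + 1)
  have hV := meanDist_nonneg p s P it (k + 1)
  have hF := hM (k + 1) hk
  have h2 : 0 ≤ s.D₁ k * meanErrX p P it (k + 1) := by rw [Params.D₁_eq]; positivity
  have h3 : 0 ≤ s.D₂ k * meanErrY p s P it (k + 1) := by rw [Params.D₂_eq]; positivity
  have h4 : 0 ≤ 8 * s.α k * s.L ^ 2 / (s.β * s.ρ (k + 1)) * meanDist p s P it (k + 1) := by
    positivity
  have h5 : 0 ≤ 4 * s.D₂ (k + 1) * s.ρ (k + 1) ^ 2 * p.sigmaY ^ 2 / s.b := by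
    rw [Params.D₂_eq]; positivity
  rw [potential_eq]
  change _ ≤ _ + _ + _ + _ - s.weight (k + 1) * meanArg p s P it (k + 1) + _
  linarith

theorem potentialInf_le (k : ℕ) : potentialInf p s P it ≤ potential p s P it k :=
  ciInf_le R.bddBelow_potential k

include hd₁ hd₁_le

theorem potential_add_sum_le (t : ℕ) :
    potential p s P it t + d₁ * ∑ k ∈ Finset.range t,
      s.η (k + 1) * s.α (k + 1) * meanGapSq p s P it (k + 1) ≤
    potential p s P it 0 + (s.ρ 1 - s.ρ (t + 1)) / 2 * p.sigmaY ^ 2 +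
      (s.weight 1 - s.weight (t + 1)) * p.sigmaY ^ 2 +
      noiseConst s δ * Real.log ((t : ℝ) + 2) := by
  induction t with
  | zero =>
    have h1 : 0 ≤ Real.log (((0 : ℕ) : ℝ) + 2) := Real.log_nonneg (by norm_num)
    have h2 := mul_nonneg R.noiseConst_nonneg h1
    simp only [Finset.range_zero, Finset.sum_empty, Nat.zero_add, sub_self, zero_div, zero_mul,
      mul_zero, add_zero]
    linarith
  | succ t ih =>
    have h1 := R.potential_succ_le hd₁ hd₁_le t
    have h2 := mul_le_mul_of_nonneg_left (one_div_add_log_le t) R.noiseConst_nonneg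
    rw [Finset.sum_range_succ, mul_add]
    have e : ((t + 1 : ℕ) : ℝ) + 2 = (t : ℝ) + 3 := by push_cast; ring
    rw [e]
    change _ ≤ _ + noiseConst s δ * _ at h1
    linarith

open Classical in
/-- As long as the expected gap exceeds `ε`, the rate bounds `ε² / 4`. -/
theorem sq_le_rate {ε : ℝ} (hε : 0 < ε) {t : ℕ} (ht : 1 ≤ t)
    (hgap : ∀ k, 1 ≤ k → k ≤ t → ε < expGap p s P it k) :
    ε ^ 2 / 4 ≤ rate p s P it δ d₁ t := by
  have hL := R.adm.L_pos R.l_pos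
  have ha := R.adm.a₄_pos
  have hβ := R.adm.β_pos
  have hb := R.adm.b_pos'
  have hσ := R.regular.sigmaY_nonneg
  set K := 2 * s.L * p.sigmaY / ε with hK
  have hK0 : 0 ≤ K := by positivity
  -- At indices where the bias exceeds `ε / 2` nothing is known about the gap, and the missing mass
  -- is added on the right instead.
  have hterm : ∀ k, k < t → s.a₄ * (ε ^ 2 / 4) * (1 / root (k + 2) ^ 9) ≤
      s.η (k + 1) * s.α (k + 1) * meanGapSq p s P it (k + 1) + s.a₄ * (ε ^ 2 / 4) *
        (if root (k + 1) ^ 2 < K then 1 / root (k + 2) ^ 9 else 0) := by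
    intro k hk
    have hr := root_pos (k + 1)
    have hr2 := root_pos (k + 2)
    have e : s.η (k + 1) * s.α (k + 1) = s.a₄ * (1 / root (k + 2) ^ 9) := by
      rw [Params.η_mul_α, mul_one_div]
    have hn : 0 ≤ meanGapSq p s P it (k + 1) := by
      have := meanStepX_nonneg P it (k + 1)
      have := meanStepY_nonneg P it (k + 1)
      have := meanErrX_nonneg p P it (k + 1)
      have := meanErrY_nonneg p s P it (k + 1)
      unfold meanGapSq
      positivity
    rw [e]
    split_ifs with h
    · have : 0 ≤ s.a₄ * (1 / root (k + 2) ^ 9) * meanGapSq p s P it (k + 1) := by positivity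
      linarith
    · rw [mul_zero, add_zero]
      have h1 : s.ρ (k + 1) * p.sigmaY ≤ ε / 2 := by
        rw [not_lt, hK, div_le_iff₀ hε] at h
        rw [Params.ρ_eq, div_mul_eq_mul_div, div_le_iff₀ (by positivity)]
        linarith
      have h2 := (hgap (k + 1) (Nat.le_add_left 1 k) hk).trans_le
        (R.expGap_le (Nat.le_add_left 1 k) hε)
      have h3 : ε / 4 < meanGapSq p s P it (k + 1) / ε := by linarith
      rw [lt_div_iff₀ hε] at h3
      have h4 : ε ^ 2 / 4 ≤ meanGapSq p s P it (k + 1) := by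
        calc ε ^ 2 / 4 = ε / 4 * ε := by ring
          _ ≤ _ := h3.le
      calc s.a₄ * (ε ^ 2 / 4) * (1 / root (k + 2) ^ 9)
          = s.a₄ * (1 / root (k + 2) ^ 9) * (ε ^ 2 / 4) := by ring
        _ ≤ _ := mul_le_mul_of_nonneg_left h4 (by positivity)
  have hsum := Finset.sum_le_sum fun k hk => hterm k (Finset.mem_range.1 hk)
  rw [Finset.sum_add_distrib, ← Finset.mul_sum, ← Finset.mul_sum] at hsum
  have h1 := R.potential_add_sum_le hd₁ hd₁_le t
  have h2 := R.potentialInf_le t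
  have h3 := mul_le_mul_of_nonneg_left (sum_bad_le K t)
    (by positivity : 0 ≤ s.a₄ * (ε ^ 2 / 4))
  have h4 := mul_le_mul_of_nonneg_left (le_sum_one_div_root t)
    (by positivity : 0 ≤ s.a₄ * (ε ^ 2 / 4))
  have h5 : s.a₄ * (ε ^ 2 / 4) * (13 / 4 * min (root t ^ 4) (K ^ 2)) ≤
      13 / 4 * s.a₄ * s.L ^ 2 * p.sigmaY ^ 2 := by
    calc _ ≤ s.a₄ * (ε ^ 2 / 4) * (13 / 4 * K ^ 2) := by gcongr; exact min_le_right _ _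
      _ = _ := by rw [hK]; field_simp; ring
  have h6 := mul_le_mul_of_nonneg_left (hsum.trans (add_le_add_right h3 _)) hd₁.le
  have h7 := mul_le_mul_of_nonneg_left h4 hd₁.le
  have h8 := mul_le_mul_of_nonneg_left h5 hd₁.le
  have hd1 := hd₁_le.trans ((min_le_left _ _).trans (min_le_left _ _))
  -- The last term of `C₁` contains `ρ₁` where the first weight has `ρ₁ - ρ₂`. The difference, `(40
  -- a₄ / β²) root 2 ^ 5 σ_y²`, absorbs the missing mass because `β L ≤ 1` and `d₁ ≤ 1/8`.
  have h9 : d₁ * (13 / 4 * s.a₄ * s.L ^ 2 * p.sigmaY ^ 2) + s.weight 1 * p.sigmaY ^ 2 ≤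
      40 * s.α 1 * s.L ^ 2 * s.ρ 1 / (s.η 1 * s.β ^ 2 * s.ρ 2 ^ 3) * p.sigmaY ^ 2 := by
    have hr := one_le_root 2
    have e1 : 40 * s.α 1 * s.L ^ 2 * s.ρ 1 / (s.η 1 * s.β ^ 2 * s.ρ 2 ^ 3) =
        s.weight 1 + 40 * s.a₄ / s.β ^ 2 * root 2 ^ 5 := by
      have hr0 := root_pos 2
      have hη := s.η_pos 1
      have hρ := R.adm.ρ_pos R.l_pos 2
      have e2 : 40 * s.a₄ / s.β ^ 2 * root 2 ^ 5 =
          40 * s.α 1 * s.L ^ 2 * s.ρ 2 / (s.η 1 * s.β ^ 2 * s.ρ 2 ^ 3) := by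
        rw [Params.α_eq, Params.η_eq, Params.ρ_eq]; field_simp
      rw [e2, Params.weight]
      ring
    have h10 : 40 * s.a₄ * s.L ^ 2 ≤ 40 * s.a₄ / s.β ^ 2 * root 2 ^ 5 := by
      have h11 : s.β ^ 2 * s.L ^ 2 ≤ 1 := by
        rw [← mul_pow]
        exact pow_le_one₀ (by positivity) ((R.adm.β_mul_L_le R.l_pos).trans (by norm_num))
      have h12 : 40 * s.a₄ * s.L ^ 2 ≤ 40 * s.a₄ / s.β ^ 2 := by
        rw [le_div_iff₀ (by positivity)]
        nlinarith
      exact h12.trans (le_mul_of_one_le_right (by positivity) (one_le_pow₀ hr))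
    have h11 : d₁ * (13 / 4 * s.a₄ * s.L ^ 2) ≤ 40 * s.a₄ * s.L ^ 2 := by
      have : 0 ≤ s.a₄ * s.L ^ 2 := by positivity
      nlinarith
    rw [e1]
    have := mul_le_mul_of_nonneg_right (h11.trans h10) (sq_nonneg p.sigmaY)
    linarith
  have h10 : 0 ≤ s.ρ (t + 1) / 2 * p.sigmaY ^ 2 := by
    have := R.adm.ρ_pos R.l_pos (t + 1)
    positivity
  have h11 : 0 ≤ s.weight (t + 1) * p.sigmaY ^ 2 :=
    mul_nonneg (R.adm.weight_nonneg R.l_pos _) (sq_nonneg _)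
  have h12 : noiseConst s δ * Real.log ((t : ℝ) + 2) ≤ C₂ p s δ * Real.log ((t : ℝ) + 2) := by
    refine mul_le_mul_of_nonneg_right ?_ (Real.log_nonneg (by linarith [t.cast_nonneg (α := ℝ)]))
    have : 0 ≤ 12 * s.a₂ * s.L ^ 2 * p.sigmaY ^ 2 / (13 * s.b) := by
      have := R.adm.a₂_pos
      positivity
    unfold C₂ noiseConst
    linarith
  have e4 : ((t : ℝ) + 3) ^ (4 / 13 : ℝ) = root (t + 2) ^ 4 := by
    rw [root_pow]; push_cast; congr 1; ring
  have e5 : (3 : ℝ) ^ (4 / 13 : ℝ) = root 2 ^ 4 := by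
    rw [root_pow]; push_cast; congr 1; norm_num
  have hpos : 0 < root (t + 2) ^ 4 - root 2 ^ 4 := by
    rw [← e4, ← e5, sub_pos]
    have : (1 : ℝ) ≤ t := by exact_mod_cast ht
    exact Real.rpow_lt_rpow (by norm_num) (by linarith) (by norm_num)
  rw [rate, e4, e5, le_div_iff₀ (by
    have : 13 / 4 * root (t + 2) ^ 4 - 13 * root 2 ^ 4 / 4 =
      13 / 4 * (root (t + 2) ^ 4 - root 2 ^ 4) := by ring
    rw [this]; positivity), C₁]
  linarith

end Run

/-! ### Inversion of the rate and conclusion. -/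

theorem log_one_div_ge {ε : ℝ} (hε : 0 < ε) (hε2 : ε ≤ 1 / 2) : 1 / 2 ≤ Real.log (1 / ε) := by
  have h1 : (2 : ℝ) ≤ 1 / ε := by rw [le_div_iff₀ hε]; linarith
  have := Real.log_le_log two_pos h1
  linarith [Real.log_two_gt_d9]

/-- Inversion of the rate: as long as it exceeds `ε² / 4`, the number of iterations is
`O(ε^{-13/2} log(1/ε)^{13/4})`. -/
theorem exists_complexity_bound (c₁ c₂ : ℝ) {κ : ℝ} (hκ : 0 < κ) :
    ∃ C : ℝ, 2 ^ (13 / 4 : ℝ) ≤ C ∧ ∀ ε : ℝ, 0 < ε → ε ≤ 1 / 2 → ∀ t : ℝ, 1 ≤ t →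
      ε ^ 2 / 4 ≤ (c₁ + c₂ * Real.log (t + 2)) /
        (κ * (13 / 4 * (t + 3) ^ (4 / 13 : ℝ) - 13 * 3 ^ (4 / 13 : ℝ) / 4)) →
      t + 1 ≤ C * ε ^ (-(13 / 2) : ℝ) * Real.log (1 / ε) ^ (13 / 4 : ℝ) := by
  set A := |c₁| + |c₂| with hA
  have hA0 : 0 ≤ A := by positivity
  set K := 2 + 16 * A / (13 * κ) with hK
  have hK0 : 0 < K := by positivity
  set K' := 13 / 3 * (2 * |Real.log (13 * K)| + 2) with hK'
  have hK'0 : 0 < K' := by positivity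
  -- The first entry serves the case `T(ε) = 1`: as `log (1/ε) ≥ 1/2`, it makes the bound at least
  -- `1`.
  refine ⟨max (2 ^ (13 / 4 : ℝ)) ((K * K') ^ (13 / 4 : ℝ)), le_max_left _ _, ?_⟩
  intro ε hε hε2 t ht hrate
  set u := t + 3 with hu
  have hu4 : 4 ≤ u := by linarith
  have hu0 : 0 < u := by linarith
  set r := u ^ (1 / 13 : ℝ) with hr
  have hr0 : 0 < r := by positivity
  set E := 1 / ε ^ 2 with hE
  have hE0 : 0 < E := by positivity
  have hE1 : 1 ≤ E := by
    rw [hE, le_div_iff₀ (by positivity)]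
    nlinarith
  set lam := Real.log (1 / ε) with hlam
  have hlam1 : 1 / 2 ≤ lam := log_one_div_ge hε hε2
  have hlogu : Real.log u = 13 * Real.log r := by
    rw [hr, Real.log_rpow hu0]; ring
  have hlogu1 : 1 ≤ Real.log u := by
    rw [Real.le_log_iff_exp_le hu0]
    linarith [Real.exp_one_lt_three]
  have hw : u ^ (4 / 13 : ℝ) = r ^ 4 := by
    rw [hr, ← Real.rpow_natCast, ← Real.rpow_mul hu0.le]
    norm_num
  have h3 : (3 : ℝ) ^ (4 / 13 : ℝ) ≤ 2 := by
    calc (3 : ℝ) ^ (4 / 13 : ℝ) ≤ 3 ^ (1 / 2 : ℝ) :=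
          Real.rpow_le_rpow_of_exponent_le (by norm_num) (by norm_num)
      _ ≤ 4 ^ (1 / 2 : ℝ) := Real.rpow_le_rpow (by norm_num) (by norm_num) (by norm_num)
      _ = 2 := by rw [← Real.sqrt_eq_rpow, show (4 : ℝ) = 2 ^ 2 by norm_num, Real.sqrt_sq two_pos.le]
  have hlt : (3 : ℝ) ^ (4 / 13 : ℝ) < u ^ (4 / 13 : ℝ) :=
    Real.rpow_lt_rpow (by norm_num) (by linarith) (by norm_num)
  have hden : 0 < κ * (13 / 4 * u ^ (4 / 13 : ℝ) - 13 * 3 ^ (4 / 13 : ℝ) / 4) :=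
    mul_pos hκ (by linarith)
  rw [le_div_iff₀ hden, hw] at hrate
  have hnum : c₁ + c₂ * Real.log (t + 2) ≤ A * Real.log u := by
    have h1 : 0 ≤ Real.log (t + 2) := Real.log_nonneg (by linarith)
    have h2 : Real.log (t + 2) ≤ Real.log u := Real.log_le_log (by linarith) (by linarith)
    have h4 : c₁ ≤ |c₁| * Real.log u :=
      (le_abs_self _).trans (le_mul_of_one_le_right (abs_nonneg _) hlogu1)
    have h5 : c₂ * Real.log (t + 2) ≤ |c₂| * Real.log u :=
      mul_le_mul (le_abs_self _) h2 h1 (abs_nonneg _)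
    rw [hA]; linarith
  -- The summand `2` of `K` accounts for the subtracted `3^{4/13} ≤ 2`.
  have hr4 : r ^ 4 ≤ K * E * Real.log u := by
    have h1 : r ^ 4 - 3 ^ (4 / 13 : ℝ) ≤ 16 * A / (13 * κ) * E * Real.log u := by
      have : 16 * A / (13 * κ) * E * Real.log u = 16 * (A * Real.log u) / (13 * κ * ε ^ 2) := by
        rw [hE]; field_simp
      rw [this, le_div_iff₀ (by positivity)]
      linarith
    have h2 : 1 ≤ E * Real.log u := one_le_mul_of_one_le_of_one_le hE1 hlogu1
    have e : K * E * Real.log u = 2 * (E * Real.log u) + 16 * A / (13 * κ) * E * Real.log u := by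
      rw [hK]; ring
    rw [e]; linarith
  -- Bootstrap: the crude bound `log u ≤ 13 r` gives a polynomial bound on `r` in `1/ε`. Hence `log
  -- u` is a multiple of `log (1/ε)`, which is inserted back into the bound on `r ^ 4`.
  have hr3 : r ^ 3 ≤ 13 * K * E := by
    have h1 : Real.log u ≤ 13 * r := by
      rw [hlogu]; linarith [Real.log_le_sub_one_of_pos hr0]
    have h2 : r ^ 3 * r ≤ 13 * K * E * r := by
      calc r ^ 3 * r = r ^ 4 := by ring
        _ ≤ K * E * Real.log u := hr4
        _ ≤ K * E * (13 * r) := by gcongr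
        _ = _ := by ring
    exact le_of_mul_le_mul_right h2 hr0
  have hlogu2 : Real.log u ≤ K' * lam := by
    have h1 := Real.log_le_log (by positivity) hr3
    have hlE : Real.log E = 2 * lam := by
      rw [hE, hlam, ← one_div_pow, Real.log_pow]; norm_num
    rw [Real.log_mul (by positivity) hE0.ne', hlE, Real.log_pow] at h1
    push_cast at h1
    have h2 : Real.log (13 * K) ≤ |Real.log (13 * K)| * (2 * lam) :=
      (le_abs_self _).trans (le_mul_of_one_le_right (abs_nonneg _) (by linarith))
    rw [hlogu, hK']; linarith
  have hr4' : r ^ 4 ≤ K * K' * E * lam := by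
    calc r ^ 4 ≤ K * E * Real.log u := hr4
      _ ≤ K * E * (K' * lam) := by gcongr
      _ = _ := by ring
  have hE' : E ^ (13 / 4 : ℝ) = ε ^ (-(13 / 2) : ℝ) := by
    have : E = ε ^ (-2 : ℝ) := by
      rw [hE, Real.rpow_neg hε.le, one_div]; norm_num
    rw [this, ← Real.rpow_mul hε.le]; norm_num
  have hu' : u = (r ^ 4) ^ (13 / 4 : ℝ) := by
    rw [← hw, ← Real.rpow_mul hu0.le]; norm_num
  have hlam0 : 0 ≤ lam := by linarith
  calc t + 1 ≤ u := by linarith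
    _ = (r ^ 4) ^ (13 / 4 : ℝ) := hu'
    _ ≤ (K * K' * E * lam) ^ (13 / 4 : ℝ) :=
        Real.rpow_le_rpow (by positivity) hr4' (by norm_num)
    _ = (K * K') ^ (13 / 4 : ℝ) * ε ^ (-(13 / 2) : ℝ) * lam ^ (13 / 4 : ℝ) := by
        rw [Real.mul_rpow (by positivity) hlam0, Real.mul_rpow (by positivity) hE0.le, hE']
    _ ≤ _ := by gcongr; exact le_max_right _ _

theorem one_le_complexity_bound {C ε : ℝ} (hC : 2 ^ (13 / 4 : ℝ) ≤ C) (hε : 0 < ε)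
    (hε2 : ε ≤ 1 / 2) : 1 ≤ C * ε ^ (-(13 / 2) : ℝ) * Real.log (1 / ε) ^ (13 / 4 : ℝ) := by
  have h1 : (1 : ℝ) ≤ ε ^ (-(13 / 2) : ℝ) :=
    Real.one_le_rpow_of_pos_of_le_one_of_nonpos hε (by linarith) (by norm_num)
  have h2 := Real.rpow_le_rpow (by norm_num) (log_one_div_ge hε hε2)
    (by norm_num : (0 : ℝ) ≤ 13 / 4)
  have hC0 : 0 < C := lt_of_lt_of_le (by positivity) hC
  calc (1 : ℝ) = 2 ^ (13 / 4 : ℝ) * 1 * (1 / 2) ^ (13 / 4 : ℝ) := by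
        rw [mul_one, ← Real.mul_rpow two_pos.le (by norm_num)]; norm_num
    _ ≤ _ := by gcongr

end FORMDA

end

theorem mainTheorem2 {dx dy : ℕ} {Z Ω : Type*} [MeasurableSpace Z] [MeasurableSpace Ω]
    (P : Measure Ω) [IsProbabilityMeasure P]
    (p : FORMDA.Problem dx dy Z) (hp : p.Standing)
    (l δ : ℝ) (hl : 0 < l) (hδ : 0 < δ)
    (hLip : p.LipschitzGradients l) (hVar : p.BoundedVariance δ)
    (s : FORMDA.Params) (hs : s.Admissible l)
    (ζ : ℕ → Fin s.b → Ω → Z) (hζ : FORMDA.IsIIDSample p P ζ)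
    (x₁ : FORMDA.Vec dx) (hx₁ : x₁ ∈ p.X) (y₁ : FORMDA.Vec dy) (hy₁ : y₁ ∈ p.Y)
    (it : FORMDA.Iterates dx dy Ω) (hit : FORMDA.IsFORMDANS p s ζ x₁ y₁ it)
    (d₁ : ℝ) (hd₁ : 0 < d₁)
    (hd₁_le : d₁ ≤ min (min (1 / 8) (s.L * s.β))
      (min (s.a₁ * s.a₅ / (4 * s.a₄)) (s.a₂ * s.a₆ / (4 * s.a₄)))) :
    -- the gap has finite expectation and the infimum in the definition of `C₁` is finite
    (∀ k : ℕ, 1 ≤ k →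
      Integrable (fun ω => ‖p.gap (s.α k) s.β (it.x k ω) (it.y k ω)‖) P) ∧
    BddBelow (Set.range (FORMDA.potential p s P it)) ∧
    -- the bound on `T(ε)`
    (∀ ε : ℝ, 0 < ε →
      (∃ k : ℕ, 1 ≤ k ∧ FORMDA.expGap p s P it k ≤ ε) ∧
      ∃ Tt : ℕ, 1 ≤ Tt ∧
        (2 ≤ Tt → ε ^ 2 / 4 ≤ FORMDA.rate p s P it δ d₁ ((Tt : ℝ) - 1)) ∧
        (FORMDA.firstStationary p s P it ε : ℝ) ≤
          max (Tt : ℝ) ((2 * s.L * p.sigmaY / ε) ^ (13 / 2 : ℝ) - 1)) ∧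
    -- the resulting complexity `T(ε) = Õ(ε^{-6.5})`
    (∃ C : ℝ, 0 < C ∧ ∀ ε : ℝ, 0 < ε → ε ≤ 1 / 2 →
      (FORMDA.firstStationary p s P it ε : ℝ) ≤
        C * ε ^ (-(13 / 2) : ℝ) * Real.log (1 / ε) ^ (13 / 4 : ℝ)) := by
  have R : FORMDA.Run P p l δ s ζ x₁ y₁ it := ⟨⟨hp, hl.le, hLip, hVar⟩, hl, hs, hζ, hx₁, hy₁, hit⟩
  obtain ⟨C, hC, hbound⟩ := FORMDA.exists_complexity_bound (FORMDA.C₁ p s P it)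
    (FORMDA.C₂ p s δ) (mul_pos hd₁ hs.a₄_pos)
  have hex : ∀ ε : ℝ, 0 < ε → ∃ k : ℕ, 1 ≤ k ∧ FORMDA.expGap p s P it k ≤ ε := by
    intro ε hε
    by_contra! hcon
    -- The inverted bound needs accuracy at most `1/2`. If no index qualified for `ε`, none would
    -- for the smaller accuracy, and the rate inequality would hold for arbitrarily large `t`.
    have hε' : 0 < min ε (1 / 2) := lt_min hε (by norm_num)
    set B := C * min ε (1 / 2) ^ (-(13 / 2) : ℝ) * Real.log (1 / min ε (1 / 2)) ^ (13 / 4 : ℝ)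
    obtain ⟨n, hn⟩ := exists_nat_gt B
    have hr := R.sq_le_rate hd₁ hd₁_le hε' (t := n + 1) (Nat.le_add_left 1 n)
      fun k hk _ => (min_le_left _ _).trans_lt (hcon k hk)
    have := hbound _ hε' (min_le_right _ _) ((n + 1 : ℕ) : ℝ) (by simp) hr
    push_cast at this
    linarith
  have hmem : ∀ ε : ℝ, 0 < ε → 1 ≤ FORMDA.firstStationary p s P it ε :=
    fun ε hε => (Nat.sInf_mem (s := {k | 1 ≤ k ∧ FORMDA.expGap p s P it k ≤ ε}) (hex ε hε)).1
  have hrate : ∀ ε : ℝ, 0 < ε → 2 ≤ FORMDA.firstStationary p s P it ε →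
      ε ^ 2 / 4 ≤ FORMDA.rate p s P it δ d₁ ((FORMDA.firstStationary p s P it ε : ℝ) - 1) := by
    intro ε hε h2
    -- By minimality the gap exceeds `ε` at every index before `T(ε)`.
    have hr := R.sq_le_rate hd₁ hd₁_le hε (t := FORMDA.firstStationary p s P it ε - 1) (by omega)
      fun k hk hkt => by
        by_contra! hcon
        have : FORMDA.firstStationary p s P it ε ≤ k := Nat.sInf_le ⟨hk, hcon⟩
        omega
    rwa [Nat.cast_sub (hmem ε hε), Nat.cast_one] at hr
  -- The witness for `T̃(ε)` is `T(ε)` itself, so the first entry of the maximum already suffices.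
  refine ⟨fun k hk => R.integrable_gap hk, R.bddBelow_potential, fun ε hε => ⟨hex ε hε,
    FORMDA.firstStationary p s P it ε, hmem ε hε, hrate ε hε, le_max_left _ _⟩,
    C, lt_of_lt_of_le (by positivity) hC, fun ε hε hε2 => ?_⟩
  rcases (hmem ε hε).eq_or_lt with h1 | h2
  · rw [← h1, Nat.cast_one]
    exact FORMDA.one_le_complexity_bound hC hε hε2
  · have h3 : (1 : ℝ) ≤ (FORMDA.firstStationary p s P it ε : ℝ) - 1 := by
      have : ((2 : ℕ) : ℝ) ≤ FORMDA.firstStationary p s P it ε := Nat.cast_le.2 h2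
      push_cast at this
      linarith
    have := hbound ε hε hε2 _ h3 (hrate ε hε h2)
    linarith
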